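/- **Conventions.** Let $S$ be a finite set and $f:S^3\to S$. The one-dimensional cellular automaton (CA) of radius $1$ with local map $f$ is $F:S^{\mathbb Z}\to S^{\mathbb Z}$, $F(c)_z=f(c_{z-1},c_z,c_{z+1})$; it also acts on finite words, mapping a word of length $n+2$ to a word of length $n$. * $\mathrm{PRED}_F$ is the problem: given $t>0$ and a pattern $u\in S^{[-t,t]}$, output the state $F^t(u)\in S$. (As $|u|=2t+1$, an input is written as the word $u$.) * $\mathrm{UBPRED}_F$ is the decision problem: given an eventually bi-periodic configuration $c={}^\infty u_L\cdot u\cdot u_R^\infty$ (finite words $u_L,u,u_R$ with $u_L,u_R$ nonempty, and a cut of $u=v\cdot w$ telling that cell $0$ is the first cell of $w\cdot u_R^\infty$) and a state $q$, decide whether $F^t(c)_0=q$ for some $t\in\mathbb N$. A problem (a function from instances, encoded as words, to a finite set of answers) is in polynomial time if a deterministic Turing machine computes the answer in time polynomial in the length of the input. A problem $X$ reduces to a problem $Y$ if there are a map $\rho$ from inputs of $X$ to inputs of $Y$, computable by a deterministic Turing machine in logarithmic work space, and a map $\sigma$ from answers of $Y$ to answers of $X$, such that the answer of $X$ on $i$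 is $\sigma$ of the answer of $Y$ on $\rho(i)$, for every input $i$. A problem is P-complete if it is in polynomial time and every language $L\subseteq\{0,1\}^*$ in P reduces to it. **The automaton $\mathcal Z_F$.** Let $F$ be a CA of radius $1$ on the finite alphabet $Q$ with local map $\delta:Q^3\to Q$. The CA $\mathcal Z_F$ has radius $1$ and alphabet $\{b,b_+,e\}\cup(Q\times Q\times\{\leftarrow,\rightarrow,l,r\})$. The new state of a cell with neighborhood (left cell, cell, right cell) is given by the first of the following items that applies. 1. If $e$ occurs in the neighborhood, the cell becomes $e$. 2. A cell in state $b$ or $b_+$ becomes $b$. 3. If the cell together with its left or its right neighbor forms one of the patterns $(x,y,r)(x',y',l)$, $(x,y,l)(x',y',r)$, $(x,y,z)(x',y',z')$, $(x,y,r)(x',y',z)$, $(x,y,z)(x',y',l)$ with $z,z'\in\{\leftarrow,\rightarrow\}$, the cell becomes $e$. 4. The following transitions: $$\begin{aligned} (x,y,l),(x',y',\leftarrow),(x'',y'',r)&\mapsto(x',y',r)\\ (x,y,l),(x',y',l),(x'',y'',\leftarrow)&\mapsto(x',y',\leftarrow)\\ (x,y,l),(x',y',\rightarrow),(x'',y'',r)&\mapsto(x',y',l)\\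 (x,y,\rightarrow),(x',y',r),(x'',y'',r)&\mapsto(\delta(y,x',x''),x',\rightarrow)\\ b,(x,y,l),(x',y',\leftarrow)&\mapsto(x,y,\leftarrow)\\ b,(x,y,\leftarrow),(x',y',r)&\mapsto(x,y,\rightarrow)\\ b,(x,y,\rightarrow),(x',y',r)&\mapsto(y,x,l)\\ b,(x,y,l),(x',y',\rightarrow)&\mapsto b_+\\ (x,y,\rightarrow),(x',y',r),b&\mapsto(x',y',\rightarrow)\\ (x,y,l),(x',y',\rightarrow),b&\mapsto(x',y',\leftarrow)\\ (x,y,l),(x',y',\leftarrow),b&\mapsto(x',y',r)\\ (x,y,\leftarrow),(x',y',r),b&\mapsto b_+\\ b',(x,y,z),b''&\mapsto(x,y,r)\qquad(b',b''\in\{b,b_+\},\ z\in\{\leftarrow,\rightarrow,l,r\}). \end{aligned}$$ 5. Otherwise the cell keeps its state. **Theorem.** For every CA $F$ of radius $1$ on a finite alphabet $Q$: 1. there is a constant $C$ such that, for every eventually bi-periodic configuration $c={}^\infty u_L\cdot u\cdot u_R^\infty$ of $\mathcal Z_F$, with $n=|u_L|+|u|+|u_R|$, the state of cell $0$ no longer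 changes from time $Cn^2$ on, i.e. $\mathcal Z_F^t(c)_0=\mathcal Z_F^{Cn^2}(c)_0$ for all $t\ge Cn^2$; 2. $\mathrm{UBPRED}_{\mathcal Z_F}$ is decidable in polynomial time; 3. if $\mathrm{PRED}_F$ is P-complete, then $\mathrm{PRED}_{\mathcal Z_F}$ is P-complete. -/

import Mathlib

/-! ### Problems, polynomial time, logarithmic space -/

/-- A computational problem with a single answer for every input: inputs are presented to machines
as words over `Symbol`.  Decision problems are those with `Answer = Bool`. -/
structure Problem where
  Input : Type
  Symbol : Type
  Answer : Type
  encode : Input → List Symbol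
  encode_injective : Function.Injective encode
  solution : Input → Answer

/-- The membership problem of a language of binary words. -/
noncomputable def Problem.ofLanguage (L : Language Bool) : Problem where
  Input := List Bool
  Symbol := Bool
  Answer := Bool
  encode := id
  encode_injective := Function.injective_id
  solution := fun w => by classical exact decide (w ∈ L)

/-- The problem is solved by a deterministic Turing machine in polynomial time.  The machine receives
the encoded input, and halts with the one-letter word consisting of the answer as its output. -/
def Problem.PolyTime (X : Problem) : Prop :=
  Nonempty (Turing.TM2ComputableInPolyTime X.encode (fun a : X.Answer => [a]) X.solution)

/-- What a machine sees on its input tape: an end marker or a letter. -/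
inductive InputSymbol (A : Type) where
  | leftEnd
  | letter (a : A)
  | rightEnd

/-- Head movements. -/
inductive HeadMove where
  | left
  | stay
  | right

def HeadMove.toInt : HeadMove → ℤ
  | .left => -1
  | .stay => 0
  | .right => 1

/-- One instruction of a transducer: next state, movement of the input head, symbol written and
movement on each work tape, and the letter (if any) appended to the output. -/
structure TransducerAction (State K Sym B : Type) where
  next : State
  inputMove : HeadMove
  write : K → Sym
  workMove : K → HeadMove
  emit : Option B

/-- Deterministic Turing machines with a two-way read-only input tape, finitely many two-way infinite
work tapes (indexed by `K`) and a write-only output tape.  The machine halts when `trans` gives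
`none`. -/
structure Transducer (A B : Type) where
  State : Type
  K : Type
  Sym : Type
  [stateFinite : Finite State]
  [tapesFinite : Finite K]
  [symFinite : Finite Sym]
  blank : Sym
  start : State
  trans : State → InputSymbol A → (K → Sym) → Option (TransducerAction State K Sym B)

namespace Transducer

variable {A B : Type} (M : Transducer A B)

/-- Configurations.  Input head position `0` is the left end marker, `1, …, |w|` are the letters of the
input `w`, and `|w| + 1` is the right end marker. -/
structure Config where
  state : M.State
  inputPos : ℕ
  head : M.K → ℤ
  tape : M.K → ℤ → M.Sym
  output : List B

def init : M.Config where
  state := M.start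
  inputPos := 0
  head := fun _ => 0
  tape := fun _ _ => M.blank
  output := []

def readInput (w : List A) : ℕ → InputSymbol A
  | 0 => .leftEnd
  | p + 1 => match w[p]? with
    | some a => .letter a
    | none => .rightEnd

/-- The input head cannot leave the segment between the two end markers. -/
def moveInput (w : List A) (p : ℕ) : HeadMove → ℕ
  | .left => p - 1
  | .stay => p
  | .right => min (p + 1) (w.length + 1)

/-- One step on input `w`; `none` if the machine halts in the given configuration. -/
def step (w : List A) (c : M.Config) : Option M.Config :=
  (M.trans c.state (readInput w c.inputPos) (fun k => c.tape k (c.head k))).map fun a =>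
    { state := a.next
      inputPos := moveInput w c.inputPos a.inputMove
      head := fun k => c.head k + (a.workMove k).toInt
      tape := fun k => Function.update (c.tape k) (c.head k) (a.write k)
      output := c.output ++ a.emit.toList }

/-- The configuration after `t` steps on input `w` (a halted machine stays where it is). -/
def run (w : List A) : ℕ → M.Config
  | 0 => M.init
  | t + 1 => (M.step w (run w t)).getD (run w t)

/-- On input `w` the machine halts with output `v`. -/
def HaltsWith (w : List A) (v : List B) : Prop :=
  ∃ t, M.step w (M.run w t) = none ∧ (M.run w t).output = v

/-- On input `w` all work heads stay within distance `s` of their starting cells. -/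
def UsesSpace (w : List A) (s : ℕ) : Prop :=
  ∀ t k, |(M.run w t).head k| ≤ (s : ℤ)

end Transducer

/-- The map `ρ` between encoded inputs is computed by a deterministic Turing machine in logarithmic
work space. -/
def LogspaceComputable {I J A B : Type} (encI : I → List A) (encJ : J → List B) (ρ : I → J) : Prop :=
  ∃ (M : Transducer A B) (C : ℕ), ∀ i,
    M.HaltsWith (encI i) (encJ (ρ i)) ∧
    M.UsesSpace (encI i) (C * (Nat.log 2 (encI i).length + 1))

/-- Logspace many-one reducibility: the input is transformed in logarithmic space, and the answer of `X`
is read off the answer of `Y` through a fixed map of answers. -/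
def Problem.LogReduces (X Y : Problem) : Prop :=
  ∃ ρ : X.Input → Y.Input, LogspaceComputable X.encode Y.encode ρ ∧
    ∃ σ : Y.Answer → X.Answer, ∀ i, X.solution i = σ (Y.solution (ρ i))

/-- P-completeness under logspace reductions. -/
def Problem.PComplete (X : Problem) : Prop :=
  X.PolyTime ∧
    ∀ L : Language Bool, (Problem.ofLanguage L).PolyTime → (Problem.ofLanguage L).LogReduces X

/-! ### One-dimensional cellular automata of radius 1 and their prediction problems -/

section CellularAutomata

variable {S : Type}

/-- The global map on configurations of the cellular automaton with local map `f`. -/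
def caMap (f : S → S → S → S) (c : ℤ → S) : ℤ → S :=
  fun z => f (c (z - 1)) (c z) (c (z + 1))

/-- The action of the cellular automaton on finite patterns, from length `n + 2` to length `n`. -/
def patternMap (f : S → S → S → S) {n : ℕ} (u : Fin (n + 2) → S) : Fin n → S :=
  fun i => f (u ⟨i, by omega⟩) (u ⟨i + 1, by omega⟩) (u ⟨i + 2, by omega⟩)

/-- The single state obtained after `t` applications to a pattern indexed by `[-t, t]`, position `z`
being stored at index `z + t`. -/
def patternIter (f : S → S → S → S) : (t : ℕ) → (Fin (2 * t + 1) → S) → S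
  | 0, u => u 0
  | t + 1, u => patternIter f t (patternMap (n := 2 * t + 1) f u)

end CellularAutomata

/-- Inputs of the bounded prediction problem: a time `t > 0` and a pattern on `[-t, t]`. -/
structure PredInput (S : Type) where
  t : ℕ
  t_pos : 0 < t
  u : Fin (2 * t + 1) → S

/-- The pair `(t, u)` is written as the word `u`, whose length `2 * t + 1` gives `t`. -/
def PredInput.encode {S : Type} (i : PredInput S) : List S :=
  List.ofFn i.u

theorem PredInput.encode_injective {S : Type} :
    Function.Injective (PredInput.encode (S := S)) := by
  rintro ⟨t, ht, u⟩ ⟨t', ht', u'⟩ h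
  have hl := congrArg List.length h
  simp only [PredInput.encode, List.length_ofFn] at hl
  obtain rfl : t = t' := by omega
  obtain rfl : u = u' := List.ofFn_injective h
  rfl

/-- The bounded prediction problem: given `t > 0` and a pattern `u` on `[-t, t]`, compute the state
of cell `0` after `t` steps. -/
def PRED {S : Type} (f : S → S → S → S) : Problem where
  Input := PredInput S
  Symbol := S
  Answer := S
  encode := PredInput.encode
  encode_injective := PredInput.encode_injective
  solution := fun i => patternIter f i.t i.u

/-- An eventually bi-periodic configuration `^∞uL · v · w · uR^∞`, where cell `0` is the first cell of
`w · uR^∞`, together with a target state. -/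
structure UBPredInput (S : Type) where
  uL : List S
  v : List S
  w : List S
  uR : List S
  target : S
  uL_ne : uL ≠ []
  uR_ne : uR ≠ []

/-- The infinite word `p · q^∞`. -/
def eventuallyPeriodicWord {S : Type} (p q : List S) (hq : q ≠ []) (n : ℕ) : S :=
  if h : n < p.length then p[n]
  else q[(n - p.length) % q.length]'(Nat.mod_lt _ (List.length_pos_iff.mpr hq))

namespace UBPredInput

variable {S : Type}

/-- The configuration described by the input. -/
def config (i : UBPredInput S) : ℤ → S
  | Int.ofNat n => eventuallyPeriodicWord i.w i.uR i.uR_ne n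
  | Int.negSucc n =>
      eventuallyPeriodicWord i.v.reverse i.uL.reverse (by simpa using i.uL_ne) n

/-- Total length of the words describing the configuration. -/
def size (i : UBPredInput S) : ℕ :=
  i.uL.length + i.v.length + i.w.length + i.uR.length

/-- The words are written one after the other, with `none` as a separator. -/
def encode (i : UBPredInput S) : List (Option S) :=
  i.uL.map some ++ none :: (i.v.map some ++ none :: (i.w.map some ++ none ::
    (i.uR.map some ++ [none, some i.target])))

theorem map_some_append_none {a b : List S} {x y : List (Option S)}
    (h : a.map some ++ none :: x = b.map some ++ none :: y) : a = b ∧ x = y := by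
  induction a generalizing b with
  | nil => cases b <;> simp_all
  | cons s a ih =>
    cases b with
    | nil => simp at h
    | cons s' b =>
      simp only [List.map_cons, List.cons_append, List.cons.injEq, Option.some.injEq] at h
      obtain ⟨rfl, rfl⟩ := ih h.2
      exact ⟨by rw [h.1], rfl⟩

theorem encode_injective : Function.Injective (UBPredInput.encode (S := S)) := by
  rintro ⟨a, b, c, d, q, ha, hd⟩ ⟨a', b', c', d', q', ha', hd'⟩ h
  simp only [encode] at h
  obtain ⟨h1, h⟩ := map_some_append_none h
  obtain ⟨h2, h⟩ := map_some_append_none h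
  obtain ⟨h3, h⟩ := map_some_append_none h
  obtain ⟨h4, h5⟩ := map_some_append_none h
  simp only [List.cons.injEq, Option.some.injEq, and_true] at h5
  subst h1 h2 h3 h4 h5
  rfl

end UBPredInput

/-- The unbounded prediction (reachability) problem: given an eventually bi-periodic configuration and a
state, decide whether cell `0` is ever in that state. -/
noncomputable def UBPRED {S : Type} (f : S → S → S → S) : Problem where
  Input := UBPredInput S
  Symbol := Option S
  Answer := Bool
  encode := UBPredInput.encode
  encode_injective := UBPredInput.encode_injective
  solution := fun i => by
    classical exact decide (∃ t : ℕ, (caMap f)^[t] i.config 0 = i.target)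

/-! ### The shrinking zigzag zone automaton -/

/-- The last component of the state of a working cell: the two heads `←`, `→` and the marks `l`, `r`. -/
inductive ZMark where
  | headLeft
  | headRight
  | l
  | r

/-- The alphabet `{b, b₊, e} ∪ (Q × Q × {←, →, l, r})`. -/
inductive ZState (Q : Type) where
  | b
  | bPlus
  | e
  | cell (x y : Q) (z : ZMark)

/-- The patterns of two adjacent marks that are forbidden in a working zone. -/
def ZMark.forbidden : ZMark → ZMark → Bool
  | .r, .l => true
  | .l, .r => true
  | .headLeft, .headLeft => true
  | .headLeft, .headRight => true
  | .headRight, .headLeft => true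
  | .headRight, .headRight => true
  | .r, .headLeft => true
  | .r, .headRight => true
  | .headLeft, .l => true
  | .headRight, .l => true
  | _, _ => false

def ZState.forbidden {Q : Type} : ZState Q → ZState Q → Bool
  | .cell _ _ z, .cell _ _ z' => z.forbidden z'
  | _, _ => false

open ZState ZMark in
/-- The movements and actions of the heads, and the end of a working zone of size one.  A neighborhood
for which no transition is listed leaves the state of the cell unchanged. -/
def zigzagMove {Q : Type} (δ : Q → Q → Q → Q) : ZState Q → ZState Q → ZState Q → ZState Q
  -- inside a working zone
  | cell _ _ l, cell x' y' headLeft, cell _ _ r => cell x' y' r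
  | cell _ _ l, cell x' y' l, cell _ _ headLeft => cell x' y' headLeft
  | cell _ _ l, cell x' y' headRight, cell _ _ r => cell x' y' l
  | cell _ y headRight, cell x' _ r, cell x'' _ r => cell (δ y x' x'') x' headRight
  -- at the boundaries of a working zone
  | b, cell x y l, cell _ _ headLeft => cell x y headLeft
  | b, cell x y headLeft, cell _ _ r => cell x y headRight
  | b, cell x y headRight, cell _ _ r => cell y x l
  | b, cell _ _ l, cell _ _ headRight => bPlus
  | cell _ _ headRight, cell x' y' r, b => cell x' y' headRight
  | cell _ _ l, cell x' y' headRight, b => cell x' y' headLeft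
  | cell _ _ l, cell x' y' headLeft, b => cell x' y' r
  | cell _ _ headLeft, cell _ _ r, b => bPlus
  -- working zones of size one
  | b, cell x y _, b => cell x y r
  | b, cell x y _, bPlus => cell x y r
  | bPlus, cell x y _, b => cell x y r
  | bPlus, cell x y _, bPlus => cell x y r
  -- everything else
  | _, s, _ => s

/-- The local map of the shrinking zigzag zone automaton: first the spreading error state, then the
blank states, then the detection of forbidden patterns, then the movements of the heads. -/
def zigzag {Q : Type} (δ : Q → Q → Q → Q) : ZState Q → ZState Q → ZState Q → ZState Q
  | .e, _, _ => .e
  | _, .e, _ => .e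
  | _, _, .e => .e
  | _, .b, _ => .b
  | _, .bPlus, _ => .b
  | p, s, n => if p.forbidden s || s.forbidden n then .e else zigzagMove δ p s n

/-! Forgetting the letters of `Q` turns `zigzag` into an automaton on seven symbols, `ZSym.next`,
and the letters of a cell change only when its mark does (`ZState.zigzag_eq_of_sym_eq`).
Stabilization is therefore a statement about marks alone.

If an error is present at time 0, 1 or 2, bi-periodicity gives one at linear distance from cell 0,
and it spreads to cell 0 in linear time. Otherwise a finite check on windows of length five shows
that from time 2 on all neighborhoods lie in a list that is closed under the dynamics
(`settledOrbit_zigzag`). In such a configuration a maximal nonblank segment is a run of `l`, then at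
most one head, then a run of `r`. Without a head it is frozen. With a head and two finite ends,
every return trip deletes a cell at the left end and possibly one at the right end, so the zone of
linear length dies in quadratic time; on an infinite side the head runs away and never returns. The
quantitative form is the potential argument of `stable_of_zone_phase`, which leads to
`zigzag_stabilizes`.

Polynomial time for unbounded prediction follows: only quadratically many time steps matter, so it
suffices to unroll the two periodic parts to polynomial length and to iterate the local map on the
resulting word (`ubpred_polyTime`). The Turing machines are produced by compiling small stack
programs with explicit running times (`Exec.reachesIn`, `StackProg.polyTime`).

For hardness, a zone on `[-t-1, t]` carries the pattern, preceded by a head. One cycle of the head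
applies the simulated automaton once and removes one cell at each end, exactly as a light cone
shrinks (`LetterZone.cycle`). After `t` cycles only the head and cell 0 are left; then the head
disappears and cell 0 keeps the result forever. The stabilization theorem bounds the time at which
the result is visible by a quadratic function of `t`.

A reduction to `PRED δ` becomes one to `PRED (zigzag δ)` by printing blanks, a head, the old output
with its letters doubled, and the same blanks again. The padding must exceed a quadratic function of
the length of the old output, which is not known in advance. But a machine in logarithmic space has
at most polynomially many configurations, so its output length is at most `a ^ (log |w| + 1)` for
some constant `a` (`exists_output_length_le`), and a counter on a logarithmic tape can emit at least
that many blanks (`padder_computes`). -/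

/-! ### A small language of stack programs and its compilation to Turing machines -/

/-- Programs with a finite internal memory of type `σ`, acting on stacks of letters of `X` indexed by
`W`. -/
inductive StackProg (W X σ : Type) where
  | push (k : W) (f : σ → Option X)
  | load (f : σ → σ)
  | pop (k : W) (f : σ → Option X → σ)
  | seq (p q : StackProg W X σ)
  /-- Repeatedly pop the stack `k`, updating the memory, and run `p` unless the stack was empty. -/
  | loop (k : W) (f : σ → Option X → σ) (p : StackProg W X σ)

namespace StackProg

variable {W X σ : Type} [DecidableEq W]

/-- `Exec p s w s' w' T`: started with memory `s` and stacks `w`, the program `p` stops with memory `s'`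
and stacks `w'` after at most `T` steps. -/
inductive Exec : StackProg W X σ → σ → (W → List X) → σ → (W → List X) → ℕ → Prop
  | push {k f s w} : Exec (push k f) s w s (Function.update w k ((f s).toList ++ w k)) 1
  | load {f s w} : Exec (load f) s w (f s) w 1
  | pop {k f s w} : Exec (pop k f) s w (f s (w k).head?) (Function.update w k (w k).tail) 1
  | seq {p q s w s' w' s'' w'' t t'} : Exec p s w s' w' t → Exec q s' w' s'' w'' t' →
      Exec (seq p q) s w s'' w'' (t + t')
  | loop_nil {k f p s w} : w k = [] → Exec (loop k f p) s w (f s none) w 1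
  | loop_cons {k f p s w a l s' w' s'' w'' t t'} : w k = a :: l →
      Exec p (f s (some a)) (Function.update w k l) s' w' t →
      Exec (loop k f p) s' w' s'' w'' t' → Exec (loop k f p) s w s'' w'' (1 + t + t')
  | weaken {p s w s' w' t T} : Exec p s w s' w' t → t ≤ T → Exec p s w s' w' T

/-- Control points of a program. -/
inductive Label : StackProg W X σ → Type
  | push {k f} : Label (push k f)
  | load {f} : Label (load f)
  | pop {k f} : Label (pop k f)
  | left {p q} (l : Label p) : Label (seq p q)
  | right {p q} (l : Label q) : Label (seq p q)
  | test {k f p} : Label (loop k f p)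
  | body {k f p} (l : Label p) : Label (loop k f p)

instance instFiniteLabel (p : StackProg W X σ) : Finite p.Label := by
  induction p with
  | push k f => exact Finite.of_surjective (fun _ : Unit => Label.push) (fun | .push => ⟨(), rfl⟩)
  | load f => exact Finite.of_surjective (fun _ : Unit => Label.load) (fun | .load => ⟨(), rfl⟩)
  | pop k f => exact Finite.of_surjective (fun _ : Unit => Label.pop) (fun | .pop => ⟨(), rfl⟩)
  | seq p q _ _ =>
    exact Finite.of_surjective (fun l : p.Label ⊕ q.Label => l.elim Label.left Label.right)
      (fun | .left l => ⟨Sum.inl l, rfl⟩ | .right l => ⟨Sum.inr l, rfl⟩)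
  | loop k f p _ =>
    exact Finite.of_surjective (fun l : Option p.Label => l.elim Label.test Label.body)
      (fun | .test => ⟨none, rfl⟩ | .body l => ⟨some l, rfl⟩)

/-- The control point where a program starts. -/
def entry : (p : StackProg W X σ) → p.Label
  | push _ _ => .push
  | load _ => .load
  | pop _ _ => .pop
  | seq p _ => .left p.entry
  | loop _ _ _ => .test

/-- The stacks of the machine: input, output and the stacks of the program. -/
inductive Stk (W : Type) where
  | input
  | output
  | work (k : W)
  deriving DecidableEq

instance [Fintype W] : Fintype (Stk W) :=
  Fintype.ofSurjective (fun o : Option (Option W) => match o with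
    | none => Stk.input
    | some none => Stk.output
    | some (some k) => Stk.work k) (by
      rintro (_ | _ | k)
      · exact ⟨none, rfl⟩
      · exact ⟨some none, rfl⟩
      · exact ⟨some (some k), rfl⟩)

/-- The alphabets of the stacks of the machine. -/
@[reducible] def StkAlphabet (W I O X : Type) : Stk W → Type
  | .input => I
  | .output => O
  | .work _ => X

/-- The contents of the stacks of the machine. -/
def stkContents {I O : Type} (i : List I) (o : List O) (w : W → List X) :
    (k : Stk W) → List (StkAlphabet W I O X k)
  | .input => i
  | .output => o
  | .work k => w k

variable {I O : Type}

theorem update_stkContents_work (i : List I) (o : List O) (w : W → List X) (k : W) (l : List X) :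
    Function.update (stkContents i o w) (Stk.work k) l =
      stkContents i o (Function.update w k l) := by
  funext j
  rcases j with _ | _ | j
  · rfl
  · rfl
  · by_cases h : j = k
    · subst h; simp [stkContents]
    · rw [Function.update_of_ne (by simpa using h)]
      simp [stkContents, h]

theorem update_stkContents_input (i i' : List I) (o : List O) (w : W → List X) :
    Function.update (stkContents i o w) Stk.input i' = stkContents i' o w := by
  funext j
  rcases j with _ | _ | j <;> rfl

theorem update_stkContents_output (i : List I) (o o' : List O) (w : W → List X) :
    Function.update (stkContents i o w) Stk.output o' = stkContents i o' w := by
  funext j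
  rcases j with _ | _ | j <;> rfl

open Turing.TM2.Stmt in
/-- The machine code of a program; the memory gets an additional flag for the result of a test. -/
def code [Inhabited X] {Λ : Type} {p : StackProg W X σ} (emb : p.Label → Λ) (ex : Λ) :
    p.Label → Turing.TM2.Stmt (StkAlphabet W I O X) Λ (σ × Bool)
  | .push (k := k) (f := f) => branch (fun s => (f s.1).isSome)
      (Turing.TM2.Stmt.push (Stk.work k) (fun s => (f s.1).getD default) (goto fun _ => ex))
      (goto fun _ => ex)
  | .load (f := f) => Turing.TM2.Stmt.load (fun s => (f s.1, s.2)) (goto fun _ => ex)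
  | .pop (k := k) (f := f) =>
      Turing.TM2.Stmt.pop (Stk.work k) (fun s (o : Option X) => (f s.1 o, s.2)) (goto fun _ => ex)
  | .left (q := q) l => code (fun l => emb (.left l)) (emb (.right q.entry)) l
  | .right l => code (fun l => emb (.right l)) ex l
  | .test (k := k) (f := f) (p := p) =>
      Turing.TM2.Stmt.pop (Stk.work k) (fun s (o : Option X) => (f s.1 o, o.isSome))
        (branch (fun s => s.2) (goto fun _ => emb (.body p.entry)) (goto fun _ => ex))
  | .body l => code (fun l => emb (.body l)) (emb .test) l

/-- `c'` is reached from `c` in at most `T` steps. -/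
def ReachesIn {α : Type*} (f : α → Option α) (c c' : α) (T : ℕ) : Prop :=
  ∃ n ≤ T, (flip bind f)^[n] (some c) = some c'

theorem ReachesIn.single {α : Type*} {f : α → Option α} {c c' : α} (h : f c = some c') :
    ReachesIn f c c' 1 :=
  ⟨1, le_rfl, by simpa [flip] using h⟩

theorem ReachesIn.trans {α : Type*} {f : α → Option α} {c c' c'' : α} {t t' : ℕ}
    (h : ReachesIn f c c' t) (h' : ReachesIn f c' c'' t') : ReachesIn f c c'' (t + t') := by
  obtain ⟨n, hn, e⟩ := h
  obtain ⟨n', hn', e'⟩ := h'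
  exact ⟨n' + n, by omega, by rw [Function.iterate_add_apply, e, e']⟩

theorem ReachesIn.mono {α : Type*} {f : α → Option α} {c c' : α} {t t' : ℕ}
    (h : ReachesIn f c c' t) (ht : t ≤ t') : ReachesIn f c c' t' := by
  obtain ⟨n, hn, e⟩ := h
  exact ⟨n, hn.trans ht, e⟩

/-- Induction on the execution. The embedding of labels and the exit label are quantified inside the
induction, because a subprogram sits in a larger machine with the next instruction as its exit. A
basic instruction costs a single machine step, since `TM2` runs a whole statement up to its `goto`.
-/
theorem Exec.reachesIn [Inhabited X] {Λ : Type}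
    (m : Λ → Turing.TM2.Stmt (StkAlphabet W I O X) Λ (σ × Bool))
    {p : StackProg W X σ} {s s' : σ} {w w' : W → List X} {t : ℕ} (h : Exec p s w s' w' t) :
    ∀ (emb : p.Label → Λ) (ex : Λ), (∀ l, m (emb l) = code emb ex l) →
    ∀ (i : List I) (o : List O) (b : Bool), ∃ b',
      ReachesIn (Turing.TM2.step m) ⟨some (emb p.entry), (s, b), stkContents i o w⟩
        ⟨some ex, (s', b'), stkContents i o w'⟩ t := by
  induction h with
  | @push k f s w =>
    intro emb ex hm i o b
    refine ⟨b, ReachesIn.single ?_⟩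
    simp only [Turing.TM2.step, hm, code, entry, Turing.TM2.stepAux]
    cases hf : f s with
    | none => simp
    | some a =>
      simp only [Option.isSome_some, cond_true, Option.getD_some, update_stkContents_work]
      simp [stkContents]
  | load =>
    intro emb ex hm i o b
    refine ⟨b, ReachesIn.single ?_⟩
    simp only [Turing.TM2.step, hm, code, entry, Turing.TM2.stepAux]
  | pop =>
    intro emb ex hm i o b
    refine ⟨b, ReachesIn.single ?_⟩
    simp only [Turing.TM2.step, hm, code, entry, Turing.TM2.stepAux, update_stkContents_work]
    rfl
  | seq _ _ ihp ihq =>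
    intro emb ex hm i o b
    obtain ⟨b', h⟩ := ihp (fun l => emb (.left l)) (emb (.right (entry _)))
      (fun l => by rw [hm]; rfl) i o b
    obtain ⟨b'', h'⟩ := ihq (fun l => emb (.right l)) ex (fun l => by rw [hm]; rfl) i o b'
    exact ⟨b'', h.trans h'⟩
  | @loop_nil k f p s w hk =>
    intro emb ex hm i o b
    refine ⟨false, ReachesIn.single ?_⟩
    simp only [Turing.TM2.step, hm, code, entry, Turing.TM2.stepAux, update_stkContents_work]
    simp [stkContents, hk]
    conv_lhs => rw [← hk, Function.update_eq_self]
  | @loop_cons k f p s w a l s' w' s'' w'' t t' hk _ _ ihp ihl =>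
    intro emb ex hm i o b
    obtain ⟨b', h⟩ := ihp (fun l => emb (.body l)) (emb .test)
      (fun l => by rw [hm]; rfl) i o true
    obtain ⟨b'', h'⟩ := ihl emb ex hm i o b'
    refine ⟨b'', (ReachesIn.trans (ReachesIn.single ?_) h).trans h'⟩
    simp only [Turing.TM2.step, hm, code, entry, Turing.TM2.stepAux, update_stkContents_work]
    simp [stkContents, hk]
  | weaken _ hT ih =>
    intro emb ex hm i o b
    obtain ⟨b', h⟩ := ih emb ex hm i o b
    exact ⟨b', h.mono hT⟩

/-- Running a program for each letter of the input. -/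
inductive ExecInput (read : σ → I → σ) (p : StackProg W X σ) :
    List I → σ → (W → List X) → σ → (W → List X) → ℕ → Prop
  | nil {s w} : ExecInput read p [] s w s w 0
  | cons {a l s w s' w' s'' w'' t t'} : Exec p (read s a) w s' w' t →
      ExecInput read p l s' w' s'' w'' t' → ExecInput read p (a :: l) s w s'' w'' (1 + t + t')

section Machine

variable [Inhabited X] (s₀ : σ) (read : σ → I → σ)
  (p q : StackProg W X σ) (out : σ → O)

/-- Control points of the machine: the reading of the input, `p`, `q` and the final instruction. -/
abbrev MachineLabel (p q : StackProg W X σ) : Type := Option (Option (p.Label ⊕ q.Label))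

open Turing.TM2.Stmt in
/-- The code of the machine that runs `p` for each letter of the input, then `q`, and outputs one
letter. -/
def machineCode : MachineLabel p q →
    Turing.TM2.Stmt (StkAlphabet W I O X) (MachineLabel p q) (σ × Bool)
  | none => Turing.TM2.Stmt.pop Stk.input (fun s (o : Option I) =>
        (match o with | none => s.1 | some a => read s.1 a, o.isSome))
      (branch (fun s => s.2) (goto fun _ => some (some (Sum.inl p.entry)))
        (goto fun _ => some (some (Sum.inr q.entry))))
  | some (some (Sum.inl l)) => code (fun l => some (some (Sum.inl l))) none l
  | some (some (Sum.inr l)) => code (fun l => some (some (Sum.inr l))) (some none) l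
  | some none => Turing.TM2.Stmt.push Stk.output (fun s => out s.1)
      (Turing.TM2.Stmt.load (fun _ => (s₀, false)) halt)

/-- The machine that runs `p` for each letter of the input, then `q`, and outputs one letter. -/
noncomputable def machine [Fintype W] [Fintype I] [Fintype σ] : Turing.FinTM2 where
  K := Stk W
  k₀ := .input
  k₁ := .output
  Γ := StkAlphabet W I O X
  Λ := MachineLabel p q
  main := none
  σ := σ × Bool
  ΛFin := Fintype.ofFinite _
  initialState := (s₀, false)
  Γk₀Fin := inferInstanceAs (Fintype I)
  m := machineCode s₀ read p q out

theorem ExecInput.reachesIn {l : List I} {s s' : σ} {w w' : W → List X} {t : ℕ}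
    (h : ExecInput read p l s w s' w' t) (b : Bool) : ∃ b',
      ReachesIn (Turing.TM2.step (machineCode s₀ read p q out))
        ⟨some none, (s, b), stkContents l [] w⟩
        ⟨some (some (some (Sum.inr q.entry))), (s', b'), stkContents [] [] w'⟩ (t + 1) := by
  induction h generalizing b with
  | nil =>
    refine ⟨false, ReachesIn.single ?_⟩
    simp [Turing.TM2.step, machineCode, Turing.TM2.stepAux, update_stkContents_input, stkContents]
  | cons hp _ ih =>
    obtain ⟨b', h⟩ := hp.reachesIn (machineCode s₀ read p q out)
      (fun l => some (some (Sum.inl l))) none (fun l => rfl) _ [] true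
    obtain ⟨b'', h'⟩ := ih b'
    refine ⟨b'', ((ReachesIn.trans (ReachesIn.single ?_) h).trans h').mono (by omega)⟩
    simp [Turing.TM2.step, machineCode, Turing.TM2.stepAux, update_stkContents_input, stkContents]

end Machine

/-- A function computed by a stack program within polynomial time is computed in polynomial time by a
Turing machine. -/
theorem polyTime {α : Type} [Fintype W] [Inhabited X] [Finite I] [Finite σ] (enc : α → List I)
    (g : α → O) (s₀ : σ) (read : σ → I → σ) (p q : StackProg W X σ) (out : σ → O)
    (time : Polynomial ℕ)
    (h : ∀ a, ∃ s₁ w₁ s₂ t₁ t₂, ExecInput read p (enc a) s₀ (fun _ => []) s₁ w₁ t₁ ∧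
      Exec q s₁ w₁ s₂ (fun _ => []) t₂ ∧ out s₂ = g a ∧ t₁ + t₂ ≤ time.eval (enc a).length) :
    Nonempty (Turing.TM2ComputableInPolyTime enc (fun b => [b]) g) := by
  have := Fintype.ofFinite I
  have := Fintype.ofFinite σ
  refine ⟨{
    tm := machine s₀ read p q out
    inputAlphabet := Equiv.refl I
    outputAlphabet := Equiv.refl O
    -- One extra step discovers the end of the input, the other writes the output.
    time := time + 2
    outputsFun := fun a => ?_ }⟩
  suffices H : ReachesIn (machine s₀ read p q out).step
      (Turing.initList (machine s₀ read p q out) (enc a))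
      (Turing.haltList (machine s₀ read p q out) [g a]) ((time + 2).eval (enc a).length) by
    have e : ((List.map (Equiv.refl I).invFun (enc a))) = enc a := by simp
    refine ⟨⟨H.choose, ?_⟩, H.choose_spec.1⟩
    erw [e]
    exact H.choose_spec.2
  obtain ⟨s₁, w₁, s₂, t₁, t₂, h₁, h₂, hg, ht⟩ := h a
  obtain ⟨b₁, r₁⟩ := h₁.reachesIn s₀ read p q out false
  obtain ⟨b₂, r₂⟩ := h₂.reachesIn (machineCode s₀ read p q out)
    (fun l => some (some (Sum.inr l))) (some none) (fun l => rfl) [] [] b₁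
  -- `Turing.haltList` demands the initial memory and empty stacks apart from the output: the last
  -- instruction resets the memory, and `q` has to empty the work stacks.
  have r₃ : ReachesIn (Turing.TM2.step (machineCode s₀ read p q out))
      ⟨some (some none), (s₂, b₂), stkContents [] [] (fun _ => [])⟩
      ⟨none, (s₀, false), stkContents [] [g a] (fun _ => [])⟩ 1 := by
    apply ReachesIn.single
    simp only [Turing.TM2.step, machineCode, Turing.TM2.stepAux, hg]
    rw [update_stkContents_output]
    rfl
  have r := ((r₁.trans r₂).trans r₃).mono
    (show _ ≤ (time + 2).eval (enc a).length by simp; omega)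
  have e₁ : Turing.initList (machine s₀ read p q out) (enc a) =
      ⟨some none, (s₀, false), stkContents (enc a) [] (fun _ => [])⟩ := by
    unfold Turing.initList
    congr 1
    funext k
    rcases k with _ | _ | k <;> rfl
  have e₂ : Turing.haltList (machine s₀ read p q out) [g a] =
      ⟨none, (s₀, false), stkContents [] [g a] (fun _ => [])⟩ := by
    unfold Turing.haltList
    congr 1
    funext k
    rcases k with _ | _ | k <;> rfl
  rw [e₁, e₂]
  exact r

theorem ExecInput.append {read : σ → I → σ} {p : StackProg W X σ} {l l' : List I} {s s' s'' : σ}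
    {w w' w'' : W → List X} {t t' : ℕ} (h : ExecInput read p l s w s' w' t)
    (h' : ExecInput read p l' s' w' s'' w'' t') :
    ExecInput read p (l ++ l') s w s'' w'' (t + t') := by
  induction h with
  | nil => simpa using h'
  | cons hp _ ih =>
    have := ExecInput.cons hp (ih h')
    rwa [← add_assoc] at this

/-- Executing a loop whose body preserves an invariant. -/
theorem exec_loop_of_invariant {k : W} {f : σ → Option X → σ} {p : StackProg W X σ} (T : ℕ)
    (Inv : List X → σ → (W → List X) → Prop) (hk : ∀ l s w, Inv l s w → w k = l)
    (hp : ∀ a l s w, Inv (a :: l) s w →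
      ∃ s' w', Exec p (f s (some a)) (Function.update w k l) s' w' T ∧ Inv l s' w')
    {l : List X} {s : σ} {w : W → List X} (h : Inv l s w) :
    ∃ s' w', Inv [] s' w' ∧ Exec (loop k f p) s w (f s' none) w' (l.length * (T + 1) + 1) := by
  induction l generalizing s w with
  | nil => exact ⟨s, w, h, .weaken (.loop_nil (hk _ _ _ h)) (by simp)⟩
  | cons a l ih =>
    obtain ⟨s', w', e, h'⟩ := hp a l s w h
    obtain ⟨s'', w'', h'', e'⟩ := ih h'
    refine ⟨s'', w'', h'', .weaken (.loop_cons (hk _ _ _ h) e e') ?_⟩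
    rw [List.length_cons]
    linarith

end StackProg

/-! ### Iterating a local rule on words -/

/-- The action of the local map on words of unspecified length. -/
def caWord {X : Type} (f : X → X → X → X) : List X → List X
  | a :: b :: c :: l => f a b c :: caWord f (b :: c :: l)
  | _ => []

theorem length_caWord {X : Type} (f : X → X → X → X) (u : List X) :
    (caWord f u).length = u.length - 2 := by
  fun_induction caWord f u with
  | case1 a b c l ih => simp [ih]
  | case2 u h =>
    match u, h with
    | [], _ => rfl
    | [a], _ => rfl
    | [a, b], _ => rfl
    | a :: b :: c :: l, h => exact absurd rfl (h a b c l)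

/-- Feed to `acc` all letters of a word, of its image, and so on until the empty word is reached. -/
def wordFold {X τ : Type} (f : X → X → X → X) (acc : τ → X → τ) (s : τ) : List X → τ
  | [] => s
  | a :: l => wordFold f acc (l.foldl acc (acc s a)) (caWord f (a :: l))
termination_by u => u.length
decreasing_by simp [length_caWord]

namespace StackProg

/-- The memory of a program: an accumulator, a window of two letters and the current letter. -/
structure Mem (τ X : Type) where
  acc : τ
  fst : Option X
  snd : Option X
  cur : Option X

instance {τ X : Type} [Finite τ] [Finite X] : Finite (Mem τ X) :=
  Finite.of_injective (fun s => (s.acc, s.fst, s.snd, s.cur)) (by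
    rintro ⟨_, _, _, _⟩ ⟨_, _, _, _⟩ h
    simpa using h)

variable {W X τ : Type} [DecidableEq W]

/-- Transfer the letters of a stack to another one, in reversed order. -/
def move (k k' : W) : StackProg W X (Mem τ X) :=
  loop k (fun s o => { s with cur := o }) (push k' fun s => s.cur)

theorem exec_move {k k' : W} (hk : k ≠ k') (s : Mem τ X) (w : W → List X) :
    Exec (move k k') s w { s with cur := none }
      (Function.update (Function.update w k []) k' ((w k).reverse ++ w k'))
      (2 * (w k).length + 1) := by
  obtain ⟨s', w', ⟨hs, hw⟩, e⟩ := exec_loop_of_invariant (k := k)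
    (f := fun (s : Mem τ X) o => { s with cur := o }) (p := push k' fun s => s.cur) 1
    -- The memory matters only up to `cur`, which every pop overwrites; `m` is the part already
    -- transferred.
    (fun l s' w' => { s' with cur := none } = { s with cur := none } ∧ ∃ m, m ++ l = w k ∧
      w' = Function.update (Function.update w k l) k' (m.reverse ++ w k'))
    (by rintro l s' w' ⟨-, m, -, rfl⟩; simp [hk])
    (by
      rintro a l s' w' ⟨hs, m, hm, rfl⟩
      refine ⟨_, _, .push, by simpa using hs, m ++ [a], by simpa using hm, ?_⟩
      funext j
      by_cases h1 : j = k'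
      · subst h1; simp [hk.symm]
      · by_cases h2 : j = k
        · subst h2; simp [h1]
        · simp [h1, h2])
    (l := w k) (s := s) (w := w) ⟨rfl, [], rfl, by simp⟩
  obtain ⟨m, hm, rfl⟩ := hw
  simp only [List.append_nil] at hm
  subst hm
  simp only [hs] at e
  exact .weaken e (by omega)

/-- Empty a stack. -/
def clear (k : W) : StackProg W X (Mem τ X) :=
  loop k (fun s o => { s with cur := o }) (load id)

theorem exec_clear (k : W) (s : Mem τ X) (w : W → List X) :
    Exec (clear k) s w { s with cur := none } (Function.update w k []) (2 * (w k).length + 1) := by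
  obtain ⟨s', w', ⟨hs, hw⟩, e⟩ := exec_loop_of_invariant (k := k)
    (f := fun (s : Mem τ X) o => { s with cur := o }) (p := load id) 1
    (fun l s' w' => { s' with cur := none } = { s with cur := none } ∧
      w' = Function.update w k l)
    (by rintro l s' w' ⟨-, rfl⟩; simp)
    (by
      rintro a l s' w' ⟨hs, rfl⟩
      exact ⟨_, _, .load, by simpa using hs, by simp⟩)
    (l := w k) (s := s) (w := w) ⟨rfl, by simp⟩
  subst hw
  simp only [hs] at e
  exact .weaken e (by omega)

section Iterate

variable (f : X → X → X → X) (acc : τ → X → τ) (A B : W)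

/-- Consume the stack `A`, and push on `B` the images of the windows of three letters. -/
def pass : StackProg W X (Mem τ X) :=
  loop A (fun s o => { s with cur := o, acc := o.elim s.acc (acc s.acc) })
    (seq (push B fun s => match s.fst, s.snd, s.cur with
        | some a, some b, some c => some (f a b c)
        | _, _, _ => none)
      (load fun s => { s with fst := s.snd, snd := s.cur }))

/-- The window consists of the two letters before the unread ones, the older one being absent at the
start of a pass. Writing it as `o.toList ++ b :: l` lets one induction cover both the first letters,
for which nothing is emitted, and the regular regime. -/
theorem exec_pass {A B : W} (hAB : A ≠ B) (l : List X) (a : τ) (o : Option X) (b : X)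
    (c : Option X) (w : W → List X) (hA : w A = l) : ∃ s : Mem τ X, s.acc = l.foldl acc a ∧
    Exec (pass f acc A B) ⟨a, o, some b, c⟩ w s (Function.update (Function.update w A []) B
      ((caWord f (o.toList ++ b :: l)).reverse ++ w B)) (3 * l.length + 1) := by
  induction l generalizing a o b c w with
  | nil =>
    refine ⟨⟨a, o, some b, none⟩, rfl, ?_⟩
    have : caWord f (o.toList ++ [b]) = [] := by
      apply List.eq_nil_of_length_eq_zero
      rw [length_caWord]
      cases o <;> simp
    refine .weaken (t := 1) ?_ (by simp)
    have hw : Function.update (Function.update w A []) B (([] : List X).reverse ++ w B) = w := by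
      rw [← hA, Function.update_eq_self]; simpa using hA
    rw [this, hw]
    exact .loop_nil hA
  | cons d l ih =>
    obtain ⟨s, hs, e⟩ := ih (acc a d) (some b) d (some d) (Function.update (Function.update w A l) B
      ((o.toList.map fun x => f x b d) ++ w B)) (by simp [hAB])
    refine ⟨s, hs, ?_⟩
    have h₁ : Function.update (Function.update w A l) B
        ((o.toList.map fun x => f x b d) ++ w B) =
        Function.update (Function.update w A l) B
          ((match o, some b, some d with
            | some a, some b, some c => some (f a b c)
            | _, _, _ => none).toList ++ Function.update w A l B) := by
      cases o <;> simp [hAB.symm]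
    have h₂ : Function.update (Function.update (Function.update (Function.update w A l) B
        ((o.toList.map fun x => f x b d) ++ w B)) A []) B
        ((caWord f (b :: d :: l)).reverse ++ ((o.toList.map fun x => f x b d) ++ w B))
        = Function.update (Function.update w A []) B
          ((caWord f (o.toList ++ b :: d :: l)).reverse ++ w B) := by
      funext j
      by_cases h1 : j = B
      · subst h1
        cases o with
        | none => simp
        | some x => simp [caWord]
      · by_cases h2 : j = A
        · subst h2; simp [h1]
        · simp [h1, h2]
    simp only [Function.update_self, Option.toList_some, List.singleton_append, h₂] at e
    rw [h₁] at e
    exact .weaken (.loop_cons hA (.seq .push .load) e)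
      (show 1 + (1 + 1) + _ ≤ _ by simp; omega)

/-- Iterate the local map on the stack `A` until it is empty, and feed all letters to `acc`. -/
def iterate : StackProg W X (Mem τ X) :=
  loop A (fun s o => ⟨o.elim s.acc (acc s.acc), none, o, none⟩) (seq (pass f acc A B) (move B A))

/-- A pass leaves the image reversed on `B`, and the transfer back to `A` restores the order. A
round costs linear time and shortens a nonempty word, whence a quadratic total. -/
theorem exec_iterate {A B : W} (hAB : A ≠ B) (u : List X) (s : Mem τ X) (w : W → List X)
    (hA : w A = u) (hB : w B = []) : ∃ s' : Mem τ X, s'.acc = wordFold f acc s.acc u ∧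
    Exec (iterate f acc A B) s w s' (Function.update w A []) (5 * (u.length + 1) ^ 2) := by
  induction hn : u.length using Nat.strong_induction_on generalizing u s w with
  | _ n ih =>
  subst hn
  cases u with
  | nil =>
    refine ⟨⟨s.acc, none, none, none⟩, by simp [wordFold], .weaken (t := 1) ?_ (by simp)⟩
    rw [← hA, Function.update_eq_self]
    exact .loop_nil hA
  | cons a l =>
    obtain ⟨s₁, h₁, e₁⟩ := exec_pass f acc hAB l (acc s.acc a) none a none (Function.update w A l)
      (by simp)
    have e₂ := exec_move (τ := τ) hAB.symm s₁ (Function.update (Function.update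
      (Function.update w A l) A []) B ((caWord f (a :: l)).reverse ++ Function.update w A l B))
    obtain ⟨s₃, h₃, e₃⟩ := ih (caWord f (a :: l)).length (by simp [length_caWord])
      (caWord f (a :: l)) { s₁ with cur := none }
      (Function.update w A (caWord f (a :: l))) (by simp) (by simp [hAB.symm, hB]) rfl
    refine ⟨s₃, ?_, ?_⟩
    · rw [h₃, wordFold, h₁]
    · simp only [Function.update_idem, ne_eq, hAB.symm, not_false_eq_true, Function.update_of_ne,
        hB, List.append_nil, Function.update_self, List.reverse_reverse, hAB] at e₂
      rw [Function.update_idem] at e₃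
      have hw : Function.update (Function.update (Function.update w A []) B []) A
          (caWord f (a :: l)) = Function.update w A (caWord f (a :: l)) := by
        funext j
        by_cases h1 : j = A
        · subst h1; simp
        · by_cases h2 : j = B
          · subst h2; simp [h1, hB]
          · simp [h1, h2]
      simp only [Function.update_idem, ne_eq, hAB.symm, not_false_eq_true, Function.update_of_ne,
        hB, List.append_nil, Option.toList_none, List.nil_append] at e₁
      rw [hw] at e₂
      refine .weaken (.loop_cons hA (.seq e₁ e₂) e₃) ?_
      simp only [List.length_reverse, length_caWord, List.length_cons]
      have : l.length + 1 - 2 + 1 ≤ l.length + 1 := by omega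
      have h2 := Nat.pow_le_pow_left this 2
      have : l.length + 1 - 2 ≤ l.length := by omega
      nlinarith

end Iterate

end StackProg

/-! ### The bounded prediction problem is in polynomial time -/

theorem caWord_ofFn {X : Type} (f : X → X → X → X) :
    ∀ {n : ℕ} (u : Fin (n + 2) → X), caWord f (List.ofFn u) = List.ofFn (patternMap f u)
  | 0, u => by simp [List.ofFn_succ, caWord]
  | n + 1, u => by
    have ih := caWord_ofFn f (fun i : Fin (n + 2) => u i.succ)
    rw [List.ofFn_succ, List.ofFn_succ, List.ofFn_succ (n := n)] at *
    rw [caWord, ih]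
    simp [List.ofFn_succ, patternMap, Fin.succ]
    rfl

/-- An accumulator that remembers only the latest letter ends with the apex of the triangle: odd
lengths decrease by two down to one. -/
theorem wordFold_ofFn {X : Type} (f : X → X → X → X) :
    ∀ (t : ℕ) (u : Fin (2 * t + 1) → X) (s : Option X),
      wordFold f (fun _ x => some x) s (List.ofFn u) = some (patternIter f t u)
  | 0, u, s => by simp [wordFold, caWord, patternIter]
  | t + 1, u, s => by
    have e := caWord_ofFn f (n := 2 * t + 1) u
    rw [List.ofFn_succ, wordFold, ← List.ofFn_succ]
    erw [e]
    rw [wordFold_ofFn f t]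
    rfl

namespace StackProg

theorem execInput_push {W X τ : Type} [DecidableEq W] (k : W) (l : List X) (s : Mem τ X)
    (w : W → List X) : ∃ s' : Mem τ X, s'.acc = s.acc ∧
      ExecInput (fun (s : Mem τ X) a => { s with cur := some a }) (push k fun s => s.cur) l s w s'
        (Function.update w k (l.reverse ++ w k)) (2 * l.length) := by
  induction l generalizing s w with
  | nil => exact ⟨s, rfl, by simpa using .nil⟩
  | cons a l ih =>
    obtain ⟨s', hs, e⟩ := ih { s with cur := some a } (Function.update w k ([a] ++ w k))
    refine ⟨s', hs, ?_⟩
    have e' := ExecInput.cons (read := fun (s : Mem τ X) a => { s with cur := some a })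
      (s := s) (.push (k := k) (f := fun s => s.cur) (w := w)) e
    simp only [Function.update_idem, Function.update_self] at e'
    convert e' using 1
    · simp
    · simp; omega

end StackProg

open StackProg in
theorem pred_polyTime {S : Type} [Finite S] [Nonempty S] (f : S → S → S → S) :
    (PRED f).PolyTime := by
  classical
  inhabit S
  refine StackProg.polyTime (W := Bool) (X := S) (σ := Mem (Option S) S) (I := S) (O := S) _ _
    ⟨none, none, none, none⟩ (fun s a => { s with cur := some a }) (push true fun s => s.cur)
    (seq (move true false) (iterate f (fun _ x => some x) false true)) (fun s => s.acc.getD default)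
    -- Two steps per letter to read the input, `2n + 1` steps to undo the reversal caused by reading
    -- it onto a stack, and the rest for the iteration.
    (4 * Polynomial.X + 1 + 5 * (Polynomial.X + 1) ^ 2) fun i => ?_
  obtain ⟨s₁, h₁, e₁⟩ := execInput_push (τ := Option S) true i.encode ⟨none, none, none, none⟩
    (fun _ => [])
  have e₂ := exec_move (k := true) (k' := false) (by simp) s₁
    (Function.update (fun _ => []) true (i.encode.reverse ++ []))
  obtain ⟨s₃, h₃, e₃⟩ := exec_iterate f (fun (_ : Option S) x => some x) (A := false) (B := true)
    (by simp) i.encode { s₁ with cur := none } (Function.update (Function.update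
      (fun _ => []) true []) false i.encode) (by simp) (by simp)
  refine ⟨_, _, s₃, _, _, e₁, .seq (.weaken (t := _) (w' := Function.update (Function.update
      (fun _ => []) true []) false i.encode) ?_ (le_refl (2 * i.encode.length + 1)))
      (by convert e₃ using 1; simp), ?_, ?_⟩
  · convert e₂ using 1
    · simp
    · simp
  · rw [h₃]
    simp only [PredInput.encode, wordFold_ofFn, Option.getD_some]
    rfl
  · simp only [PRED, Polynomial.eval_add, Polynomial.eval_mul, Polynomial.eval_ofNat,
      Polynomial.eval_X, Polynomial.eval_one, Polynomial.eval_pow]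
    omega

/-! ### Unbounded prediction in polynomial time, for automata that stabilize in quadratic time -/

/-- The stacks used for unbounded prediction. -/
inductive UBStack where
  | word | image | left | leftMid | rightMid | right | tmp | rightCount | leftCount | count | count'
  deriving DecidableEq

instance : Fintype UBStack where
  elems := {.word, .image, .left, .leftMid, .rightMid, .right, .tmp, .rightCount, .leftCount, .count,
    .count'}
  complete k := by cases k <;> decide

/-- The contents of the stacks used for unbounded prediction. -/
structure UBContents (X : Type) where
  word : List X := []
  image : List X := []
  left : List X := []
  leftMid : List X := []
  rightMid : List X := []
  right : List X := []
  tmp : List X := []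
  rightCount : List X := []
  leftCount : List X := []
  count : List X := []
  count' : List X := []

namespace UBContents

variable {X : Type} (st : UBContents X) (l : List X)

@[simp] def get : UBStack → List X
  | .word => st.word
  | .image => st.image
  | .left => st.left
  | .leftMid => st.leftMid
  | .rightMid => st.rightMid
  | .right => st.right
  | .tmp => st.tmp
  | .rightCount => st.rightCount
  | .leftCount => st.leftCount
  | .count => st.count
  | .count' => st.count'

/-- Replace the contents of one stack. -/
@[simp] def set (k : UBStack) : UBContents X :=
  match k with
  | .word => { st with word := l }
  | .image => { st with image := l }
  | .left => { st with left := l }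
  | .leftMid => { st with leftMid := l }
  | .rightMid => { st with rightMid := l }
  | .right => { st with right := l }
  | .tmp => { st with tmp := l }
  | .rightCount => { st with rightCount := l }
  | .leftCount => { st with leftCount := l }
  | .count => { st with count := l }
  | .count' => { st with count' := l }

theorem update_get (k : UBStack) : Function.update st.get k l = (st.set l k).get := by
  funext j
  cases k <;> cases j <;> rfl

end UBContents

/-! ### Unrolling periodic words with counters -/

namespace StackProg

variable {X τ : Type}

/-- Push the reversed contents of the stack `k` on the stack `word`, keeping `k`. -/
def copy (k : UBStack) : StackProg UBStack X (Mem τ X) :=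
  seq (loop k (fun s o => { s with cur := o })
    (seq (push .word fun s => s.cur) (push .tmp fun s => s.cur))) (move .tmp k)

theorem exec_copy (k : UBStack) (hk : k = .left ∨ k = .right) (s : Mem τ X) (st : UBContents X)
    (h : st.tmp = []) : Exec (copy k) s st.get { s with cur := none }
      { st with word := (st.get k).reverse ++ st.word }.get (5 * (st.get k).length + 2) := by
  obtain ⟨s', w', ⟨hs, hw⟩, e⟩ := exec_loop_of_invariant (k := k)
    (f := fun (s : Mem τ X) o => { s with cur := o })
    (p := seq (push .word fun s => s.cur) (push .tmp fun s => s.cur)) 2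
    (fun l s' w' => { s' with cur := none } = { s with cur := none } ∧ ∃ m, m ++ l = st.get k ∧
      w' = ({ st with word := m.reverse ++ st.word, tmp := m.reverse }.set l k).get)
    (by rintro l s' w' ⟨-, m, -, rfl⟩; rcases hk with rfl | rfl <;> simp)
    (by
      rintro a l s' w' ⟨hs, m, hm, rfl⟩
      refine ⟨_, _, .seq .push .push, by simpa using hs, m ++ [a], by simpa using hm, ?_⟩
      rcases hk with rfl | rfl <;> simp [UBContents.update_get])
    (l := st.get k) (s := s) (w := st.get) ⟨rfl, [], rfl, by
      cases st; rcases hk with rfl | rfl <;> simp_all⟩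
  obtain ⟨m, hm, rfl⟩ := hw
  simp only [List.append_nil] at hm
  subst hm
  simp only [hs] at e
  have e₂ := exec_move (show UBStack.tmp ≠ k by rcases hk with rfl | rfl <;> simp)
    { s with cur := none } ({ st with word := (st.get k).reverse ++ st.word, tmp := (st.get k).reverse
      }.set [] k).get
  refine .weaken (.seq e ?_) (t := _ + (2 * (st.get k).length + 1)) (by omega)
  rcases hk with rfl | rfl <;> simpa [UBContents.update_get, h] using e₂

/-- Push many reversed copies of the stack `k` on the stack `word`. -/
def copies (c k : UBStack) : StackProg UBStack X (Mem τ X) :=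
  loop c (fun s o => { s with cur := o })
    (seq (loop .count (fun s o => { s with cur := o })
      (seq (push .count' fun s => s.cur) (copy k))) (move .count' .count))

/-- Two nested loops multiply the lengths of two counters. The outer counter `c` is consumed, while
the inner one, `count`, is saved on `count'` and restored after each round; this is how
quadratically many copies are made from counters of linear length. -/
theorem exec_copies (c k : UBStack) (hk : c = .leftCount ∧ k = .left ∨ c = .rightCount ∧ k = .right)
    (s : Mem τ X) (st : UBContents X) (h : st.tmp = []) (h' : st.count' = []) :
    Exec (copies c k) s st.get { s with cur := none }
      ({ st with word := (List.replicate ((st.get c).length * st.count.length)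
        (st.get k).reverse).flatten ++ st.word }.set [] c).get
      ((st.get c).length * (st.count.length * (5 * (st.get k).length + 4) +
        (2 * st.count.length + 1) + 2) + 1) := by
  have hinner : ∀ (s : Mem τ X) (st : UBContents X), st.tmp = [] → st.count' = [] →
      Exec (seq (loop .count (fun s o => { s with cur := o })
        (seq (push .count' fun s => s.cur) (copy k))) (move .count' .count)) s st.get
        { s with cur := none } { st with word := (List.replicate st.count.length
          (st.get k).reverse).flatten ++ st.word }.get
        (st.count.length * (5 * (st.get k).length + 4) + (2 * st.count.length + 1) + 1) := by
    intro s st h h'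
    obtain ⟨s', w', ⟨hs, hw⟩, e⟩ := exec_loop_of_invariant (k := .count)
      (f := fun (s : Mem τ X) o => { s with cur := o })
      (p := seq (push .count' fun s => s.cur) (copy k)) (5 * (st.get k).length + 3)
      (fun l s' w' => { s' with cur := none } = { s with cur := none } ∧ ∃ m, m ++ l = st.count ∧
        w' = { st with
          word := (List.replicate m.length (st.get k).reverse).flatten ++ st.word
          count := l
          count' := m.reverse }.get)
      (by rintro l s' w' ⟨-, m, -, rfl⟩; rfl)
      (by
        rintro a l s' w' ⟨hs, m, hm, rfl⟩
        have e := exec_copy (τ := τ) k (by tauto) { s' with cur := some a } { st with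
          word := (List.replicate m.length (st.get k).reverse).flatten ++ st.word
          count := l
          count' := a :: m.reverse } h
        refine ⟨{ s' with cur := none }, { st with
            word := (st.get k).reverse ++ ((List.replicate m.length (st.get k).reverse).flatten ++
              st.word)
            count := l
            count' := a :: m.reverse }.get,
          .weaken (.seq .push (t' := 5 * (st.get k).length + 2) ?_)
          (show 1 + _ ≤ _ by omega), by simpa using hs, m ++ [a], by simpa using hm, ?_⟩
        · rcases hk with ⟨rfl, rfl⟩ | ⟨rfl, rfl⟩ <;>
            simpa [UBContents.update_get] using e
        · rcases hk with ⟨rfl, rfl⟩ | ⟨rfl, rfl⟩ <;>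
            simp [List.replicate_succ])
      (l := st.count) (s := s) (w := st.get) ⟨rfl, [], rfl, by cases st; simp_all⟩
    obtain ⟨m, hm, rfl⟩ := hw
    simp only [List.append_nil] at hm
    subst hm
    simp only [hs] at e
    have e₂ := exec_move (show UBStack.count' ≠ .count by simp) { s with cur := none } { st with
          word := (List.replicate st.count.length (st.get k).reverse).flatten ++ st.word
          count := []
          count' := st.count.reverse }.get
    refine .weaken (.seq e ?_) (t := _ + (2 * st.count.length + 1)) (by ring_nf; omega)
    cases st
    simp_all [UBContents.update_get]
  obtain ⟨s', w', ⟨hs, hw⟩, e⟩ := exec_loop_of_invariant (k := c)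
    (f := fun (s : Mem τ X) o => { s with cur := o })
    (p := seq (loop .count (fun s o => { s with cur := o })
        (seq (push .count' fun s => s.cur) (copy k))) (move .count' .count))
    (st.count.length * (5 * (st.get k).length + 4) + (2 * st.count.length + 1) + 1)
    (fun l s' w' => { s' with cur := none } = { s with cur := none } ∧ ∃ m, m ++ l = st.get c ∧
      w' = ({ st with
        word := (List.replicate (m.length * st.count.length) (st.get k).reverse).flatten ++
          st.word }.set l c).get)
    (by rintro l s' w' ⟨-, m, -, rfl⟩; rcases hk with ⟨rfl, rfl⟩ | ⟨rfl, rfl⟩ <;> rfl)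
    (by
      rintro a l s' w' ⟨hs, m, hm, rfl⟩
      have e := hinner { s' with cur := some a } ({ st with
        word := (List.replicate (m.length * st.count.length) (st.get k).reverse).flatten ++
          st.word }.set l c) (by rcases hk with ⟨rfl, rfl⟩ | ⟨rfl, rfl⟩ <;> exact h)
          (by rcases hk with ⟨rfl, rfl⟩ | ⟨rfl, rfl⟩ <;> exact h')
      refine ⟨{ s' with cur := none }, _, ?_, by simpa using hs, m ++ [a], by simpa using hm, rfl⟩
      rw [List.length_append, List.length_singleton, Nat.succ_mul, Nat.add_comm,
        List.replicate_add, List.flatten_append, List.append_assoc]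
      rcases hk with ⟨rfl, rfl⟩ | ⟨rfl, rfl⟩
      · simpa [UBContents.update_get] using e
      · simpa [UBContents.update_get] using e)
    (l := st.get c) (s := s) (w := st.get) ⟨rfl, [], rfl, by
      rcases hk with ⟨rfl, rfl⟩ | ⟨rfl, rfl⟩ <;> simp⟩
  obtain ⟨m, hm, rfl⟩ := hw
  simp only [List.append_nil] at hm
  subst hm
  simp only [hs] at e
  exact e

end StackProg

/-! ### Reading the description of a configuration -/

namespace StackProg

/-- The accumulator for unbounded prediction: whether the target was seen, how many separators were
read, and the last letter that was read. -/
structure UBAcc (S : Type) where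
  found : Bool
  phase : Fin 5
  target : S

instance {S : Type} [Finite S] : Finite (UBAcc S) :=
  Finite.of_injective (fun s => (s.found, s.phase, s.target)) (by
    rintro ⟨_, _, _⟩ ⟨_, _, _⟩ h
    simpa using h)

section

variable {S : Type} [Inhabited S]

/-- Read one letter of the description of a configuration. -/
def ubRead (s : Mem (UBAcc S) (S × Bool)) : Option S → Mem (UBAcc S) (S × Bool)
  | none => { s with acc := { s.acc with phase := s.acc.phase + 1 }, cur := none }
  | some x => { s with acc := { s.acc with target := x }, cur := some (x, false) }

/-- A value that depends on whether the current phase `p` is the phase `i`. -/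
def onPhase {α : Type} (p i : Fin 5) (a b : α) : α := if p = i then a else b

/-- Push the letter read during the given phase. -/
def pushIn (k : UBStack) (i : Fin 5) : StackProg UBStack (S × Bool) (Mem (UBAcc S) (S × Bool)) :=
  push k fun s => onPhase s.acc.phase i s.cur none

/-- Push `n` tokens. -/
def pushTokens (k : UBStack) : ℕ → StackProg UBStack (S × Bool) (Mem (UBAcc S) (S × Bool))
  | 0 => load id
  | n + 1 => seq (push k fun _ => some default) (pushTokens k n)

theorem exec_pushTokens (k : UBStack) (n : ℕ) (s : Mem (UBAcc S) (S × Bool))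
    (w : UBStack → List (S × Bool)) :
    Exec (pushTokens k n) s w s (Function.update w k (List.replicate n default ++ w k)) (n + 1) := by
  induction n generalizing w with
  | zero =>
    rw [List.replicate_zero, List.nil_append, Function.update_eq_self]
    exact Exec.load (f := id)
  | succ n ih =>
    have := Exec.seq (.push (k := k) (f := fun _ : Mem (UBAcc S) (S × Bool) => some default)
      (s := s) (w := w)) (ih (Function.update w k (default :: w k)))
    rw [Function.update_idem, Function.update_self] at this
    rw [List.replicate_succ', List.append_assoc]
    exact .weaken this (by omega)

/-- What is done for each letter of the input. -/
def ubStore (C : ℕ) : StackProg UBStack (S × Bool) (Mem (UBAcc S) (S × Bool)) :=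
  seq (pushIn .left 0) (seq (pushIn .leftMid 1) (seq (pushIn .rightMid 2) (seq (pushIn .right 3)
    (seq (pushTokens .rightCount C) (seq (pushTokens .leftCount C)
      (push .count fun _ => some default))))))

/-- The contents of the stacks while the input is read. -/
def ubContents (C : ℕ) (a b c d : List (S × Bool)) (n : ℕ) : UBContents (S × Bool) where
  left := a
  leftMid := b
  rightMid := c
  right := d
  rightCount := List.replicate (C * n) default
  leftCount := List.replicate (C * n) default
  count := List.replicate n default

theorem exec_ubStore (C : ℕ) (a b c d : List (S × Bool)) (n : ℕ) (s : Mem (UBAcc S) (S × Bool)) :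
    Exec (ubStore C) s (ubContents C a b c d n).get s
      (ubContents C ((onPhase s.acc.phase 0 s.cur none).toList ++ a)
        ((onPhase s.acc.phase 1 s.cur none).toList ++ b)
        ((onPhase s.acc.phase 2 s.cur none).toList ++ c)
        ((onPhase s.acc.phase 3 s.cur none).toList ++ d) (n + 1)).get (2 * C + 7) := by
  refine .weaken (.seq .push (.seq .push (.seq .push (.seq .push (.seq (exec_pushTokens _ _ _ _)
    (.seq (exec_pushTokens _ _ _ _) (.weaken (t := 1) ?_ le_rfl))))))) (by omega)
  have := Exec.push (k := UBStack.count) (f := fun _ : Mem (UBAcc S) (S × Bool) => some default)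
    (s := s) (w := { ubContents C ((onPhase s.acc.phase 0 s.cur none).toList ++ a)
        ((onPhase s.acc.phase 1 s.cur none).toList ++ b)
        ((onPhase s.acc.phase 2 s.cur none).toList ++ c)
        ((onPhase s.acc.phase 3 s.cur none).toList ++ d) (n + 1) with
          count := List.replicate n default }.get)
  have h : List.replicate (C * (n + 1)) (default : S × Bool) =
      List.replicate C default ++ List.replicate (C * n) default := by
    rw [Nat.mul_succ, Nat.add_comm, List.replicate_add]
  simpa only [ubContents, h, UBContents.update_get, List.replicate_succ, UBContents.set,
    UBContents.get, Option.toList_some, List.singleton_append] using this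

/-- A letter of the configuration, not marked. -/
abbrev unmarked (l : List S) : List (S × Bool) := l.map fun x => (x, false)

theorem execInput_ubStore (C : ℕ) (l : List S) (a b c d : List (S × Bool)) (n : ℕ)
    (s : Mem (UBAcc S) (S × Bool)) :
    ∃ s' : Mem (UBAcc S) (S × Bool), s'.acc.found = s.acc.found ∧ s'.acc.phase = s.acc.phase ∧
      ExecInput ubRead (ubStore C) (l.map some) s (ubContents C a b c d n).get s'
        (ubContents C (onPhase s.acc.phase 0 ((unmarked l).reverse ++ a) a)
          (onPhase s.acc.phase 1 ((unmarked l).reverse ++ b) b)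
          (onPhase s.acc.phase 2 ((unmarked l).reverse ++ c) c)
          (onPhase s.acc.phase 3 ((unmarked l).reverse ++ d) d) (n + l.length)).get
        (l.length * (2 * C + 8)) := by
  induction l generalizing a b c d n s with
  | nil => exact ⟨s, rfl, rfl, by
      simpa [onPhase] using ExecInput.nil (read := ubRead) (p := ubStore C) (s := s)
        (w := (ubContents C a b c d n).get)⟩
  | cons x l ih =>
    obtain ⟨s', h₁, h₂, e⟩ := ih _ _ _ _ (n + 1) (ubRead s (some x))
    refine ⟨s', h₁, h₂, ?_⟩
    have h : ∀ (i : Fin 5) (a : List (S × Bool)), onPhase (ubRead s (some x)).acc.phase i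
        ((unmarked l).reverse ++ ((onPhase (ubRead s (some x)).acc.phase i
          (ubRead s (some x)).cur none).toList ++ a))
        ((onPhase (ubRead s (some x)).acc.phase i (ubRead s (some x)).cur none).toList ++
          a) = onPhase s.acc.phase i ((unmarked (x :: l)).reverse ++ a) a := by
      intro i a
      change onPhase s.acc.phase i ((unmarked l).reverse ++ ((onPhase s.acc.phase i
          (some (x, false)) none).toList ++ a)) ((onPhase s.acc.phase i (some (x, false))
          none).toList ++ a) = _
      simp only [onPhase]
      split_ifs <;> simp
    have := ExecInput.cons (exec_ubStore C a b c d n (ubRead s (some x))) e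
    rw [h, h, h, h, show 1 + (2 * C + 7) + l.length * (2 * C + 8) =
      (x :: l).length * (2 * C + 8) by simp; ring, show n + 1 + l.length = n + (x :: l).length by
        simp; omega] at this
    exact this

theorem execInput_ubSeparator (C : ℕ) (a b c d : List (S × Bool)) (n : ℕ)
    (s : Mem (UBAcc S) (S × Bool)) :
    ExecInput ubRead (ubStore C) [none] s (ubContents C a b c d n).get (ubRead s none)
      (ubContents C a b c d (n + 1)).get (2 * C + 8) := by
  have := ExecInput.cons (exec_ubStore C a b c d n (ubRead s none)) .nil
  have h : ∀ (i : Fin 5) (a : List (S × Bool)), (onPhase (ubRead s none).acc.phase i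
      (ubRead s none).cur none).toList ++ a = a := by
    intro i a
    change (onPhase _ i none none).toList ++ a = a
    simp [onPhase]
  rw [h, h, h, h, show 1 + (2 * C + 7) + 0 = 2 * C + 8 by ring] at this
  exact this

/-- The number of separators read so far selects the stack that receives a letter. In phase 4 no
stack does; the target is recovered because `acc.target` is overwritten by each letter and the
target comes last. Counter tokens are pushed for every input symbol, separators included, so the
counters measure the encoded length. -/
theorem execInput_encode (C : ℕ) (i : UBPredInput S) (s₀ : Mem (UBAcc S) (S × Bool))
    (h₀ : s₀.acc.phase = 0) :
    ∃ s : Mem (UBAcc S) (S × Bool), s.acc.found = s₀.acc.found ∧ s.acc.target = i.target ∧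
      ExecInput ubRead (ubStore C) i.encode s₀ (fun _ => []) s
        (ubContents C (unmarked i.uL).reverse (unmarked i.v).reverse (unmarked i.w).reverse
          (unmarked i.uR).reverse i.encode.length).get (i.encode.length * (2 * C + 8)) := by
  obtain ⟨s₁, f₁, p₁, e₁⟩ := execInput_ubStore C i.uL [] [] [] [] 0 s₀
  have e₁' := execInput_ubSeparator C (unmarked i.uL).reverse [] [] [] i.uL.length s₁
  obtain ⟨s₂, f₂, p₂, e₂⟩ := execInput_ubStore C i.v (unmarked i.uL).reverse [] [] []
    (i.uL.length + 1) (ubRead s₁ none)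
  have e₂' := execInput_ubSeparator C (unmarked i.uL).reverse (unmarked i.v).reverse [] []
    (i.uL.length + 1 + i.v.length) s₂
  obtain ⟨s₃, f₃, p₃, e₃⟩ := execInput_ubStore C i.w (unmarked i.uL).reverse (unmarked i.v).reverse
    [] [] (i.uL.length + 1 + i.v.length + 1) (ubRead s₂ none)
  have e₃' := execInput_ubSeparator C (unmarked i.uL).reverse (unmarked i.v).reverse
    (unmarked i.w).reverse [] (i.uL.length + 1 + i.v.length + 1 + i.w.length) s₃
  obtain ⟨s₄, f₄, p₄, e₄⟩ := execInput_ubStore C i.uR (unmarked i.uL).reverse (unmarked i.v).reverse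
    (unmarked i.w).reverse [] (i.uL.length + 1 + i.v.length + 1 + i.w.length + 1) (ubRead s₃ none)
  have e₄' := execInput_ubSeparator C (unmarked i.uL).reverse (unmarked i.v).reverse
    (unmarked i.w).reverse (unmarked i.uR).reverse
    (i.uL.length + 1 + i.v.length + 1 + i.w.length + 1 + i.uR.length) s₄
  have e₅ := ExecInput.cons (exec_ubStore C (unmarked i.uL).reverse (unmarked i.v).reverse
    (unmarked i.w).reverse (unmarked i.uR).reverse
    (i.uL.length + 1 + i.v.length + 1 + i.w.length + 1 + i.uR.length + 1)
    (ubRead (ubRead s₄ none) (some i.target))) .nil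
  have q₁ : (ubRead s₁ none).acc.phase = 1 := by simp only [ubRead]; rw [p₁, h₀]; rfl
  have q₂ : (ubRead s₂ none).acc.phase = 2 := by simp only [ubRead]; rw [p₂, q₁]; rfl
  have q₃ : (ubRead s₃ none).acc.phase = 3 := by simp only [ubRead]; rw [p₃, q₂]; rfl
  have q₄ : (ubRead (ubRead s₄ none) (some i.target)).acc.phase = 4 := by
    simp only [ubRead]; rw [p₄, q₃]; rfl
  refine ⟨ubRead (ubRead s₄ none) (some i.target), ?_, rfl, ?_⟩
  · simp only [ubRead] at f₁ f₂ f₃ f₄ ⊢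
    rw [f₄, f₃, f₂, f₁]
  · rw [h₀] at e₁
    rw [q₁] at e₂
    rw [q₂] at e₃
    rw [q₃] at e₄
    rw [q₄] at e₅
    simp only [onPhase, Fin.isValue, reduceIte, List.append_nil, zero_add, Fin.reduceEq,
      Option.toList_none, List.nil_append] at e₁ e₂ e₃ e₄ e₅
    have key := (((((((e₁.append e₁').append e₂).append e₂').append e₃).append e₃').append e₄).append
      e₄').append e₅
    have hl : i.encode.length =
        i.uL.length + 1 + i.v.length + 1 + i.w.length + 1 + i.uR.length + 1 + 1 := by
      simp [UBPredInput.encode]; omega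
    have h0 : (fun _ => []) = (ubContents C ([] : List (S × Bool)) [] [] [] 0).get := by
      funext k
      cases k <;> simp [ubContents]
    rw [hl, h0]
    convert key using 1
    · simp [UBPredInput.encode]
    · ring

end

end StackProg

/-! ### The program for unbounded prediction -/

/-- Mark the first letter of a word. -/
def markHead {S : Type} : List (S × Bool) → List (S × Bool)
  | [] => []
  | x :: l => (x.1, true) :: l

/-- The local map acting on letters that carry a mark. -/
def markedLocal {S : Type} (f : S → S → S → S) (a b c : S × Bool) : S × Bool :=
  (f a.1 b.1 c.1, b.2)

namespace StackProg

theorem exec_move_get {X τ : Type} {k k' : UBStack} (hk : k ≠ k') (s : Mem τ X)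
    (st : UBContents X) :
    Exec (move k k') s st.get { s with cur := none }
      ((st.set [] k).set ((st.get k).reverse ++ st.get k') k').get
      (2 * (st.get k).length + 1) := by
  rw [← UBContents.update_get, ← UBContents.update_get]
  exact exec_move hk s _

theorem exec_clear_get {X τ : Type} (k : UBStack) (s : Mem τ X) (st : UBContents X) :
    Exec (clear k) s st.get { s with cur := none } (st.set [] k).get
      (2 * (st.get k).length + 1) := by
  rw [← UBContents.update_get]
  exact exec_clear k s _

/-- Mark the top letter of the stack `word`. -/
def markTop {S : Type} : StackProg UBStack (S × Bool) (Mem (UBAcc S) (S × Bool)) :=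
  seq (pop .word fun s o => { s with cur := o.map fun x => (x.1, true) })
    (push .word fun s => s.cur)

theorem exec_markTop {S : Type} (s : Mem (UBAcc S) (S × Bool)) (st : UBContents (S × Bool)) :
    ∃ o, Exec markTop s st.get { s with cur := o } { st with word := markHead st.word }.get 2 := by
  refine ⟨st.word.head?.map fun x => (x.1, true), ?_⟩
  have e := Exec.seq (.pop (k := UBStack.word) (s := s) (w := st.get)
    (f := fun s o => { s with cur := o.map fun x => (x.1, true) }))
    (.push (k := UBStack.word) (f := fun s : Mem (UBAcc S) (S × Bool) => s.cur))
  rw [Function.update_idem, Function.update_self, UBContents.update_get] at e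
  have h : markHead st.word = (st.word.head?.map fun x => (x.1, true)).toList ++ st.word.tail := by
    cases st.word <;> rfl
  rw [h]
  exact e

variable {S : Type} [DecidableEq S] (f : S → S → S → S)

/-- Record whether the marked letter is the target. -/
def ubAcc (s : UBAcc S) (x : S × Bool) : UBAcc S :=
  { s with found := s.found || (x.2 && decide (x.1 = s.target)) }

/-- Unroll the configuration, and then iterate the local map. -/
def ubMain : StackProg UBStack (S × Bool) (Mem (UBAcc S) (S × Bool)) :=
  seq (copies .rightCount .right) <| seq (move .rightMid .word) <| seq markTop <|
  seq (move .leftMid .word) <| seq (copies .leftCount .left) <| seq (clear .left) <|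
  seq (clear .right) <| seq (clear .count) <| iterate (markedLocal f) ubAcc .word .image

/-- The word is a stack, hence it is built from its right end. Cell 0 is marked at the moment it is
on top, namely after the right half has been stacked and before the left half is. -/
theorem exec_ubMain [Inhabited S] (C n : ℕ) (a b c d : List (S × Bool)) (ha : a.length ≤ n)
    (hb : b.length ≤ n) (hc : c.length ≤ n) (hd : d.length ≤ n) (s : Mem (UBAcc S) (S × Bool)) :
    ∃ s' : Mem (UBAcc S) (S × Bool), s'.acc = wordFold (markedLocal f) ubAcc s.acc
      ((List.replicate (C * n * n) a).flatten ++ (b ++ markHead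
        (c ++ (List.replicate (C * n * n) d).flatten))) ∧
    Exec (ubMain f) s (ubContents C a.reverse b.reverse c.reverse d.reverse n).get s' (fun _ => [])
      (2 * (C * n * (n * (5 * n + 4) + (2 * n + 1) + 2) + 1) + 5 * (2 * n + 1) + 2 +
        5 * (2 * (C * n * n * n) + 2 * n + 1) ^ 2) := by
  have e₁ := exec_copies .rightCount .right (by simp) s
    (ubContents C a.reverse b.reverse c.reverse d.reverse n) rfl rfl
  have e₂ := exec_move_get (show UBStack.rightMid ≠ .word by simp) { s with cur := none }
    (({ ubContents C a.reverse b.reverse c.reverse d.reverse n with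
      word := (List.replicate (C * n * n) d).flatten }).set [] .rightCount)
  obtain ⟨o, e₃⟩ := exec_markTop { s with cur := none }
    { ubContents C a.reverse b.reverse [] d.reverse n with
      word := c ++ (List.replicate (C * n * n) d).flatten
      rightCount := [] }
  have e₄ := exec_move_get (show UBStack.leftMid ≠ .word by simp) { s with cur := o }
    { ubContents C a.reverse b.reverse [] d.reverse n with
      word := markHead (c ++ (List.replicate (C * n * n) d).flatten)
      rightCount := [] }
  have e₅ := exec_copies .leftCount .left (by simp) { s with cur := none }
    { ubContents C a.reverse [] [] d.reverse n with
      word := b ++ markHead (c ++ (List.replicate (C * n * n) d).flatten)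
      rightCount := [] } rfl rfl
  have e₆ := exec_clear_get .left { s with cur := none }
    { ubContents C a.reverse [] [] d.reverse n with
      word := (List.replicate (C * n * n) a).flatten ++
        (b ++ markHead (c ++ (List.replicate (C * n * n) d).flatten))
      rightCount := []
      leftCount := [] }
  have e₇ := exec_clear_get .right { s with cur := none }
    { ubContents C [] [] [] d.reverse n with
      word := (List.replicate (C * n * n) a).flatten ++
        (b ++ markHead (c ++ (List.replicate (C * n * n) d).flatten))
      rightCount := []
      leftCount := [] }
  have e₈ := exec_clear_get .count { s with cur := none }
    { ubContents C [] [] [] [] n with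
      word := (List.replicate (C * n * n) a).flatten ++
        (b ++ markHead (c ++ (List.replicate (C * n * n) d).flatten))
      rightCount := []
      leftCount := [] }
  obtain ⟨s', hs', e₉⟩ := exec_iterate (markedLocal f) ubAcc
    (show UBStack.word ≠ .image by simp)
    ((List.replicate (C * n * n) a).flatten ++
        (b ++ markHead (c ++ (List.replicate (C * n * n) d).flatten))) { s with cur := none }
    ({ word := (List.replicate (C * n * n) a).flatten ++
        (b ++ markHead (c ++ (List.replicate (C * n * n) d).flatten)) } : UBContents _).get rfl rfl
  rw [UBContents.update_get] at e₉
  refine ⟨s', hs', ?_⟩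
  simp only [ubContents, UBContents.set, UBContents.get, List.length_replicate,
    List.reverse_reverse, List.append_nil, List.length_reverse] at e₁ e₂ e₃ e₄ e₅ e₆ e₇ e₈ e₉
  have e := e₁.seq (e₂.seq (e₃.seq (e₄.seq (e₅.seq (e₆.seq (e₇.seq (e₈.seq e₉)))))))
  have h0 : ({} : UBContents (S × Bool)).get = fun _ => [] := by funext k; cases k <;> rfl
  rw [h0] at e
  refine .weaken e ?_
  have hm : ∀ l : List (S × Bool), (markHead l).length = l.length := by
    intro l; cases l <;> rfl
  simp only [List.length_append, List.length_flatten, List.map_replicate, List.sum_replicate, hm,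
    smul_eq_mul]
  have h1 : C * n * (n * (5 * d.length + 4) + (2 * n + 1) + 2) + 1 ≤
    C * n * (n * (5 * n + 4) + (2 * n + 1) + 2) + 1 := by gcongr
  have h2 : C * n * (n * (5 * a.length + 4) + (2 * n + 1) + 2) + 1 ≤
    C * n * (n * (5 * n + 4) + (2 * n + 1) + 2) + 1 := by gcongr
  have h3 : C * n * n * a.length + (b.length + (c.length + C * n * n * d.length)) + 1 ≤
      2 * (C * n * n * n) + 2 * n + 1 := by
    have : C * n * n * a.length ≤ C * n * n * n := by gcongr
    have : C * n * n * d.length ≤ C * n * n * n := by gcongr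
    omega
  have h4 := Nat.pow_le_pow_left h3 2
  omega

end StackProg

/-! ### Words cut out of a configuration -/

/-- The restriction of a configuration to `n` cells from cell `lo` on, with cell `0` marked. -/
def cellSegment {S : Type} (c : ℤ → S) (lo : ℤ) (n : ℕ) : List (S × Bool) :=
  List.ofFn fun i : Fin n => (c (lo + i), decide (lo + (i : ℤ) = 0))

theorem length_cellSegment {S : Type} (c : ℤ → S) (lo : ℤ) (n : ℕ) : (cellSegment c lo n).length = n := by
  simp [cellSegment]

theorem caWord_cellSegment {S : Type} (f : S → S → S → S) (c : ℤ → S) (lo : ℤ) (n : ℕ) :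
    caWord (markedLocal f) (cellSegment c lo (n + 2)) = cellSegment (caMap f c) (lo + 1) n := by
  rw [cellSegment, caWord_ofFn, cellSegment]
  congr 1
  funext i
  simp only [patternMap, markedLocal, caMap, Nat.cast_add, Nat.cast_one, Nat.cast_ofNat]
  rw [show lo + 1 + (i : ℤ) - 1 = lo + i by ring, show lo + 1 + (i : ℤ) = lo + (i + 1) by ring,
    show lo + ((i : ℤ) + 1) + 1 = lo + (i + 2) by ring]

open StackProg in
theorem foldl_ubAcc {S : Type} [DecidableEq S] (l : List (S × Bool)) (s : UBAcc S) :
    (l.foldl ubAcc s).target = s.target ∧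
      ((l.foldl ubAcc s).found = true ↔ s.found = true ∨ (s.target, true) ∈ l) := by
  induction l generalizing s with
  | nil => simp
  | cons x l ih =>
    obtain ⟨h₁, h₂⟩ := ih (ubAcc s x)
    refine ⟨h₁, h₂.trans ?_⟩
    obtain ⟨x, b⟩ := x
    cases b
    · simp [ubAcc]
    · simp only [ubAcc, Bool.true_and, Bool.or_eq_true, decide_eq_true_eq, List.mem_cons,
        Prod.mk.injEq, and_true, or_assoc]
      rw [@eq_comm _ x]

-- The segment loses one cell at each end per step and the mark travels with the central letter.
-- Hence cell 0 is inspected exactly at the times `t` for which it still lies in `[lo + t, lo + n -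
-- t)`.
open StackProg in
theorem wordFold_cellSegment {S : Type} [DecidableEq S] (f : S → S → S → S) (n : ℕ) (c : ℤ → S)
    (lo : ℤ) (s : UBAcc S) :
    (wordFold (markedLocal f) ubAcc s (cellSegment c lo n)).found = true ↔
      s.found = true ∨ ∃ t : ℕ, lo + t ≤ 0 ∧ 0 < lo + n - t ∧ (caMap f)^[t] c 0 = s.target := by
  induction n using Nat.strong_induction_on generalizing c lo s with
  | _ n ih =>
  have hfold : ∀ l : List (S × Bool), l ≠ [] → wordFold (markedLocal f) ubAcc s l =
      wordFold (markedLocal f) ubAcc (l.foldl ubAcc s) (caWord (markedLocal f) l) := by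
    rintro (_ | ⟨a, l⟩) h
    · exact absurd rfl h
    · rw [wordFold]; rfl
  have hmem : (s.target, true) ∈ cellSegment c lo n ↔ lo ≤ 0 ∧ 0 < lo + n ∧ c 0 = s.target := by
    simp only [cellSegment, List.mem_ofFn, Prod.mk.injEq, decide_eq_true_eq]
    constructor
    · rintro ⟨i, h₁, h₂⟩
      rw [h₂] at h₁
      have := i.2
      exact ⟨by omega, by omega, h₁⟩
    · rintro ⟨h₁, h₂, h₃⟩
      refine ⟨⟨(-lo).toNat, by omega⟩, ?_, ?_⟩
      · rw [← h₃]; congr 1; simp only [Int.ofNat_toNat]; omega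
      · simp only [Int.ofNat_toNat]; omega
  obtain ⟨ht, hf⟩ := foldl_ubAcc (cellSegment c lo n) s
  match n with
  | 0 =>
    rw [show cellSegment c lo 0 = [] from rfl, wordFold]
    refine ⟨Or.inl, ?_⟩
    rintro (h | ⟨t, h₁, h₂, -⟩)
    · exact h
    · simp only [Nat.cast_zero] at h₂
      omega
  | 1 =>
    rw [hfold _ (by simp [cellSegment])]
    have : caWord (markedLocal f) (cellSegment c lo 1) = [] := by
      apply List.eq_nil_of_length_eq_zero
      rw [length_caWord, length_cellSegment]
    rw [this, wordFold, hf, hmem]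
    refine or_congr_right ⟨fun h => ⟨0, by simpa using h⟩, ?_⟩
    rintro ⟨t, h₁, h₂, h₃⟩
    obtain rfl : t = 0 := by simp only [Nat.cast_one] at h₂; omega
    exact ⟨by simpa using h₁, by simpa using h₂, h₃⟩
  | n + 2 =>
    rw [hfold _ (by simp [cellSegment]), caWord_cellSegment, ih n (by omega), hf, ht, hmem, or_assoc]
    refine or_congr_right ⟨?_, ?_⟩
    · rintro (h | ⟨t, h₁, h₂, h₃⟩)
      · exact ⟨0, by simpa using h⟩
      · exact ⟨t + 1, by push_cast; omega, by push_cast; omega, h₃⟩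
    · rintro ⟨t, h₁, h₂, h₃⟩
      cases t with
      | zero => exact Or.inl ⟨by simpa using h₁, by simpa using h₂, h₃⟩
      | succ t => exact Or.inr ⟨t, by push_cast at *; omega, by push_cast at *; omega, h₃⟩

theorem getElem_flatten_replicate {S : Type} (q : List S) (hq : q ≠ []) (K n : ℕ)
    (h : n < (List.replicate K q).flatten.length) :
    (List.replicate K q).flatten[n] =
      q[n % q.length]'(Nat.mod_lt _ (List.length_pos_iff.mpr hq)) := by
  induction K generalizing n with
  | zero => simp at h
  | succ K ih =>
    simp only [List.replicate_succ, List.flatten_cons] at h ⊢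
    rw [List.getElem_append]
    split_ifs with h'
    · congr 1
      rw [Nat.mod_eq_of_lt h']
    · rw [ih]
      congr 1
      exact (Nat.mod_eq_sub_mod (by omega)).symm

theorem getElem_append_replicate {S : Type} (p q : List S) (hq : q ≠ []) (K n : ℕ)
    (h : n < (p ++ (List.replicate K q).flatten).length) :
    (p ++ (List.replicate K q).flatten)[n] = eventuallyPeriodicWord p q hq n := by
  rw [List.getElem_append, eventuallyPeriodicWord]
  split_ifs with h'
  · rfl
  · exact getElem_flatten_replicate q hq K _ _

-- The comparison is split at cell 0. On the negative side the configuration is defined through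
-- reversed words, so the left half is read backwards there.
open StackProg in
theorem unroll_eq_cellSegment {S : Type} (i : UBPredInput S) (K : ℕ) :
    (List.replicate K (unmarked i.uL)).flatten ++ (unmarked i.v ++ markHead
        (unmarked i.w ++ (List.replicate K (unmarked i.uR)).flatten)) =
      cellSegment i.config (-(K * i.uL.length + i.v.length : ℕ))
        (K * i.uL.length + i.v.length + (i.w.length + K * i.uR.length)) := by
  have hun : ∀ l : List S, (List.replicate K (unmarked l)).flatten =
      unmarked (List.replicate K l).flatten := by
    intro l
    simp [unmarked, List.map_flatten]
  have hlen : ∀ l : List S, (List.replicate K l).flatten.length = K * l.length := by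
    intro l; simp
  have hmark : ∀ (l : List S), markHead (unmarked l) =
      List.ofFn fun i : Fin l.length => (l[i], decide ((i : ℕ) = 0)) := by
    intro l
    cases l with
    | nil => rfl
    | cons x l =>
      simp only [unmarked, List.map_cons, markHead, List.length_cons, List.ofFn_succ]
      simp only [Fin.getElem_fin, Fin.val_zero, List.getElem_cons_zero, decide_true, Fin.val_succ,
        List.getElem_cons_succ, Nat.add_eq_zero_iff, one_ne_zero, and_false, decide_false]
      congr 1
      apply List.ext_getElem <;> simp
  rw [hun, hun, ← List.append_assoc, ← List.map_append, ← List.map_append, hmark]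
  apply List.ext_getElem
  · simp [length_cellSegment, add_assoc]
  · intro n h₁ h₂
    rw [List.getElem_append]
    simp only [cellSegment, List.getElem_ofFn]
    split_ifs with h
    · simp only [List.getElem_map, List.length_map, List.length_append, hlen] at h ⊢
      have h3 : (-((K * i.uL.length + i.v.length : ℕ) : ℤ) + n) =
          Int.negSucc (K * i.uL.length + i.v.length - 1 - n) := by
        rw [Int.negSucc_eq]; omega
      rw [h3]
      simp only [UBPredInput.config, Prod.mk.injEq]
      constructor
      · rw [← getElem_append_replicate _ _ _ K _ (by simp; omega)]
        have h4 : i.v.reverse ++ (List.replicate K i.uL.reverse).flatten =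
            ((List.replicate K i.uL).flatten ++ i.v).reverse := by
          simp [List.reverse_flatten]
        simp only [h4]
        rw [List.getElem_reverse]
        congr 1
        simp only [List.length_append, hlen]
        omega
      · simp
    · simp only [List.length_map, List.length_append, hlen] at h ⊢
      have h3 : (-((K * i.uL.length + i.v.length : ℕ) : ℤ) + n) =
          Int.ofNat (n - (K * i.uL.length + i.v.length)) := by
        simp only [Int.ofNat_eq_natCast]; omega
      rw [h3]
      simp only [UBPredInput.config, Prod.mk.injEq]
      constructor
      · exact getElem_append_replicate _ _ _ K _ _
      · simp only [Int.ofNat_eq_natCast, Nat.cast_eq_zero]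

-- After time `C * size ^ 2` cell 0 shows nothing new, so every state it ever takes is seen on a
-- segment that reaches farther than this on both sides.
open StackProg in
theorem ubpred_polyTime {S : Type} [Finite S] [Nonempty S] (f : S → S → S → S) (C : ℕ)
    (hC : ∀ (i : UBPredInput S) (t : ℕ), C * i.size ^ 2 ≤ t →
      (caMap f)^[t] i.config 0 = (caMap f)^[C * i.size ^ 2] i.config 0) :
    (UBPRED f).PolyTime := by
  classical
  inhabit S
  refine StackProg.polyTime (W := UBStack) (X := S × Bool) (σ := Mem (UBAcc S) (S × Bool))
    (I := Option S) (O := Bool) _ _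
    ⟨⟨false, 0, default⟩, none, none, none⟩ ubRead (ubStore (C + 1))
    (ubMain f) (fun s => s.acc.found)
    (Polynomial.X * (2 * (Polynomial.C C + 1) + 8) +
      (2 * ((Polynomial.C C + 1) * Polynomial.X * (Polynomial.X * (5 * Polynomial.X + 4) +
        (2 * Polynomial.X + 1) + 2) + 1) + 5 * (2 * Polynomial.X + 1) + 2 +
        5 * (2 * ((Polynomial.C C + 1) * Polynomial.X * Polynomial.X * Polynomial.X) +
          2 * Polynomial.X + 1) ^ 2)) fun i => ?_
  change UBPredInput S at i
  obtain ⟨s₁, h₁, h₁', e₁⟩ := execInput_encode (C + 1) i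
    ⟨⟨false, 0, default⟩, none, none, none⟩ rfl
  have hN : i.encode.length = i.size + 5 := by
    simp [UBPredInput.encode, UBPredInput.size]; omega
  have hs : i.size = i.uL.length + i.v.length + i.w.length + i.uR.length := rfl
  obtain ⟨s₂, h₂, e₂⟩ := exec_ubMain f (C + 1) i.encode.length (unmarked i.uL) (unmarked i.v)
    (unmarked i.w) (unmarked i.uR) (by simp; omega) (by simp; omega) (by simp; omega)
    (by simp; omega) s₁
  refine ⟨s₁, _, s₂, _, _, e₁, e₂, ?_, ?_⟩
  · rw [h₂, unroll_eq_cellSegment]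
    -- The factor `C + 1` keeps the inequality strict when `C = 0`; at least one copy of each period
    -- is thus present.
    have hK : C * i.size ^ 2 < (C + 1) * i.encode.length * i.encode.length := by
      rw [hN]
      nlinarith
    have hL : 0 < i.uL.length := List.length_pos_iff.mpr i.uL_ne
    have hR : 0 < i.uR.length := List.length_pos_iff.mpr i.uR_ne
    set K := (C + 1) * i.encode.length * i.encode.length
    have hKL : K ≤ K * i.uL.length := Nat.le_mul_of_pos_right _ hL
    have hKR : K ≤ K * i.uR.length := Nat.le_mul_of_pos_right _ hR
    have hsol : (UBPRED f).solution i =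
        decide (∃ t : ℕ, (caMap f)^[t] i.config 0 = i.target) := rfl
    rw [hsol, Bool.eq_iff_iff, decide_eq_true_iff, wordFold_cellSegment, h₁, h₁']
    simp only [Bool.false_eq_true, false_or]
    constructor
    · rintro ⟨t, -, -, h⟩
      exact ⟨t, h⟩
    · rintro ⟨t, h⟩
      by_cases ht : C * i.size ^ 2 ≤ t
      · exact ⟨C * i.size ^ 2, by omega, by omega, by rw [← hC i t ht, h]⟩
      · exact ⟨t, by omega, by omega, h⟩
  · simp [UBPRED]

/-! ### The dynamics of the marks -/

/-- The states of the shrinking zigzag zone automaton without the letters of `Q`. -/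
inductive ZSym where
  | b | bPlus | e | headLeft | headRight | l | r
  deriving DecidableEq

instance : Fintype ZSym where
  elems := {.b, .bPlus, .e, .headLeft, .headRight, .l, .r}
  complete s := by cases s <;> decide

/-- Forget the letters of `Q`. -/
def ZState.sym {Q : Type} : ZState Q → ZSym
  | .b => .b
  | .bPlus => .bPlus
  | .e => .e
  | .cell _ _ .headLeft => .headLeft
  | .cell _ _ .headRight => .headRight
  | .cell _ _ .l => .l
  | .cell _ _ .r => .r

namespace ZSym

/-- The pairs of marks that create an error. -/
def forbidden : ZSym → ZSym → Bool
  | .r, .l => true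
  | .l, .r => true
  | .headLeft, .headLeft => true
  | .headLeft, .headRight => true
  | .headRight, .headLeft => true
  | .headRight, .headRight => true
  | .r, .headLeft => true
  | .r, .headRight => true
  | .headLeft, .l => true
  | .headRight, .l => true
  | _, _ => false

/-- The movements of the heads. -/
def move : ZSym → ZSym → ZSym → ZSym
  | .l, .headLeft, .r => .r
  | .l, .l, .headLeft => .headLeft
  | .l, .headRight, .r => .l
  | .headRight, .r, .r => .headRight
  | .b, .l, .headLeft => .headLeft
  | .b, .headLeft, .r => .headRight
  | .b, .headRight, .r => .l
  | .b, .l, .headRight => .bPlus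
  | .headRight, .r, .b => .headRight
  | .l, .headRight, .b => .headLeft
  | .l, .headLeft, .b => .r
  | .headLeft, .r, .b => .bPlus
  | .b, _, .b => .r
  | .b, _, .bPlus => .r
  | .bPlus, _, .b => .r
  | .bPlus, _, .bPlus => .r
  | _, s, _ => s

/-- The local map on states without letters. -/
def next : ZSym → ZSym → ZSym → ZSym
  | .e, _, _ => .e
  | _, .e, _ => .e
  | _, _, .e => .e
  | _, .b, _ => .b
  | _, .bPlus, _ => .b
  | p, s, n => if p.forbidden s || s.forbidden n then .e else move p s n

/-- The neighborhoods that may occur after one step if no error occurs in two steps. -/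
def settling : ZSym → ZSym → ZSym → Bool
  | .e, _, _ => false
  | _, _, .e => false
  | _, .b, _ => true
  | .headLeft, .bPlus, .b | .headRight, .bPlus, .b | .b, .bPlus, .headLeft | .b, .bPlus, .headRight
  | .b, .bPlus, .l | .r, .bPlus, .b => true
  | .headLeft, .headLeft, .b | .bPlus, .headLeft, .b | .b, .headLeft, .headLeft
  | .b, .headLeft, .bPlus | .b, .headLeft, .r | .l, .headLeft, .headLeft | .l, .headLeft, .b
  | .l, .headLeft, .r => true
  | .headRight, .headRight, .b | .headRight, .headRight, .r | .bPlus, .headRight, .b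
  | .b, .headRight, .headRight | .b, .headRight, .bPlus | .b, .headRight, .r | .l, .headRight, .b
  | .l, .headRight, .r => true
  | .bPlus, .l, .headRight | .bPlus, .l, .r | .b, .l, .headLeft | .b, .l, .headRight | .b, .l, .l
  | .b, .l, .r | .l, .l, .headLeft | .l, .l, .headRight | .l, .l, .b | .l, .l, .l
  | .l, .l, .r => true
  | .headLeft, .r, .bPlus | .headLeft, .r, .b | .headLeft, .r, .r | .headRight, .r, .b
  | .headRight, .r, .r | .b, .r, .b | .b, .r, .r | .l, .r, .bPlus | .l, .r, .b | .l, .r, .r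
  | .r, .r, .b | .r, .r, .r => true
  | _, _, _ => false

/-- The neighborhoods that may occur after two steps if no error occurs in three steps. -/
def settled : ZSym → ZSym → ZSym → Bool
  | .e, _, _ => false
  | _, _, .e => false
  | _, .b, _ => true
  | .headRight, .bPlus, .b | .b, .bPlus, .headLeft | .b, .bPlus, .l | .r, .bPlus, .b => true
  | .bPlus, .headLeft, .b | .b, .headLeft, .r | .l, .headLeft, .b | .l, .headLeft, .r => true
  | .b, .headRight, .bPlus | .b, .headRight, .r | .l, .headRight, .b | .l, .headRight, .r => true
  | .bPlus, .l, .headRight | .b, .l, .headLeft | .b, .l, .headRight | .b, .l, .l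
  | .l, .l, .headLeft | .l, .l, .headRight | .l, .l, .b | .l, .l, .l => true
  | .headLeft, .r, .bPlus | .headLeft, .r, .b | .headLeft, .r, .r | .headRight, .r, .b
  | .headRight, .r, .r | .b, .r, .b | .b, .r, .r | .r, .r, .b | .r, .r, .r => true
  | _, _, _ => false

/-- A Boolean version of a universal statement on symbols. -/
def all (P : ZSym → Bool) : Bool :=
  P .b && P .bPlus && P .e && P .headLeft && P .headRight && P .l && P .r

theorem all_iff (P : ZSym → Bool) : all P = true ↔ ∀ s, P s = true := by
  simp only [all, Bool.and_eq_true]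
  constructor
  · rintro ⟨⟨⟨⟨⟨⟨_, _⟩, _⟩, _⟩, _⟩, _⟩, _⟩ s
    cases s <;> assumption
  · intro h
    simp [h]

/-- All windows of length five whose factors of length three satisfy `P` are mapped to windows of
length three that satisfy `R`. -/
def imp5 (P R : ZSym → ZSym → ZSym → Bool) : Bool :=
  all fun s₁ => all fun s₂ => all fun s₃ => !P s₁ s₂ s₃ || all fun s₄ => !P s₂ s₃ s₄ ||
    all fun s₅ => !P s₃ s₄ s₅ || R (next s₁ s₂ s₃) (next s₂ s₃ s₄) (next s₃ s₄ s₅)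

theorem of_imp5 {P R : ZSym → ZSym → ZSym → Bool} (h : imp5 P R = true) {s₁ s₂ s₃ s₄ s₅ : ZSym}
    (h₁ : P s₁ s₂ s₃ = true) (h₂ : P s₂ s₃ s₄ = true) (h₃ : P s₃ s₄ s₅ = true) :
    R (next s₁ s₂ s₃) (next s₂ s₃ s₄) (next s₃ s₄ s₅) = true := by
  simp only [imp5, all_iff, Bool.or_eq_true, Bool.not_eq_true'] at h
  rcases h s₁ s₂ s₃ with h | h
  · simp [h] at h₁
  rcases h s₄ with h | h
  · simp [h] at h₂
  rcases h s₅ with h | h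
  · simp [h] at h₃
  exact h

/-- No error occurs in a window. -/
def noError (p s n : ZSym) : Bool :=
  p != .e && s != .e && n != .e

-- This check and the next two are exhaustive on windows of length five. Absence of errors at times
-- 0 and 1 makes the neighborhoods at time 1 `settling`; absence of errors at time 2 then makes
-- those at time 2 `settled`; and `settled`, which excludes `e`, is preserved forever. So errors
-- appear by time 2 or never.
set_option maxRecDepth 100000 in
theorem imp5_noError : imp5 noError (fun p s n => !noError p s n || settling p s n) = true := by
  decide +kernel

set_option maxRecDepth 100000 in
theorem imp5_settling : imp5 settling (fun p s n => !noError p s n || settled p s n) = true := by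
  decide +kernel

set_option maxRecDepth 100000 in
theorem imp5_settled : imp5 settled settled = true := by
  decide +kernel

end ZSym

/-- The marks evolve without looking at the letters, which reduces the analysis of stabilization to
a seven-letter automaton independent of `δ`. -/
theorem ZState.sym_zigzag {Q : Type} (δ : Q → Q → Q → Q) (p s n : ZState Q) :
    (zigzag δ p s n).sym = ZSym.next p.sym s.sym n.sym := by
  rcases p with _ | _ | _ | ⟨_, _, _ | _ | _ | _⟩ <;>
  rcases s with _ | _ | _ | ⟨_, _, _ | _ | _ | _⟩ <;>
  rcases n with _ | _ | _ | ⟨_, _, _ | _ | _ | _⟩ <;> rfl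

/-- The letters of a cell change only if its mark changes. -/
theorem ZState.zigzag_eq_of_sym_eq {Q : Type} (δ : Q → Q → Q → Q) (p s n : ZState Q)
    (h : (zigzag δ p s n).sym = s.sym) : zigzag δ p s n = s := by
  revert h
  rcases p with _ | _ | _ | ⟨_, _, _ | _ | _ | _⟩ <;>
  rcases s with _ | _ | _ | ⟨_, _, _ | _ | _ | _⟩ <;>
  rcases n with _ | _ | _ | ⟨_, _, _ | _ | _ | _⟩ <;> intro h <;> first | rfl | cases h

/-! ### Orbits without errors -/

namespace ZSym

/-- Orbits on which no error ever occurs, described through the neighborhoods that occur. -/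
structure SettledOrbit (o : ℕ → ℤ → ZSym) : Prop where
  step : ∀ t z, o (t + 1) z = next (o t (z - 1)) (o t z) (o t (z + 1))
  settled : ∀ t z, settled (o t (z - 1)) (o t z) (o t (z + 1)) = true

/-- The blank states. -/
def blank (s : ZSym) : Prop := s = .b ∨ s = .bPlus

instance : DecidablePred blank := fun s => inferInstanceAs (Decidable (s = .b ∨ s = .bPlus))

/-- This table and the following ones come from inspecting the local map on settled neighborhoods.
The adjacency facts at the end say that a nonblank segment reads `l…l`, at most one head, `r…r`; the
others describe how heads move, turn and delete. -/
theorem next_blank : ∀ p s n, settled p s n → blank s → next p s n = .b := by decide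
theorem next_l : ∀ p n, settled p .l n → n = .l ∨ blank n → next p .l n = .l := by decide
theorem next_r : ∀ p n, settled p .r n → p = .r ∨ blank p → next p .r n = .r := by decide
theorem next_l_headRight : ∀ p, settled p .l .headRight → p ≠ .b → next p .l .headRight = .l := by
  decide
theorem next_b_l_headRight : next .b .l .headRight = .bPlus := by decide
theorem next_l_headLeft : ∀ p, settled p .l .headLeft → next p .l .headLeft = .headLeft := by
  decide
theorem next_headLeft_r : ∀ p, settled p .headLeft .r → blank p →
    next p .headLeft .r = .headRight := by decide
theorem next_l_headLeft_any : ∀ n, settled .l .headLeft n → next .l .headLeft n = .r := by decide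
theorem next_headLeft_r_ne : ∀ n, settled .headLeft .r n → n ≠ .b → next .headLeft .r n = .r := by
  decide
theorem next_headLeft_r_b : next .headLeft .r .b = .bPlus := by decide
theorem next_headRight_r : ∀ n, settled .headRight .r n → next .headRight .r n = .headRight := by
  decide
theorem next_any_headRight_r : ∀ p, settled p .headRight .r → next p .headRight .r = .l := by
  decide
theorem next_l_headRight_blank : ∀ n, settled .l .headRight n → blank n →
    next .l .headRight n = .headLeft := by decide
theorem next_single : ∀ p s n, settled p s n → ¬ blank s → blank p → blank n → next p s n = .r := by
  decide
theorem right_of_l : ∀ p n, settled p .l n → n = .l ∨ n = .b ∨ n = .headLeft ∨ n = .headRight := by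
  decide
theorem left_of_l : ∀ p n, settled p .l n → p = .l ∨ blank p := by decide
theorem left_of_r : ∀ p n, settled p .r n → p = .r ∨ p = .b ∨ p = .headLeft ∨ p = .headRight := by
  decide
theorem right_of_r : ∀ p n, settled p .r n → n = .r ∨ blank n := by decide
theorem left_of_head : ∀ p s n, settled p s n → s = .headLeft ∨ s = .headRight →
    p = .l ∨ blank p := by decide
theorem right_of_head : ∀ p s n, settled p s n → s = .headLeft ∨ s = .headRight →
    n = .r ∨ blank n := by decide

namespace SettledOrbit

variable {o : ℕ → ℤ → ZSym} {t : ℕ} {z : ℤ}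

theorem blank_step (O : SettledOrbit o) (h : blank (o t z)) : o (t + 1) z = .b := by
  rw [O.step]; exact next_blank _ _ _ (O.settled t z) h

theorem keep_l (O : SettledOrbit o) (h : o t z = .l) (h' : o t (z + 1) = .l ∨ blank (o t (z + 1))) :
    o (t + 1) z = .l := by
  have := O.settled t z
  rw [h] at this
  rw [O.step, h]; exact next_l _ _ this h'

theorem keep_r (O : SettledOrbit o) (h : o t z = .r) (h' : o t (z - 1) = .r ∨ blank (o t (z - 1))) :
    o (t + 1) z = .r := by
  have := O.settled t z
  rw [h] at this
  rw [O.step, h]; exact next_r _ _ this h'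

theorem keep_l_headRight (O : SettledOrbit o) (h : o t z = .l) (h' : o t (z + 1) = .headRight) (h'' : o t (z - 1) ≠ .b) :
    o (t + 1) z = .l := by
  have := O.settled t z
  rw [h, h'] at this
  rw [O.step, h, h']; exact next_l_headRight _ this h''

theorem delete_left (O : SettledOrbit o) (h : o t z = .l) (h' : o t (z + 1) = .headRight) (h'' : o t (z - 1) = .b) :
    o (t + 1) z = .bPlus := by
  rw [O.step, h, h', h'', next_b_l_headRight]

theorem l_headLeft (O : SettledOrbit o) (h : o t z = .l) (h' : o t (z + 1) = .headLeft) : o (t + 1) z = .headLeft := by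
  have := O.settled t z
  rw [h, h'] at this
  rw [O.step, h, h']; exact next_l_headLeft _ this

theorem turn_left (O : SettledOrbit o) (h : o t z = .headLeft) (h' : o t (z + 1) = .r) (h'' : blank (o t (z - 1))) :
    o (t + 1) z = .headRight := by
  have := O.settled t z
  rw [h, h'] at this
  rw [O.step, h, h']; exact next_headLeft_r _ this h''

theorem headLeft_leaves (O : SettledOrbit o) (h : o t z = .headLeft) (h' : o t (z - 1) = .l) : o (t + 1) z = .r := by
  have := O.settled t z
  rw [h, h'] at this
  rw [O.step, h, h']; exact next_l_headLeft_any _ this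

theorem keep_r_headLeft (O : SettledOrbit o) (h : o t z = .r) (h' : o t (z - 1) = .headLeft) (h'' : o t (z + 1) ≠ .b) :
    o (t + 1) z = .r := by
  have := O.settled t z
  rw [h, h'] at this
  rw [O.step, h, h']; exact next_headLeft_r_ne _ this h''

theorem delete_right (O : SettledOrbit o) (h : o t z = .r) (h' : o t (z - 1) = .headLeft) (h'' : o t (z + 1) = .b) :
    o (t + 1) z = .bPlus := by
  rw [O.step, h, h', h'', next_headLeft_r_b]

theorem headRight_r (O : SettledOrbit o) (h : o t z = .r) (h' : o t (z - 1) = .headRight) :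
    o (t + 1) z = .headRight := by
  have := O.settled t z
  rw [h, h'] at this
  rw [O.step, h, h']; exact next_headRight_r _ this

theorem headRight_leaves (O : SettledOrbit o) (h : o t z = .headRight) (h' : o t (z + 1) = .r) : o (t + 1) z = .l := by
  have := O.settled t z
  rw [h, h'] at this
  rw [O.step, h, h']; exact next_any_headRight_r _ this

theorem turn_right (O : SettledOrbit o) (h : o t z = .headRight) (h' : o t (z - 1) = .l) (h'' : blank (o t (z + 1))) :
    o (t + 1) z = .headLeft := by
  have := O.settled t z
  rw [h, h'] at this
  rw [O.step, h, h']; exact next_l_headRight_blank _ this h''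

/-! #### Configurations in which cell `0` does not change -/

/-- From time `T` on, cell `0` does not change. -/
def StableFrom (o : ℕ → ℤ → ZSym) (T : ℕ) : Prop := ∀ s, T ≤ s → o s 0 = o T 0

theorem StableFrom.mono {T T' : ℕ} (h : StableFrom o T) (hT : T ≤ T') : StableFrom o T' :=
  fun s hs => by rw [h s (by omega), h T' hT]

theorem stableFrom_of_invariant (x : ZSym) (Inv : ℕ → Prop) (h0 : ∀ s, Inv s → o s 0 = x)
    (hs : ∀ s, Inv s → Inv (s + 1)) (ht : Inv t) : StableFrom o t := by
  have : ∀ k, Inv (t + k) := fun k => by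
    induction k with
    | zero => exact ht
    | succ k ih => exact hs _ ih
  intro s hs'
  obtain ⟨k, rfl⟩ := Nat.exists_eq_add_of_le hs'
  rw [h0 _ (this k), h0 _ ht]

theorem stable_of_blank (O : SettledOrbit o) (h : blank (o t 0)) : StableFrom o (t + 1) :=
  stableFrom_of_invariant .b (fun s => o s 0 = .b) (fun _ h => h)
    (fun _ h => O.blank_step (Or.inl h)) (O.blank_step h)

theorem stable_of_single (O : SettledOrbit o) (h : ¬ blank (o t 0)) (hl : blank (o t (-1))) (hr : blank (o t 1)) :
    StableFrom o (t + 1) := by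
  have key : ∀ s, ¬ blank (o s 0) ∧ blank (o s (-1)) ∧ blank (o s 1) →
      o (s + 1) 0 = .r ∧ o (s + 1) (-1) = .b ∧ o (s + 1) 1 = .b := by
    rintro s ⟨h, hl, hr⟩
    refine ⟨?_, O.blank_step hl, O.blank_step hr⟩
    rw [O.step]
    exact next_single _ _ _ (O.settled s 0) h hl hr
  refine stableFrom_of_invariant .r (fun s => o s 0 = .r ∧ o s (-1) = .b ∧ o s 1 = .b)
    (fun _ h => h.1) (fun s ⟨h, hl, hr⟩ => key s ⟨by rw [h]; decide, Or.inl hl, Or.inl hr⟩)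
    (key t ⟨h, hl, hr⟩)

/-- In a settled orbit an `l` followed by `l` or by a blank does not change, whatever is on its
left. A run of `l` that ends at a blank on the right can therefore never be reached by a head. -/
theorem stable_of_l (O : SettledOrbit o) {B : ℤ} (hB : 0 ≤ B) (h : ∀ z, 0 ≤ z → z ≤ B → o t z = .l)
    (hb : blank (o t (B + 1))) : StableFrom o t := by
  refine stableFrom_of_invariant .l
    (fun s => (∀ z, 0 ≤ z → z ≤ B → o s z = .l) ∧ blank (o s (B + 1)))
    (fun s h => h.1 0 le_rfl hB) (fun s ⟨h, hb⟩ => ⟨fun z h0 hz => O.keep_l (h z h0 hz) ?_,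
      Or.inl (O.blank_step hb)⟩) ⟨h, hb⟩
  rcases hz.lt_or_eq with hz | rfl
  · exact Or.inl (h _ (by omega) (by omega))
  · exact Or.inr hb

theorem stable_of_l_forever (O : SettledOrbit o) (h : ∀ z, 0 ≤ z → o t z = .l) : StableFrom o t :=
  stableFrom_of_invariant .l (fun s => ∀ z, 0 ≤ z → o s z = .l) (fun s h => h 0 le_rfl)
    (fun s h z h0 => O.keep_l (h z h0) (Or.inl (h _ (by omega)))) h

theorem stable_of_r (O : SettledOrbit o) {A : ℤ} (hA : A ≤ 0) (h : ∀ z, A ≤ z → z ≤ 0 → o t z = .r)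
    (ha : blank (o t (A - 1))) : StableFrom o t := by
  refine stableFrom_of_invariant .r
    (fun s => (∀ z, A ≤ z → z ≤ 0 → o s z = .r) ∧ blank (o s (A - 1)))
    (fun s h => h.1 0 hA le_rfl) (fun s ⟨h, ha⟩ => ⟨fun z hz h0 => O.keep_r (h z hz h0) ?_,
      Or.inl (O.blank_step ha)⟩) ⟨h, ha⟩
  rcases hz.lt_or_eq with hz | rfl
  · exact Or.inl (h _ (by omega) (by omega))
  · exact Or.inr ha

theorem stable_of_r_forever (O : SettledOrbit o) (h : ∀ z, z ≤ 0 → o t z = .r) : StableFrom o t :=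
  stableFrom_of_invariant .r (fun s => ∀ z, z ≤ 0 → o s z = .r) (fun s h => h 0 le_rfl)
    (fun s h z h0 => O.keep_r (h z h0) (Or.inl (h _ (by omega)))) h

/-- On an infinite run of `r` the head moves away forever. The condition `2 ≤ h` guarantees that the
cell just behind the head has an `l`, not a `b`, on its left, so that the deletion rule at the left
end does not apply. -/
theorem stable_of_headRight (O : SettledOrbit o) {h : ℤ} (hh : 2 ≤ h) (hl : ∀ z, 0 ≤ z → z < h → o t z = .l)
    (hd : o t h = .headRight) (hr : ∀ z, h < z → o t z = .r) : StableFrom o t := by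
  refine stableFrom_of_invariant .l (fun s => ∃ h : ℤ, 2 ≤ h ∧
    (∀ z, 0 ≤ z → z < h → o s z = .l) ∧ o s h = .headRight ∧ ∀ z, h < z → o s z = .r)
    (fun s ⟨h, hh, hl, _⟩ => hl 0 le_rfl (by omega)) ?_ ⟨h, hh, hl, hd, hr⟩
  rintro s ⟨h, hh, hl, hd, hr⟩
  refine ⟨h + 1, by omega, fun z h0 hz => ?_,
    O.headRight_r (hr _ (by omega)) (by rw [← hd]; congr 1; omega),
    fun z hz => O.keep_r (hr _ (by omega)) (Or.inl (hr _ (by omega)))⟩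
  rcases lt_trichotomy z (h - 1) with hz' | rfl | hz'
  · exact O.keep_l (hl _ h0 (by omega)) (Or.inl (hl _ (by omega) (by omega)))
  · refine O.keep_l_headRight (hl _ h0 (by omega)) (by rw [← hd]; congr 1; omega) ?_
    rw [hl _ (by omega) (by omega)]
    decide
  · obtain rfl : z = h := by omega
    exact O.headRight_leaves hd (hr _ (by omega))

theorem stable_of_headLeft (O : SettledOrbit o) {h : ℤ} (hh : h ≤ -2) (hl : ∀ z, z < h → o t z = .l)
    (hd : o t h = .headLeft) (hr : ∀ z, h < z → z ≤ 0 → o t z = .r) : StableFrom o t := by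
  refine stableFrom_of_invariant .r (fun s => ∃ h : ℤ, h ≤ -2 ∧
    (∀ z, z < h → o s z = .l) ∧ o s h = .headLeft ∧ ∀ z, h < z → z ≤ 0 → o s z = .r)
    (fun s ⟨h, hh, _, _, hr⟩ => hr 0 (by omega) le_rfl) ?_ ⟨h, hh, hl, hd, hr⟩
  rintro s ⟨h, hh, hl, hd, hr⟩
  refine ⟨h - 1, by omega, fun z hz => O.keep_l (hl _ (by omega)) (Or.inl (hl _ (by omega))),
    O.l_headLeft (hl _ (by omega)) (by rw [← hd]; congr 1; omega), fun z hz h0 => ?_⟩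
  rcases lt_trichotomy z (h + 1) with hz' | rfl | hz'
  · obtain rfl : z = h := by omega
    exact O.headLeft_leaves hd (hl _ (by omega))
  · refine O.keep_r_headLeft (hr _ (by omega) h0) (by rw [← hd]; congr 1; omega) ?_
    rw [hr _ (by omega) (by omega)]
    decide
  · exact O.keep_r (hr _ (by omega) h0) (Or.inl (hr _ (by omega) (by omega)))

end SettledOrbit

end ZSym

/-! ### Shrinking of a zone with a head -/

namespace ZSym

/-- The cells from `A` to `B`, prolonged to infinity on the left if `fA` and on the right if `fB`, form a
working zone whose head, in state `d`, is at `h`. -/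
structure Zone (c : ℤ → ZSym) (fA fB : Prop) (A h B : ℤ) (d : ZSym) : Prop where
  le_head : A ≤ h
  head_le : h ≤ B
  left : ∀ z, z < h → fA ∨ A ≤ z → c z = .l
  head : c h = d
  right : ∀ z, h < z → fB ∨ z ≤ B → c z = .r
  left_end : ¬ fA → blank (c (A - 1))
  right_end : ¬ fB → blank (c (B + 1))

namespace SettledOrbit

variable {o : ℕ → ℤ → ZSym} {t : ℕ} {fA fB : Prop} {A h B : ℤ}

/-- When the head moves right, the part of a zone on its left is kept, except perhaps its first cell. -/
theorem left_of_headRight (O : SettledOrbit o) (Z : Zone (o t) fA fB A h B .headRight) :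
    ∃ A', (A' = A ∧ ¬ (¬ fA ∧ h = A + 1 ∧ o t (A - 1) = .b) ∨
        A' = A + 1 ∧ h = A + 1 ∧ ¬ fA ∧ o (t + 1) A = .bPlus) ∧
      (∀ z, z < h → fA ∨ A' ≤ z → o (t + 1) z = .l) ∧ (¬ fA → blank (o (t + 1) (A' - 1))) := by
  have hd : o t (h - 1 + 1) = .headRight := by rw [← Z.head]; congr 1; omega
  have keep : ∀ z, z < h - 1 → fA ∨ A ≤ z → o (t + 1) z = .l := fun z hz hA =>
    O.keep_l (Z.left z (by omega) hA)
      (Or.inl (Z.left _ (by omega) (hA.imp_right fun _ => by omega)))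
  by_cases hb : ¬ fA ∧ h = A + 1 ∧ o t (A - 1) = .b
  · obtain ⟨hA, rfl, hb⟩ := hb
    have hdel : o (t + 1) A = .bPlus :=
      O.delete_left (Z.left _ (by omega) (Or.inr le_rfl)) Z.head hb
    refine ⟨A + 1, Or.inr ⟨rfl, rfl, hA, hdel⟩, fun z hz hz' => ?_, fun _ => Or.inr ?_⟩
    · rcases hz' with hz' | hz'
      · exact absurd hz' hA
      · omega
    · rw [← hdel]; congr 1; omega
  · refine ⟨A, Or.inl ⟨rfl, hb⟩, fun z hz hz' => ?_, fun hA => Or.inl (O.blank_step (Z.left_end hA))⟩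
    rcases (show z < h - 1 ∨ z = h - 1 by omega) with hz | rfl
    · exact keep z hz hz'
    · refine O.keep_l_headRight (Z.left _ (by omega) hz') hd fun hb' => ?_
      by_cases hl : fA ∨ A ≤ h - 1 - 1
      · rw [Z.left _ (by omega) hl] at hb'
        cases hb'
      · rw [not_or] at hl
        have hA : A = h - 1 := by
          rcases hz' with hz' | hz'
          · exact absurd hz' hl.1
          · omega
        exact hb ⟨hl.1, by omega, by rw [hA, hb']⟩

/-- When the head moves left, the part of a zone on its right is kept, except perhaps its last cell. -/
theorem right_of_headLeft (O : SettledOrbit o) (Z : Zone (o t) fA fB A h B .headLeft) :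
    ∃ B', (B' = B ∨ B' = B - 1 ∧ h = B - 1 ∧ o (t + 1) B = .bPlus) ∧
      (∀ z, h < z → fB ∨ z ≤ B' → o (t + 1) z = .r) ∧ (¬ fB → blank (o (t + 1) (B' + 1))) := by
  have hd : o t (h + 1 - 1) = .headLeft := by rw [← Z.head]; congr 1; omega
  have keep : ∀ z, h + 1 < z → fB ∨ z ≤ B → o (t + 1) z = .r := fun z hz hB =>
    O.keep_r (Z.right z (by omega) hB)
      (Or.inl (Z.right _ (by omega) (hB.imp_right fun _ => by omega)))
  by_cases hb : ¬ fB ∧ h = B - 1 ∧ o t (B + 1) = .b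
  · obtain ⟨hB, rfl, hb⟩ := hb
    have hdel : o (t + 1) B = .bPlus :=
      O.delete_right (Z.right _ (by omega) (Or.inr le_rfl)) (by rw [← Z.head]) hb
    refine ⟨B - 1, Or.inr ⟨rfl, rfl, hdel⟩, fun z hz hz' => ?_, fun _ => Or.inr ?_⟩
    · rcases hz' with hz' | hz'
      · exact absurd hz' hB
      · omega
    · rw [← hdel]; congr 1; omega
  · refine ⟨B, Or.inl rfl, fun z hz hz' => ?_, fun hB => Or.inl (O.blank_step (Z.right_end hB))⟩
    rcases (show h + 1 < z ∨ z = h + 1 by omega) with hz | rfl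
    · exact keep z hz hz'
    · refine O.keep_r_headLeft (Z.right _ (by omega) hz') hd fun hb' => ?_
      by_cases hl : fB ∨ h + 1 + 1 ≤ B
      · rw [Z.right _ (by omega) hl] at hb'
        cases hb'
      · rw [not_or] at hl
        have hB : B = h + 1 := by
          rcases hz' with hz' | hz'
          · exact absurd hz' hl.1
          · omega
        exact hb ⟨hl.1, by omega, by rw [hB, hb']⟩

/-- An upper bound for the number of steps until the next deletion of a cell of a zone. -/
def Phase (c : ℤ → ZSym) (fA : Prop) (A h B : ℤ) (d : ZSym) (p : ℤ) : Prop :=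
  d = .headRight ∧ (¬ fA ∧ h = A ∧ 2 ≤ p ∨ ¬ fA ∧ h = A + 1 ∧ c (A - 1) = .b ∧ 1 ≤ p ∨
    B - h + (B - A) + 6 ≤ p) ∨ d = .headLeft ∧ h - A + 3 ≤ p

/-- The potential `(2 * L + 10) * (B - A) + p` decreases at every step. The quantity `p ≥ 1` is fuel
until the next deletion at the left end: a trip right costs `B - h`, the way back `B - A`, and a few
steps are spent on turning. A left deletion shortens the zone and releases `2 * L + 10`, more than
any fresh fuel needed. The descent stops when cell 0 is deleted or alone, or when the head enters an
infinite arm; for such an arm the end `A ≤ -2` or `B ≥ 2` is an artificial cell at which the head is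
known never to affect cell 0 again. -/
theorem stable_of_zone_phase (O : SettledOrbit o) {L : ℤ} (k : ℕ) (hA : A ≤ 0) (hB : 0 ≤ B)
    (hfA : fA → A ≤ -2) (hfB : fB → 2 ≤ B) (hL : B - A ≤ L) {d : ZSym}
    (Z : Zone (o t) fA fB A h B d) {p : ℤ} (hp : Phase (o t) fA A h B d p)
    (hk : (2 * L + 10) * (B - A) + p ≤ k) : StableFrom o (t + k + 2) := by
  induction k generalizing t A h B d p with
  | zero =>
    exfalso
    have := Z.le_head
    have := Z.head_le
    have : 0 ≤ (2 * L + 10) * (B - A) := mul_nonneg (by omega) (by omega)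
    rcases hp with ⟨_, h | h | h⟩ | h <;> omega
  | succ k ih =>
    have hle := Z.le_head
    have hle' := Z.head_le
    have single : A = B → StableFrom o (t + (k + 1) + 2) := by
      intro hAB
      obtain rfl : A = 0 := by omega
      obtain rfl : B = 0 := by omega
      obtain rfl : h = 0 := by omega
      have h1 : ¬ fA := fun h => by have := hfA h; omega
      have h2 : ¬ fB := fun h => by have := hfB h; omega
      refine (O.stable_of_single ?_ (Z.left_end h1) (Z.right_end h2)).mono (by omega)
      rw [Z.head]
      rcases hp with ⟨rfl, _⟩ | ⟨rfl, _⟩ <;> decide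
    have hk' : t + (k + 1) + 2 = t + 1 + k + 2 := by omega
    rcases eq_or_lt_of_le (hle.trans hle') with hAB | hAB
    · exact single hAB
    have shrink : (2 * L + 10) * (B - (A + 1)) = (2 * L + 10) * (B - A) - (2 * L + 10) := by ring
    have shrink' : (2 * L + 10) * (B - 1 - A) = (2 * L + 10) * (B - A) - (2 * L + 10) := by ring
    rw [hk']
    rcases hp with ⟨rfl, hp⟩ | ⟨rfl, hp⟩
    · obtain ⟨A', hA', hl, hlb⟩ := O.left_of_headRight Z
      rcases hle'.lt_or_eq with hhB | rfl
      · -- the head moves right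
        have hh : o (t + 1) h = .l :=
          O.headRight_leaves Z.head (Z.right _ (by omega) (Or.inr (by omega)))
        have Z' : A' ≤ h → Zone (o (t + 1)) fA fB A' (h + 1) B .headRight := fun hle =>
          { le_head := by omega
            head_le := by omega
            left := fun z hz hz' => by
              rcases (show z < h ∨ z = h by omega) with hz | rfl
              · exact hl z hz hz'
              · exact hh
            head := O.headRight_r (Z.right _ (by omega) (Or.inr (by omega)))
              (by rw [← Z.head]; congr 1; omega)
            right := fun z hz hz' => O.keep_r (Z.right _ (by omega) hz')
              (Or.inl (Z.right _ (by omega) (hz'.imp_right fun _ => by omega)))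
            left_end := hlb
            right_end := fun hB => Or.inl (O.blank_step (Z.right_end hB)) }
        rcases hA' with ⟨rfl, hA'⟩ | ⟨rfl, rfl, hfA', hdel⟩
        · rcases hp with ⟨h1, rfl, hp⟩ | ⟨h1, h2, h3, hp⟩ | hp
          · exact ih hA hB hfA hfB hL (Z' hle) (p := 1) (Or.inl ⟨rfl, Or.inr (Or.inl ⟨h1, rfl,
              O.blank_step (Z.left_end h1), le_rfl⟩)⟩) (by omega)
          · exact absurd ⟨h1, h2, h3⟩ hA'
          · exact ih hA hB hfA hfB hL (Z' hle) (p := p - 1)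
              (Or.inl ⟨rfl, Or.inr (Or.inr (by omega))⟩) (by omega)
        · rcases hA.lt_or_eq with hA | rfl
          · refine ih (by omega) hB (fun h => absurd h hfA') hfB (by omega) (Z' le_rfl)
              (p := B - (A + 1 + 1) + (B - (A + 1)) + 6) (Or.inl ⟨rfl, Or.inr (Or.inr le_rfl)⟩) ?_
            have : 1 ≤ p := by omega
            omega
          · exact (O.stable_of_blank (Or.inr hdel)).mono (by omega)
      -- The head is at `B`. If this end is artificial, only `r` lies beyond it and the head
      -- escapes; otherwise it turns back.
      · by_cases hf : fB
        · refine (O.stable_of_headRight (hfB hf) (fun z h0 hz => Z.left z hz (Or.inr (by omega)))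
            Z.head (fun z hz => Z.right z hz (Or.inl hf))).mono (by omega)
        · have hh : o (t + 1) h = .headLeft :=
            O.turn_right Z.head (Z.left _ (by omega) (Or.inr (by omega))) (Z.right_end hf)
          have Z' : A' ≤ h → Zone (o (t + 1)) fA fB A' h h .headLeft := fun hle =>
            { le_head := by omega
              head_le := le_rfl
              left := hl
              head := hh
              right := fun z hz hz' => by
                rcases hz' with hz' | hz'
                · exact absurd hz' hf
                · omega
              left_end := hlb
              right_end := fun hB => Or.inl (O.blank_step (Z.right_end hB)) }
          rcases hA' with ⟨rfl, hA'⟩ | ⟨rfl, rfl, hfA', hdel⟩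
          · rcases hp with ⟨h1, rfl, hp⟩ | ⟨h1, h2, h3, hp⟩ | hp
            · omega
            · exact absurd ⟨h1, h2, h3⟩ hA'
            · exact ih hA hB hfA hfB hL (Z' hle) (p := p - 1) (Or.inr ⟨rfl, by omega⟩) (by omega)
          · rcases hA.lt_or_eq with hA | rfl
            · refine ih (by omega) hB (fun h => absurd h hfA') hfB (by omega) (Z' le_rfl)
                (p := 3) (Or.inr ⟨rfl, by omega⟩) ?_
              have : 1 ≤ p := by omega
              omega
            · exact (O.stable_of_blank (Or.inr hdel)).mono (by omega)
    · obtain ⟨B', hB', hr, hrb⟩ := O.right_of_headLeft Z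
      rcases hle.lt_or_eq with hAh | rfl
      · -- the head moves left
        have hh : o (t + 1) h = .r :=
          O.headLeft_leaves Z.head (Z.left _ (by omega) (Or.inr (by omega)))
        have Z' : h ≤ B' → Zone (o (t + 1)) fA fB A (h - 1) B' .headLeft := fun hle =>
          { le_head := by omega
            head_le := by omega
            right := fun z hz hz' => by
              rcases (show h < z ∨ z = h by omega) with hz | rfl
              · exact hr z hz hz'
              · exact hh
            head := O.l_headLeft (Z.left _ (by omega) (Or.inr (by omega)))
              (by rw [← Z.head]; congr 1; omega)
            left := fun z hz hz' => O.keep_l (Z.left _ (by omega) hz')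
              (Or.inl (Z.left _ (by omega) (hz'.imp_right fun _ => by omega)))
            right_end := hrb
            left_end := fun hA => Or.inl (O.blank_step (Z.left_end hA)) }
        rcases hB' with rfl | ⟨rfl, rfl, hdel⟩
        · exact ih hA hB hfA hfB hL (Z' hle') (p := p - 1) (Or.inr ⟨rfl, by omega⟩) (by omega)
        -- No cell is deleted in an infinite right arm: cell `B` would be both `r` and `bPlus`.
        · by_cases hfB' : fB
          · rw [hr B (by omega) (Or.inl hfB')] at hdel
            cases hdel
          rcases hB.lt_or_eq with hB | rfl
          · exact ih hA (by omega) hfA (fun h => absurd h hfB') (by omega) (Z' le_rfl)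
              (p := p - 1) (Or.inr ⟨rfl, by omega⟩) (by omega)
          · exact (O.stable_of_blank (Or.inr hdel)).mono (by omega)
      · by_cases hf : fA
        · exact (O.stable_of_headLeft (hfA hf) (fun z hz => Z.left z hz (Or.inl hf))
            Z.head (fun z hz h0 => Z.right z hz (Or.inr (by omega)))).mono (by omega)
        · have hh : o (t + 1) A = .headRight :=
            O.turn_left Z.head (Z.right _ (by omega) (Or.inr (by omega))) (Z.left_end hf)
          have Z' : A ≤ B' → Zone (o (t + 1)) fA fB A A B' .headRight := fun hle =>
            { le_head := le_rfl
              head_le := hle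
              right := hr
              head := hh
              left := fun z hz hz' => by
                rcases hz' with hz' | hz'
                · exact absurd hz' hf
                · omega
              right_end := hrb
              left_end := fun hA => Or.inl (O.blank_step (Z.left_end hA)) }
          rcases hB' with rfl | ⟨rfl, rfl, hdel⟩
          · exact ih hA hB hfA hfB hL (Z' hle') (p := p - 1)
              (Or.inl ⟨rfl, Or.inl ⟨hf, rfl, by omega⟩⟩) (by omega)
          · by_cases hfB' : fB
            · rw [hr B (by omega) (Or.inl hfB')] at hdel
              cases hdel
            rcases hB.lt_or_eq with hB | rfl
            · exact ih hA (by omega) hfA (fun h => absurd h hfB') (by omega) (Z' le_rfl)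
                (p := p - 1) (Or.inl ⟨rfl, Or.inl ⟨hf, rfl, by omega⟩⟩) (by omega)
            · exact (O.stable_of_blank (Or.inr hdel)).mono (by omega)

theorem stable_of_zone (O : SettledOrbit o) {L : ℕ} (hA : A ≤ 0) (hB : 0 ≤ B)
    (hfA : fA → A ≤ -2) (hfB : fB → 2 ≤ B) (hL : B - A ≤ L) {d : ZSym}
    (Z : Zone (o t) fA fB A h B d) (hd : d = .headLeft ∨ d = .headRight) :
    StableFrom o (t + (2 * L + 10) * (L + 1)) := by
  have h1 := Z.le_head
  have h2 := Z.head_le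
  have h3 : (2 * (L : ℤ) + 10) * (B - A) ≤ (2 * L + 10) * L :=
    mul_le_mul_of_nonneg_left hL (by omega)
  refine (O.stable_of_zone_phase (L := L) ((2 * L + 10) * L + (2 * L + 6)) hA hB hfA hfB hL Z
    (p := 2 * L + 6) ?_ (by push_cast; omega)).mono ?_
  · rcases hd with rfl | rfl
    · exact Or.inr ⟨rfl, by omega⟩
    · exact Or.inl ⟨rfl, Or.inr (Or.inr (by omega))⟩
  · have : (2 * L + 10) * (L + 1) = (2 * L + 10) * L + (2 * L + 10) := by ring
    omega

end SettledOrbit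

end ZSym

/-! ### Locating exceptions in periodic configurations -/

/-- Scanning a configuration to the right of a cell `z₀`, the first exception to a property, if any, is
found not farther than `N` cells after `z₀` and the origin. -/
def RightScan {X : Type} (c : ℤ → X) (N : ℤ) : Prop :=
  ∀ (P : X → Prop) (z₀ : ℤ), (∀ z, z₀ ≤ z → P (c z)) ∨
    ∃ z, z₀ ≤ z ∧ ¬ P (c z) ∧ (∀ y, z₀ ≤ y → y < z → P (c y)) ∧ z ≤ max z₀ 0 + N

/-- The mirror image of `RightScan`. -/
def LeftScan {X : Type} (c : ℤ → X) (N : ℤ) : Prop :=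
  ∀ (P : X → Prop) (z₀ : ℤ), (∀ z, z ≤ z₀ → P (c z)) ∨
    ∃ z, z ≤ z₀ ∧ ¬ P (c z) ∧ (∀ y, y ≤ z₀ → z < y → P (c y)) ∧ min z₀ 0 - N ≤ z

/-- If the first exception were too far out, subtracting one period would stay in the periodic
region and to the right of `z₀`, giving an earlier exception. -/
theorem rightScan_of_periodic {X : Type} {c : ℤ → X} {M p N : ℤ} (hp : 0 < p)
    (hN : M + p ≤ N) (hN' : p ≤ N) (hc : ∀ z, M ≤ z → c (z + p) = c z) : RightScan c N := by
  intro P z₀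
  by_cases h : ∀ z, z₀ ≤ z → P (c z)
  · exact Or.inl h
  right
  push Not at h
  obtain ⟨z, ⟨hz, hPz⟩, hmin⟩ := Int.exists_least_of_bdd (P := fun z => z₀ ≤ z ∧ ¬ P (c z))
    ⟨z₀, fun z hz => hz.1⟩ h
  refine ⟨z, hz, hPz, fun y hy hyz => by_contra fun hPy => absurd (hmin y ⟨hy, hPy⟩) (by omega), ?_⟩
  by_contra hlt
  have h1 := hc (z - p) (by omega)
  rw [sub_add_cancel] at h1
  have := hmin (z - p) ⟨by omega, by rw [← h1]; exact hPz⟩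
  omega

theorem LeftScan.of_neg {X : Type} {c : ℤ → X} {N : ℤ} (h : RightScan (fun z => c (-z)) N) :
    LeftScan c N := by
  intro P z₀
  rcases h P (-z₀) with h | ⟨z, h1, h2, h3, h4⟩
  · exact Or.inl fun z hz => by simpa using h (-z) (by omega)
  · exact Or.inr ⟨-z, by omega, h2, fun y hy hyz => by simpa using h3 (-y) (by omega) (by omega),
      by omega⟩

theorem leftScan_of_periodic {X : Type} {c : ℤ → X} {M p N : ℤ} (hp : 0 < p)
    (hN : M + p ≤ N) (hN' : p ≤ N) (hc : ∀ z, z ≤ -M → c (z - p) = c z) : LeftScan c N :=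
  .of_neg (rightScan_of_periodic hp hN hN' fun z hz => by
    rw [neg_add, ← sub_eq_add_neg]; exact hc _ (by omega))

/-! ### Stabilization of the mark of cell 0 -/

namespace ZSym.SettledOrbit

variable {o : ℕ → ℤ → ZSym} {t : ℕ}

/-- Scanning from the head finds either an infinite run of marks or the first other symbol, which
must be blank by the adjacency rules. This exhibits a `Zone`; the assumptions on the cells between 0
and `h` ensure that it contains cell 0. -/
theorem stable_of_head (O : SettledOrbit o) {N : ℕ} (hR : RightScan (o t) N) (hL : LeftScan (o t) N)
    {h : ℤ} (h1 : -N ≤ h) (h2 : h ≤ N) (hd : o t h = .headLeft ∨ o t h = .headRight)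
    (hl : ∀ z, 0 ≤ z → z < h → o t z = .l) (hr : ∀ z, h < z → z ≤ 0 → o t z = .r) :
    StableFrom o (t + (8 * N + 18) * (4 * N + 5)) := by
  have right : ∃ (fB : Prop) (B : ℤ), h ≤ B ∧ 0 ≤ B ∧ B ≤ 2 * N + 2 ∧ (fB → 2 ≤ B) ∧
      (∀ z, h < z → fB ∨ z ≤ B → o t z = .r) ∧ (¬ fB → blank (o t (B + 1))) := by
    rcases hR (· = .r) (h + 1) with hs | ⟨z, hz, hne, hs, hzN⟩
    · exact ⟨True, max 2 h, by omega, by omega, by omega, fun _ => by omega,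
        fun z hz _ => hs z (by omega), fun h => absurd trivial h⟩
    · refine ⟨False, z - 1, by omega, ?_, by omega, False.elim, fun y hy hyz =>
        hs y (by omega) (by have := hyz.resolve_left id; omega), fun _ => ?_⟩
      · by_contra h0
        exact hne (hr z (by omega) (by omega))
      · rw [sub_add_cancel]
        have hset := O.settled t (z - 1)
        rw [sub_add_cancel] at hset
        rcases hz.eq_or_lt with rfl | hz
        · rw [add_sub_cancel_right] at hset
          exact (right_of_head _ _ _ hset hd).resolve_left hne
        · rw [hs (z - 1) (by omega) (by omega)] at hset
          exact (right_of_r _ _ hset).resolve_left hne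
  have left : ∃ (fA : Prop) (A : ℤ), A ≤ h ∧ A ≤ 0 ∧ -(2 * N + 2) ≤ A ∧ (fA → A ≤ -2) ∧
      (∀ z, z < h → fA ∨ A ≤ z → o t z = .l) ∧ (¬ fA → blank (o t (A - 1))) := by
    rcases hL (· = .l) (h - 1) with hs | ⟨z, hz, hne, hs, hzN⟩
    · exact ⟨True, min (-2) h, by omega, by omega, by omega, fun _ => by omega,
        fun z hz _ => hs z (by omega), fun h => absurd trivial h⟩
    · refine ⟨False, z + 1, by omega, ?_, by omega, False.elim, fun y hy hyz =>
        hs y (by omega) (by have := hyz.resolve_left id; omega), fun _ => ?_⟩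
      · by_contra h0
        exact hne (hl z (by omega) (by omega))
      · rw [add_sub_cancel_right]
        have hset := O.settled t (z + 1)
        rw [add_sub_cancel_right] at hset
        rcases hz.eq_or_lt with rfl | hz
        · rw [sub_add_cancel] at hset
          exact (left_of_head _ _ _ hset hd).resolve_left hne
        · rw [hs (z + 1) (by omega) (by omega)] at hset
          exact (left_of_l _ _ hset).resolve_left hne
  obtain ⟨fB, B, hB1, hB2, hB3, hB4, hB5, hB6⟩ := right
  obtain ⟨fA, A, hA1, hA2, hA3, hA4, hA5, hA6⟩ := left
  have := O.stable_of_zone (L := 4 * N + 4) hA2 hB2 hA4 hB4 (by push_cast; omega)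
    ⟨hA1, hB1, hA5, rfl, hB5, hA6, hB6⟩ hd
  exact this.mono (le_of_eq (by ring))

/-- If cell 0 is `l`, the only symbol that can disturb it is the one that ends the run of `l` on its
right: nothing, a blank, or a head. The case `r` is the mirror image, and the other cases are
immediate or have the head at 0. -/
theorem stable (O : SettledOrbit o) {N : ℕ} (hR : RightScan (o t) N) (hL : LeftScan (o t) N) :
    StableFrom o (t + (8 * N + 18) * (4 * N + 5)) := by
  have pos : 1 ≤ (8 * N + 18) * (4 * N + 5) := Nat.mul_pos (by omega) (by omega)
  have hset := O.settled t 0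
  rcases hd : o t 0 with _ | _ | _ | _ | _ | _ | _
  · exact (O.stable_of_blank (Or.inl hd)).mono (by omega)
  · exact (O.stable_of_blank (Or.inr hd)).mono (by omega)
  · rw [hd] at hset
    exact absurd hset ((by decide : ∀ p n, ¬ ZSym.settled p .e n = true) _ _)
  · exact O.stable_of_head hR hL (h := 0) (by omega) (by omega) (Or.inl hd)
      (fun z _ _ => by omega) (fun z _ _ => by omega)
  · exact O.stable_of_head hR hL (h := 0) (by omega) (by omega) (Or.inr hd)
      (fun z _ _ => by omega) (fun z _ _ => by omega)
  · rcases hR (· = .l) 0 with hs | ⟨z, hz, hne, hs, hzN⟩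
    · exact (O.stable_of_l_forever hs).mono (by omega)
    · have hz0 : z ≠ 0 := fun h => hne (by rw [h, hd])
      have hset := O.settled t (z - 1)
      rw [sub_add_cancel, hs (z - 1) (by omega) (by omega)] at hset
      rcases (right_of_l _ _ hset).resolve_left hne with hb | hh
      · exact (O.stable_of_l (B := z - 1) (by omega) (fun y h0 hy => hs y h0 (by omega))
          (by rw [sub_add_cancel]; exact Or.inl hb)).mono (by omega)
      · exact O.stable_of_head hR hL (by omega) (by omega) hh hs (fun y _ _ => by omega)
  · rcases hL (· = .r) 0 with hs | ⟨z, hz, hne, hs, hzN⟩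
    · exact (O.stable_of_r_forever hs).mono (by omega)
    · have hz0 : z ≠ 0 := fun h => hne (by rw [h, hd])
      have hset := O.settled t (z + 1)
      rw [add_sub_cancel_right, hs (z + 1) (by omega) (by omega)] at hset
      rcases (left_of_r _ _ hset).resolve_left hne with hb | hh
      · exact (O.stable_of_r (A := z + 1) (by omega) (fun y hy h0 => hs y h0 (by omega))
          (by rw [add_sub_cancel_right]; exact Or.inl hb)).mono (by omega)
      · exact O.stable_of_head hR hL (by omega) (by omega) hh (fun y _ _ => by omega)
          (fun y hy h0 => hs y h0 hy)

end ZSym.SettledOrbit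

/-! ### Persistence of periodicity -/

section CellularAutomata

variable {S : Type} (f : S → S → S → S)

theorem caMap_iterate_succ (c : ℤ → S) (t : ℕ) (z : ℤ) : (caMap f)^[t + 1] c z =
    f ((caMap f)^[t] c (z - 1)) ((caMap f)^[t] c z) ((caMap f)^[t] c (z + 1)) := by
  rw [Function.iterate_succ_apply']; rfl

/-- A radius of 1 means that the periodic region recedes by at most one cell per step. -/
theorem caMap_iterate_periodic_right {c : ℤ → S} {M p : ℤ} (hc : ∀ z, M ≤ z → c (z + p) = c z)
    (t : ℕ) (z : ℤ) (hz : M + t ≤ z) : (caMap f)^[t] c (z + p) = (caMap f)^[t] c z := by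
  induction t generalizing z with
  | zero => exact hc z (by simpa using hz)
  | succ t ih =>
    push_cast at hz
    rw [caMap_iterate_succ, caMap_iterate_succ, add_sub_right_comm, add_right_comm, ih z (by omega),
      ih (z - 1) (by omega), ih (z + 1) (by omega)]

theorem caMap_iterate_periodic_left {c : ℤ → S} {M p : ℤ} (hc : ∀ z, z ≤ -M → c (z - p) = c z)
    (t : ℕ) (z : ℤ) (hz : z ≤ -(M + t)) : (caMap f)^[t] c (z - p) = (caMap f)^[t] c z := by
  induction t generalizing z with
  | zero => exact hc z (by simpa using hz)
  | succ t ih =>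
    push_cast at hz
    rw [caMap_iterate_succ, caMap_iterate_succ, sub_right_comm, ← add_sub_right_comm,
      ih z (by omega), ih (z - 1) (by omega), ih (z + 1) (by omega)]

end CellularAutomata

theorem eventuallyPeriodicWord_add_length {S : Type} (p q : List S) (hq : q ≠ []) {n : ℕ}
    (hn : p.length ≤ n) :
    eventuallyPeriodicWord p q hq (n + q.length) = eventuallyPeriodicWord p q hq n := by
  rw [eventuallyPeriodicWord, dif_neg (by omega), eventuallyPeriodicWord, dif_neg (by omega)]
  congr 1
  rw [Nat.sub_add_comm hn, Nat.add_mod_right]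

namespace UBPredInput

variable {S : Type} (i : UBPredInput S)

theorem config_add_length (z : ℤ) (hz : i.w.length ≤ z) :
    i.config (z + i.uR.length) = i.config z := by
  obtain ⟨n, rfl⟩ := Int.eq_ofNat_of_zero_le (a := z) (by omega)
  exact eventuallyPeriodicWord_add_length i.w i.uR i.uR_ne (by omega)

theorem config_sub_length (z : ℤ) (hz : z ≤ -(i.v.length + 1)) :
    i.config (z - i.uL.length) = i.config z := by
  obtain ⟨n, rfl⟩ : ∃ n : ℕ, z = Int.negSucc n := ⟨(-z - 1).toNat, by omega⟩
  have h : Int.negSucc n - i.uL.length = Int.negSucc (n + i.uL.reverse.length) := by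
    rw [List.length_reverse]
    omega
  rw [h]
  exact eventuallyPeriodicWord_add_length i.v.reverse i.uL.reverse (by simpa using i.uL_ne)
    (by rw [List.length_reverse]; omega)

theorem rightScan (f : S → S → S → S) (t : ℕ) :
    RightScan ((caMap f)^[t] i.config) (2 * i.size + t : ℕ) := by
  have := List.length_pos_iff.mpr i.uR_ne
  refine rightScan_of_periodic (M := i.w.length + t) (p := i.uR.length) (by omega) ?_ ?_
    (caMap_iterate_periodic_right f i.config_add_length t)
  all_goals rw [size]; push_cast; omega

theorem leftScan (f : S → S → S → S) (t : ℕ) :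
    LeftScan ((caMap f)^[t] i.config) (2 * i.size + t : ℕ) := by
  have := List.length_pos_iff.mpr i.uR_ne
  have := List.length_pos_iff.mpr i.uL_ne
  refine leftScan_of_periodic (M := i.v.length + 1 + t) (p := i.uL.length) (by omega) ?_ ?_
    (caMap_iterate_periodic_left f i.config_sub_length t)
  all_goals rw [size]; push_cast; omega

end UBPredInput

theorem RightScan.comp {X Y : Type} {c : ℤ → X} {N : ℤ} (h : RightScan c N) (g : X → Y) :
    RightScan (fun z => g (c z)) N := fun P => h fun x => P (g x)

theorem LeftScan.comp {X Y : Type} {c : ℤ → X} {N : ℤ} (h : LeftScan c N) (g : X → Y) :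
    LeftScan (fun z => g (c z)) N := fun P => h fun x => P (g x)

/-! ### Stabilization in quadratic time -/

section Stabilization

variable {Q : Type} (δ : Q → Q → Q → Q)

theorem zigzag_error_spreads (c : ℤ → ZState Q) {t : ℕ} {z : ℤ}
    (h : (caMap (zigzag δ))^[t] c z = .e) (j : ℕ) (y : ℤ) (hy : z - j ≤ y) (hy' : y ≤ z + j) :
    (caMap (zigzag δ))^[t + j] c y = .e := by
  induction j generalizing y with
  | zero =>
    obtain rfl : y = z := by push_cast at hy hy'; omega
    exact h
  | succ j ih =>
    push_cast at hy hy'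
    rw [← add_assoc, caMap_iterate_succ]
    have key : ∀ p s n : ZState Q, p = .e ∨ s = .e ∨ n = .e → zigzag δ p s n = .e := by
      rintro (_ | _ | _ | _) (_ | _ | _ | _) (_ | _ | _ | _) h <;> simp_all [zigzag]
    apply key
    rcases (show y = z - j - 1 ∨ y = z + j + 1 ∨ (z - j ≤ y ∧ y ≤ z + j) by omega) with hy | hy | hy
    · exact Or.inr (Or.inr (ih _ (by omega) (by omega)))
    · exact Or.inl (ih _ (by omega) (by omega))
    · exact Or.inr (Or.inl (ih _ hy.1 hy.2))

/-- The orbit of a configuration without errors at times `0`, `1` and `2` is settled from time `2`. -/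
theorem settledOrbit_zigzag (c : ℤ → ZState Q)
    (h : ∀ t ≤ 2, ∀ z, ((caMap (zigzag δ))^[t] c z).sym ≠ .e) :
    ZSym.SettledOrbit fun t z => ((caMap (zigzag δ))^[t + 2] c z).sym := by
  let o : ℕ → ℤ → ZSym := fun t z => ((caMap (zigzag δ))^[t] c z).sym
  have step : ∀ t z, o (t + 1) z = ZSym.next (o t (z - 1)) (o t z) (o t (z + 1)) := fun t z => by
    change ((caMap (zigzag δ))^[t + 1] c z).sym = _
    rw [caMap_iterate_succ, ZState.sym_zigzag]
  have noError : ∀ t ≤ 2, ∀ z, ZSym.noError (o t (z - 1)) (o t z) (o t (z + 1)) = true :=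
    fun t ht z => by
      have h1 : o t (z - 1) ≠ .e := h t ht _
      have h2 : o t z ≠ .e := h t ht _
      have h3 : o t (z + 1) ≠ .e := h t ht _
      simp [ZSym.noError, h1, h2, h3]
  have window : ∀ {P R : ZSym → ZSym → ZSym → Bool}, ZSym.imp5 P R = true → ∀ t,
      (∀ z, P (o t (z - 1)) (o t z) (o t (z + 1)) = true) →
      ∀ z, R (o (t + 1) (z - 1)) (o (t + 1) z) (o (t + 1) (z + 1)) = true := by
    intro P R hPR t hP z
    rw [step, step, step, sub_add_cancel, add_sub_cancel_right]
    have h1 := hP (z - 1)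
    have h3 := hP (z + 1)
    rw [sub_add_cancel] at h1
    rw [add_sub_cancel_right] at h3
    exact ZSym.of_imp5 hPR h1 (hP z) h3
  have s1 : ∀ z, ZSym.settling (o 1 (z - 1)) (o 1 z) (o 1 (z + 1)) = true := fun z => by
    have := window ZSym.imp5_noError 0 (noError 0 (by omega)) z
    rw [noError 1 (by omega)] at this
    simpa using this
  have s2 : ∀ z, ZSym.settled (o 2 (z - 1)) (o 2 z) (o 2 (z + 1)) = true := fun z => by
    have := window ZSym.imp5_settling 1 s1 z
    rw [noError 2 (by omega)] at this
    simpa using this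
  refine ⟨fun t z => ?_, fun t => ?_⟩
  · exact step (t + 2) z
  · induction t with
    | zero => exact s2
    | succ t ih => exact window ZSym.imp5_settled (t + 2) ih

/-- Either no error occurs up to time 2, and the marks at cell 0 freeze in quadratic time, or there
is an error by time 2 at linear distance from the origin, and cell 0 becomes `e` in linear time. -/
theorem zigzag_stabilizes (i : UBPredInput (ZState Q)) (t : ℕ) (ht : 1000 * i.size ^ 2 ≤ t) :
    (caMap (zigzag δ))^[t] i.config 0 = (caMap (zigzag δ))^[1000 * i.size ^ 2] i.config 0 := by
  have hsize : 2 ≤ i.size := by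
    have := List.length_pos_iff.mpr i.uL_ne
    have := List.length_pos_iff.mpr i.uR_ne
    rw [UBPredInput.size]
    omega
  set n := i.size with hn
  have hn2 : 2 * n ≤ n ^ 2 := by nlinarith
  by_cases h : ∀ t ≤ 2, ∀ z, ((caMap (zigzag δ))^[t] i.config z).sym ≠ .e
  · have O := settledOrbit_zigzag δ i.config h
    have hs := O.stable (t := 0) (N := 2 * n + 2) ((i.rightScan (zigzag δ) 2).comp ZState.sym)
      ((i.leftScan (zigzag δ) 2).comp ZState.sym)
    set T := 0 + (8 * (2 * n + 2) + 18) * (4 * (2 * n + 2) + 5) with hT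
    -- The product of the two linear factors is `(16n + 34)(8n + 13)`; the generous constant 1000
    -- absorbs the lower terms because `n ≥ 2`.
    have hT' : T + 2 ≤ 1000 * n ^ 2 := by
      rw [hT]
      nlinarith
    have key : ∀ k, (caMap (zigzag δ))^[T + 2 + k] i.config 0 =
        (caMap (zigzag δ))^[T + 2] i.config 0 := fun k => by
      induction k with
      | zero => rfl
      | succ k ih =>
        rw [← ih, ← add_assoc, caMap_iterate_succ]
        -- Only the mark is known to be constant; the letters follow, since they cannot change while
        -- the mark stays.
        apply ZState.zigzag_eq_of_sym_eq
        rw [← caMap_iterate_succ (zigzag δ)]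
        have h1 := hs (T + k + 1) (by omega)
        have h2 := hs (T + k) (by omega)
        have e1 : T + 2 + k + 1 = T + k + 1 + 2 := by omega
        have e2 : T + 2 + k = T + k + 2 := by omega
        rw [e1, e2]
        exact h1.trans h2.symm
    obtain ⟨a, rfl⟩ := Nat.exists_eq_add_of_le (hT'.trans ht)
    obtain ⟨b, hb⟩ := Nat.exists_eq_add_of_le hT'
    rw [key, hb, key]
  · push Not at h
    obtain ⟨s, hs, z, hz⟩ := h
    -- The error may be anywhere; scanning from the origin on its side for a state equal to `e`
    -- replaces it by one nearby.
    have near : ∃ z : ℤ, -((2 * n + s : ℕ) : ℤ) ≤ z ∧ z ≤ (2 * n + s : ℕ) ∧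
        (caMap (zigzag δ))^[s] i.config z = .e := by
      have hz' : (caMap (zigzag δ))^[s] i.config z = .e := by
        generalize (caMap (zigzag δ))^[s] i.config z = x at hz
        rcases x with _ | _ | _ | ⟨_, _, _ | _ | _ | _⟩ <;> first | rfl | cases hz
      rcases le_total 0 z with h0 | h0
      · rcases i.rightScan (zigzag δ) s (· ≠ .e) 0 with hs | ⟨y, h1, h2, -, h4⟩
        · exact absurd hz' (hs z h0)
        · rw [← hn] at h4
          exact ⟨y, by omega, by omega, not_not.mp h2⟩
      · rcases i.leftScan (zigzag δ) s (· ≠ .e) 0 with hs | ⟨y, h1, h2, -, h4⟩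
        · exact absurd hz' (hs z h0)
        · rw [← hn] at h4
          exact ⟨y, by omega, by omega, not_not.mp h2⟩
    obtain ⟨z, h1, h2, hz⟩ := near
    have key : ∀ t, 2 * n + s + s ≤ t → (caMap (zigzag δ))^[t] i.config 0 = .e := fun t ht => by
      obtain ⟨k, rfl⟩ := Nat.exists_eq_add_of_le (show s ≤ t by omega)
      exact zigzag_error_spreads δ _ hz k 0 (by omega) (by omega)
    rw [key t (by omega), key _ (by omega)]

end Stabilization

/-! ### Simulation of the automaton inside a working zone -/

/-- The symbol of a mark. -/
def ZMark.sym : ZMark → ZSym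
  | .headLeft => .headLeft
  | .headRight => .headRight
  | .l => .l
  | .r => .r

/-- The marks of a zone with head `d` at `h`. -/
def zoneMark (d : ZMark) (h z : ℤ) : ZMark :=
  if z < h then .l else if z = h then d else .r

namespace ZMark

theorem zoneMark_of_lt {d : ZMark} {h z : ℤ} (hz : z < h) : zoneMark d h z = .l := if_pos hz

theorem zoneMark_self {d : ZMark} {h : ℤ} : zoneMark d h h = d := by
  rw [zoneMark, if_neg (by omega), if_pos rfl]

theorem zoneMark_of_gt {d : ZMark} {h z : ℤ} (hz : h < z) : zoneMark d h z = .r := by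
  rw [zoneMark, if_neg (by omega), if_neg (by omega)]

end ZMark

section Simulation

open ZMark ZState

variable {Q : Type} (δ : Q → Q → Q → Q)

theorem sym_cell (x y : Q) (m : ZMark) : (cell x y m).sym = m.sym := by cases m <;> rfl

theorem eq_b_of_sym {s : ZState Q} (h : s.sym = .b) : s = .b := by
  rcases s with _ | _ | _ | ⟨_, _, _ | _ | _ | _⟩ <;> first | rfl | cases h

/-- In most transitions the letters are kept. -/
theorem zigzag_cell {x y : Q} {m m' : ZMark} {p n : ZState Q}
    (h : ZSym.next p.sym m.sym n.sym = m'.sym) (h₁ : ¬ (p.sym = .headRight ∧ m = .r))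
    (h₂ : ¬ (p.sym = .b ∧ m = .headRight)) : zigzag δ p (cell x y m) n = cell x y m' := by
  rcases p with _ | _ | _ | ⟨_, _, _ | _ | _ | _⟩ <;>
  rcases n with _ | _ | _ | ⟨_, _, _ | _ | _ | _⟩ <;>
  rcases m with _ | _ | _ | _ <;> rcases m' with _ | _ | _ | _ <;>
  first | rfl | (exfalso; cases h; done) | exact absurd ⟨rfl, rfl⟩ h₁ | exact absurd ⟨rfl, rfl⟩ h₂

theorem zigzag_blank {p s n : ZState Q} (hp : p.sym ≠ .e) (hn : n.sym ≠ .e) (hs : s.sym.blank) :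
    zigzag δ p s n = .b := by
  apply eq_b_of_sym
  rw [sym_zigzag]
  generalize p.sym = p at *
  generalize n.sym = n at *
  generalize s.sym = s at *
  revert p s n
  decide

/-- A zone without errors, whose head in state `d` is at `h`; its cells carry letters that satisfy `I`. -/
structure LetterZone (c : ℤ → ZState Q) (d : ZMark) (A h B : ℤ) (I : ℤ → Q → Q → Prop) : Prop where
  le_head : A ≤ h
  head_le : h ≤ B
  left : ∀ z, z < A → (c z).sym = .b ∨ (c z).sym = .bPlus ∧ d = .headRight ∧ h = A + 1
  cells : ∀ z, A ≤ z → z ≤ B → ∃ x y, c z = cell x y (zoneMark d h z) ∧ I z x y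
  right : ∀ z, B < z → (c z).sym = .b ∨ (c z).sym = .bPlus ∧ d = .headLeft ∧ h + 1 = B

namespace LetterZone

variable {δ} {c : ℤ → ZState Q} {d : ZMark} {A h B : ℤ} {I J : ℤ → Q → Q → Prop}

theorem mono (Z : LetterZone c d A h B I) (hIJ : ∀ z x y, A ≤ z → z ≤ B → I z x y → J z x y) :
    LetterZone c d A h B J :=
  ⟨Z.le_head, Z.head_le, Z.left, fun z h1 h2 => by
    obtain ⟨x, y, hc, hi⟩ := Z.cells z h1 h2
    exact ⟨x, y, hc, hIJ z x y h1 h2 hi⟩, Z.right⟩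

theorem sym_eq (Z : LetterZone c d A h B I) {z : ℤ} (h1 : A ≤ z) (h2 : z ≤ B) :
    (c z).sym = (zoneMark d h z).sym := by
  obtain ⟨x, y, hc, -⟩ := Z.cells z h1 h2
  rw [hc, sym_cell]

theorem sym_l (Z : LetterZone c d A h B I) {z : ℤ} (h1 : A ≤ z) (h2 : z < h) : (c z).sym = .l := by
  rw [Z.sym_eq h1 (by have := Z.head_le; omega), zoneMark_of_lt h2]; rfl

theorem sym_head (Z : LetterZone c d A h B I) : (c h).sym = d.sym := by
  rw [Z.sym_eq Z.le_head Z.head_le, zoneMark_self]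

theorem sym_r (Z : LetterZone c d A h B I) {z : ℤ} (h1 : h < z) (h2 : z ≤ B) : (c z).sym = .r := by
  rw [Z.sym_eq (by have := Z.le_head; omega) h2, zoneMark_of_gt h1]; rfl

theorem blank_left (Z : LetterZone c d A h B I) {z : ℤ} (hz : z < A) : (c z).sym.blank :=
  (Z.left z hz).imp_right And.left

theorem blank_right (Z : LetterZone c d A h B I) {z : ℤ} (hz : B < z) : (c z).sym.blank :=
  (Z.right z hz).imp_right And.left

theorem ne_e (Z : LetterZone c d A h B I) (z : ℤ) : (c z).sym ≠ .e := by
  rcases lt_or_ge z A with h1 | h1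
  · rcases Z.blank_left h1 with h | h <;> rw [h] <;> decide
  rcases lt_or_ge B z with h2 | h2
  · rcases Z.blank_right h2 with h | h <;> rw [h] <;> decide
  · rw [Z.sym_eq h1 h2]
    cases zoneMark d h z <;> decide

theorem blank_step (Z : LetterZone c d A h B I) {z : ℤ} (hz : (c z).sym.blank) :
    caMap (zigzag δ) c z = .b :=
  zigzag_blank δ (Z.ne_e _) (Z.ne_e _) hz

theorem blank_step' (Z : LetterZone c d A h B I) {z : ℤ} (hz : (c z).sym.blank) :
    (caMap (zigzag δ) c z).sym = .b := by
  rw [Z.blank_step hz]; rfl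

theorem sym_step (z : ℤ) : (caMap (zigzag δ) c z).sym =
    ZSym.next (c (z - 1)).sym (c z).sym (c (z + 1)).sym := sym_zigzag δ _ _ _

theorem left_cases (Z : LetterZone c d A h B I) {z : ℤ} (hz : z < h) :
    (c z).sym = .l ∧ A ≤ z ∨ (c z).sym = .b ∧ z < A ∨
      (c z).sym = .bPlus ∧ z < A ∧ d = .headRight ∧ h = A + 1 := by
  rcases lt_or_ge z A with h1 | h1
  · exact Or.inr ((Z.left z h1).imp (fun h => ⟨h, h1⟩) fun h => ⟨h.1, h1, h.2⟩)
  · exact Or.inl ⟨Z.sym_l h1 hz, h1⟩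

theorem right_cases (Z : LetterZone c d A h B I) {z : ℤ} (hz : h < z) :
    (c z).sym = .r ∧ z ≤ B ∨ (c z).sym = .b ∧ B < z ∨
      (c z).sym = .bPlus ∧ B < z ∧ d = .headLeft ∧ h + 1 = B := by
  rcases lt_or_ge B z with h1 | h1
  · exact Or.inr ((Z.right z h1).imp (fun h => ⟨h, h1⟩) fun h => ⟨h.1, h1, h.2⟩)
  · exact Or.inl ⟨Z.sym_r hz h1, h1⟩

/-- Letters of cells that are not entered by a head moving right, and that are not left by such a head at
the end of the zone, are kept. -/
theorem cell_step (Z : LetterZone c d A h B I) {z : ℤ} (h1 : A ≤ z) (h2 : z ≤ B) {m : ZMark}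
    (hm : ZSym.next (c (z - 1)).sym (c z).sym (c (z + 1)).sym = m.sym)
    (h₁ : ¬ (d = .headRight ∧ z = h + 1)) (h₂ : ¬ (d = .headRight ∧ z = h ∧ z = A)) :
    ∃ x y, caMap (zigzag δ) c z = cell x y m ∧ I z x y := by
  obtain ⟨x, y, hc, hI⟩ := Z.cells z h1 h2
  refine ⟨x, y, ?_, hI⟩
  change zigzag δ (c (z - 1)) (c z) (c (z + 1)) = _
  rw [hc, sym_cell] at hm
  rw [hc]
  refine zigzag_cell δ hm ?_ ?_
  · rintro ⟨hp, hm⟩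
    have hz : h < z := by
      by_contra hz
      rcases (show z < h ∨ z = h by omega) with hz | rfl
      · rw [zoneMark_of_lt hz] at hm; cases hm
      · rw [zoneMark_self] at hm
        subst hm
        rcases Z.left_cases (z := z - 1) (by omega) with ⟨h, _⟩ | ⟨h, _⟩ | ⟨h, _⟩ <;>
          (rw [h] at hp; cases hp)
    rcases (show z - 1 = h ∨ h < z - 1 by omega) with hz' | hz'
    · rw [hz', Z.sym_head] at hp
      refine h₁ ⟨?_, by omega⟩
      cases d <;> first | rfl | cases hp
    · rcases Z.right_cases hz' with ⟨h, _⟩ | ⟨h, _⟩ | ⟨h, _⟩ <;>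
          (rw [h] at hp; cases hp)
  · rintro ⟨hp, hm⟩
    rcases lt_trichotomy z h with hz | rfl | hz
    · rw [zoneMark_of_lt hz] at hm; cases hm
    · rw [zoneMark_self] at hm
      refine h₂ ⟨hm, rfl, ?_⟩
      by_contra hA
      rw [Z.sym_l (by omega) (by omega)] at hp
      cases hp
    · rw [zoneMark_of_gt hz] at hm; cases hm

/-- A head moving left. -/
theorem moveLeft (Z : LetterZone c .headLeft A h B I) (hA : A < h)
    (hB : h + 1 = B → (c (B + 1)).sym ≠ .b) :
    LetterZone (caMap (zigzag δ) c) .headLeft A (h - 1) B I where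
  le_head := by omega
  head_le := by have := Z.head_le; omega
  left z hz := Or.inl (Z.blank_step' (Z.blank_left hz))
  right z hz := Or.inl (Z.blank_step' (Z.blank_right hz))
  cells z h1 h2 := by
    refine Z.cell_step h1 h2 ?_ (by simp) (by simp)
    rcases (show z < h - 1 ∨ z = h - 1 ∨ z = h ∨ z = h + 1 ∨ h + 1 < z by omega) with
      hz | rfl | rfl | rfl | hz
    · rw [zoneMark_of_lt hz, Z.sym_l h1 (by omega), Z.sym_l (z := z + 1) (by omega) (by omega)]
      rcases Z.left_cases (z := z - 1) (by omega) with ⟨h', g⟩ | ⟨h', g⟩ | ⟨h', g, g', g''⟩ <;>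
        (rw [h']; rfl)
    · rw [zoneMark_self, Z.sym_l h1 (by omega), sub_add_cancel, Z.sym_head]
      rcases Z.left_cases (z := h - 1 - 1) (by omega) with ⟨h', g⟩ | ⟨h', g⟩ | ⟨h', g, g', g''⟩ <;>
        first | (rw [h']; rfl) | cases g'
    · rw [zoneMark_of_gt (by omega), Z.sym_head, Z.sym_l (z := z - 1) (by omega) (by omega)]
      rcases Z.right_cases (z := z + 1) (by omega) with ⟨h', g⟩ | ⟨h', g⟩ | ⟨h', g, g', g''⟩ <;>
        first | (rw [h']; rfl) | (exfalso; omega)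
    · rw [zoneMark_of_gt (by omega), Z.sym_r (by omega) h2, add_sub_cancel_right, Z.sym_head]
      rcases Z.right_cases (z := h + 1 + 1) (by omega) with ⟨h', -⟩ | ⟨h', -⟩ | ⟨h', -⟩
      · rw [h']; rfl
      · rcases h2.eq_or_lt with h2 | h2
        · rw [h2] at h'
          exact absurd h' (hB h2)
        · rw [Z.sym_r (by omega) (by omega)] at h'
          cases h'
      · rw [h']; rfl
    · rw [zoneMark_of_gt (by omega), Z.sym_r (by omega) h2,
        Z.sym_r (z := z - 1) (by omega) (by omega)]
      rcases Z.right_cases (z := z + 1) (by omega) with ⟨h', g⟩ | ⟨h', g⟩ | ⟨h', g, g', g''⟩ <;>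
        (rw [h']; rfl)

/-- A head moving left, whose right neighbor is the last cell of the zone, deletes that cell. -/
theorem moveLeft_delete (Z : LetterZone c .headLeft A h B I) (hA : A < h) (hB : h + 1 = B)
    (hb : (c (B + 1)).sym = .b) :
    LetterZone (caMap (zigzag δ) c) .headLeft A (h - 1) (B - 1) I ∧
      (caMap (zigzag δ) c B).sym = .bPlus := by
  have hdel : (caMap (zigzag δ) c B).sym = .bPlus := by
    rw [sym_step, hb, Z.sym_r (by omega) le_rfl, ← hB, add_sub_cancel_right, Z.sym_head]
    rfl
  refine ⟨⟨by omega, by omega, fun z hz => Or.inl (Z.blank_step' (Z.blank_left hz)), fun z h1 h2 => ?_,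
    fun z hz => ?_⟩, hdel⟩
  · refine Z.cell_step h1 (by omega) ?_ (by simp) (by simp)
    rcases (show z < h - 1 ∨ z = h - 1 ∨ z = h by omega) with hz | rfl | rfl
    · rw [zoneMark_of_lt hz, Z.sym_l h1 (by omega), Z.sym_l (z := z + 1) (by omega) (by omega)]
      rcases Z.left_cases (z := z - 1) (by omega) with ⟨h', g⟩ | ⟨h', g⟩ | ⟨h', g, g', g''⟩ <;>
        (rw [h']; rfl)
    · rw [zoneMark_self, Z.sym_l h1 (by omega), sub_add_cancel, Z.sym_head]
      rcases Z.left_cases (z := h - 1 - 1) (by omega) with ⟨h', g⟩ | ⟨h', g⟩ | ⟨h', g, g', g''⟩ <;>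
        first | (rw [h']; rfl) | cases g'
    · rw [zoneMark_of_gt (by omega), Z.sym_head, Z.sym_l (z := z - 1) (by omega) (by omega)]
      rcases Z.right_cases (z := z + 1) (by omega) with ⟨h', g⟩ | ⟨h', g⟩ | ⟨h', g, g', g''⟩ <;>
        first | (rw [h']; rfl) | (exfalso; omega)
  · rcases (show z = B ∨ B < z by omega) with rfl | hz
    · exact Or.inr ⟨hdel, rfl, by omega⟩
    · exact Or.inl (Z.blank_step' (Z.blank_right hz))

/-- The head turns at the left end of the zone. -/
theorem turnLeft (Z : LetterZone c .headLeft A A B I) (hB : A + 1 < B ∨ A + 1 = B ∧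
    (c (B + 1)).sym ≠ .b) : LetterZone (caMap (zigzag δ) c) .headRight A A B I where
  le_head := le_rfl
  head_le := Z.head_le
  left z hz := Or.inl (Z.blank_step' (Z.blank_left hz))
  right z hz := Or.inl (Z.blank_step' (Z.blank_right hz))
  cells z h1 h2 := by
    refine Z.cell_step h1 h2 ?_ (by simp) (by simp)
    rcases (show z = A ∨ z = A + 1 ∨ A + 1 < z by omega) with rfl | rfl | hz
    · rw [zoneMark_self, Z.sym_head, Z.sym_r (z := z + 1) (by omega) (by omega)]
      rcases Z.left (z - 1) (by omega) with h | ⟨-, h, -⟩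
      · rw [h]; rfl
      · cases h
    · rw [zoneMark_of_gt (by omega), Z.sym_r (by omega) h2, add_sub_cancel_right, Z.sym_head]
      rcases Z.right_cases (z := A + 1 + 1) (by omega) with ⟨h', -⟩ | ⟨h', -⟩ | ⟨h', -⟩
      · rw [h']; rfl
      · rcases hB with hB | ⟨hB, hb⟩
        · rw [Z.sym_r (by omega) (by omega)] at h'
          cases h'
        · rw [hB] at h'
          exact absurd h' hb
      · rw [h']; rfl
    · rw [zoneMark_of_gt (by omega), Z.sym_r (by omega) h2,
        Z.sym_r (z := z - 1) (by omega) (by omega)]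
      rcases Z.right_cases (z := z + 1) (by omega) with ⟨h', g⟩ | ⟨h', g⟩ | ⟨h', g, g', g''⟩ <;>
        (rw [h']; rfl)

/-- The head turns at the right end of the zone. -/
theorem turnRight (Z : LetterZone c .headRight A B B I) (hA : A + 1 < B) :
    LetterZone (caMap (zigzag δ) c) .headLeft A B B I where
  le_head := Z.le_head
  head_le := le_rfl
  left z hz := Or.inl (Z.blank_step' (Z.blank_left hz))
  right z hz := Or.inl (Z.blank_step' (Z.blank_right hz))
  cells z h1 h2 := by
    refine Z.cell_step h1 h2 ?_ (by omega) (by omega)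
    rcases (show z = B ∨ z = B - 1 ∨ z < B - 1 by omega) with rfl | rfl | hz
    · rw [zoneMark_self, Z.sym_head, Z.sym_l (z := z - 1) (by omega) (by omega)]
      rcases Z.right (z + 1) (by omega) with h | ⟨-, h, -⟩
      · rw [h]; rfl
      · cases h
    · rw [zoneMark_of_lt (by omega), Z.sym_l (z := B - 1) (by omega) (by omega), sub_add_cancel, Z.sym_head,
        Z.sym_l (z := B - 1 - 1) (by omega) (by omega)]
      rfl
    · rw [zoneMark_of_lt (by omega), Z.sym_l (z := z) (by omega) (by omega),
        Z.sym_l (z := z + 1) (by omega) (by omega)]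
      rcases Z.left_cases (z := z - 1) (by omega) with ⟨h', g⟩ | ⟨h', g⟩ | ⟨h', g, g', g''⟩ <;>
        (rw [h']; rfl)


/-- The letters of a cell entered by a head moving right, the head not being at the end of the zone. -/
theorem enter (Z : LetterZone c .headRight A h B I) (hB : h + 1 < B) :
    ∃ x y x' y' x'' y'', I h x y ∧ I (h + 1) x' y' ∧ I (h + 2) x'' y'' ∧
      caMap (zigzag δ) c (h + 1) = cell (δ y x' x'') x' .headRight := by
  obtain ⟨x, y, h0, hI0⟩ := Z.cells h Z.le_head Z.head_le
  have := Z.le_head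
  obtain ⟨x', y', h1, hI1⟩ := Z.cells (h + 1) (by omega) (by omega)
  obtain ⟨x'', y'', h2, hI2⟩ := Z.cells (h + 2) (by omega) (by omega)
  refine ⟨x, y, x', y', x'', y'', hI0, hI1, hI2, ?_⟩
  rw [zoneMark_self] at h0
  rw [zoneMark_of_gt (by omega)] at h1 h2
  change zigzag δ (c (h + 1 - 1)) (c (h + 1)) (c (h + 1 + 1)) = _
  rw [add_sub_cancel_right, add_assoc, show (1 : ℤ) + 1 = 2 from rfl, h0, h1, h2]
  rfl

/-- A head entering the last cell of the zone. -/
theorem enter_last (Z : LetterZone c .headRight A h B I) (hB : h + 1 = B) :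
    ∃ x y, I (h + 1) x y ∧ caMap (zigzag δ) c (h + 1) = cell x y .headRight := by
  obtain ⟨x, y, h0, -⟩ := Z.cells h Z.le_head Z.head_le
  have := Z.le_head
  obtain ⟨x', y', h1, hI1⟩ := Z.cells (h + 1) (by omega) (by omega)
  refine ⟨x', y', hI1, ?_⟩
  have h2 : c (h + 1 + 1) = .b := by
    rcases Z.right (h + 1 + 1) (by omega) with h | ⟨-, h, -⟩
    · exact eq_b_of_sym h
    · cases h
  rw [zoneMark_self] at h0
  rw [zoneMark_of_gt (by omega)] at h1
  change zigzag δ (c (h + 1 - 1)) (c (h + 1)) (c (h + 1 + 1)) = _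
  rw [add_sub_cancel_right, h0, h1, h2]
  rfl

/-- A head moving right inside a zone, the zone being cut at `A'`. -/
theorem moveRight_aux (Z : LetterZone c .headRight A h B I) (hB : h < B) {A' : ℤ} (hA' : A ≤ A')
    (hA'h : A' ≤ h) (hleft : ∀ z, z < A' → (caMap (zigzag δ) c z).sym = .b ∨
      (caMap (zigzag δ) c z).sym = .bPlus ∧ h = A')
    (hAh : A < h ∨ ∀ x y x' y', I A x y → I A x' y')
    (hkeep : h - 1 = A' → (c (A' - 1)).sym ≠ .b)
    (hJ : ∀ z x y, z ≠ h + 1 → I z x y → J z x y)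
    (hJ₁ : h + 1 < B → ∀ x y x' y' x'' y'', I h x y → I (h + 1) x' y' → I (h + 2) x'' y'' →
      J (h + 1) (δ y x' x'') x')
    (hJ₂ : h + 1 = B → ∀ x y, I (h + 1) x y → J (h + 1) x y) :
    LetterZone (caMap (zigzag δ) c) .headRight A' (h + 1) B J where
  le_head := by omega
  head_le := by omega
  left z hz := (hleft z hz).imp_right fun g => ⟨g.1, rfl, by omega⟩
  right z hz := Or.inl (Z.blank_step' (Z.blank_right hz))
  cells z h1 h2 := by
    rcases (show z = h + 1 ∨ z = h ∨ z < h ∨ h + 1 < z by omega) with rfl | rfl | hz | hz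
    · rw [zoneMark_self]
      rcases h2.lt_or_eq with h2 | h2
      · obtain ⟨x, y, x', y', x'', y'', hI, hI', hI'', hc⟩ := Z.enter h2
        exact ⟨_, _, hc, hJ₁ h2 _ _ _ _ _ _ hI hI' hI''⟩
      · obtain ⟨x, y, hI, hc⟩ := Z.enter_last h2
        exact ⟨_, _, hc, hJ₂ h2 _ _ hI⟩
    · rw [zoneMark_of_lt (by omega)]
      by_cases hzA : A < z
      · obtain ⟨x, y, hc, hI⟩ := Z.cell_step (δ := δ) (z := z) (m := .l) (by omega) h2 (by
          rw [Z.sym_head, Z.sym_l (by omega) (by omega), Z.sym_r (by omega) (by omega)]; rfl)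
          (by omega) (by omega)
        exact ⟨x, y, hc, hJ _ _ _ (by omega) hI⟩
      -- A head leaving the left end swaps the two letters of its cell. This is harmless by `hAh`,
      -- since `I A` then does not depend on the letters.
      · obtain rfl : z = A := by omega
        obtain ⟨x, y, h0, hI⟩ := Z.cells z le_rfl h2
        obtain ⟨x', y', h1, -⟩ := Z.cells (z + 1) (by omega) (by omega)
        rw [zoneMark_self] at h0
        rw [zoneMark_of_gt (by omega)] at h1
        refine ⟨y, x, ?_, hJ _ _ _ (by omega) (hAh.resolve_left (lt_irrefl _) _ _ _ _ hI)⟩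
        change zigzag δ (c (z - 1)) (c z) (c (z + 1)) = _
        have hb : c (z - 1) = .b := by
          rcases Z.left (z - 1) (by omega) with h | ⟨-, -, h⟩
          · exact eq_b_of_sym h
          · omega
        rw [h0, h1, hb]
        rfl
    · obtain ⟨x, y, hc, hI⟩ := Z.cell_step (δ := δ) (z := z) (m := .l) (by omega) h2 (by
        rw [Z.sym_l (z := z) (by omega) (by omega)]
        rcases (show z = h - 1 ∨ z < h - 1 by omega) with rfl | hz
        · rw [sub_add_cancel, Z.sym_head]
          rcases Z.left_cases (z := h - 1 - 1) (by omega) with ⟨g, -⟩ | ⟨g, g'⟩ | ⟨g, -⟩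
          · rw [g]; rfl
          · have hA : h - 1 = A' := by omega
            rw [hA] at g
            exact absurd g (hkeep hA)
          · rw [g]; rfl
        · rw [Z.sym_l (z := z + 1) (by omega) (by omega)]
          rcases Z.left_cases (z := z - 1) (by omega) with ⟨g, -⟩ | ⟨g, -⟩ | ⟨g, g', g'', g3⟩
          · rw [g]; rfl
          · rw [g]; rfl
          · omega) (by omega) (by omega)
      rw [zoneMark_of_lt (by omega)]
      exact ⟨x, y, hc, hJ _ _ _ (by omega) hI⟩
    · obtain ⟨x, y, hc, hI⟩ := Z.cell_step (δ := δ) (z := z) (m := .r) (by omega) h2 (by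
        rw [Z.sym_r (z := z) (by omega) (by omega), Z.sym_r (z := z - 1) (by omega) (by omega)]
        rcases Z.right_cases (z := z + 1) (by omega) with ⟨g, -⟩ | ⟨g, -⟩ | ⟨g, -⟩ <;> rw [g] <;> rfl)
        (by omega) (by omega)
      rw [zoneMark_of_gt (by omega)]
      exact ⟨x, y, hc, hJ _ _ _ (by omega) hI⟩

end LetterZone

end Simulation

/-! ### Sweeps and cycles of the head -/

section Simulation

open ZMark ZState

variable {Q : Type} {δ : Q → Q → Q → Q} {c : ℤ → ZState Q} {A h B : ℤ}

namespace LetterZone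

/-- The letters during a sweep to the right: the cells after `N` have been updated up to the head. -/
def Sweep (δ : Q → Q → Q → Q) (G : ℤ → Q) (N B h z : ℤ) (x y : Q) : Prop :=
  (N < z → z ≤ h → z < B → x = caMap δ G z) ∧ (h < z → x = G z) ∧ (z = h → z < B → y = G z)

/-- The second letter of the head cell is the state before the update. The three arguments of `δ`
are thus all old states, although the first letter on the left has already been overwritten, and the
new head cell in turn stores its old state in second position. -/
theorem sweep_cell {G : ℤ → Q} {N x y x' y' x'' y''} (hB : h + 1 < B)
    (h0 : Sweep δ G N B h h x y) (h1 : Sweep δ G N B h (h + 1) x' y')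
    (h2 : Sweep δ G N B h (h + 2) x'' y'') :
    Sweep δ G N B (h + 1) (h + 1) (δ y x' x'') x' := by
  rw [h0.2.2 rfl (by omega), h1.2.1 (by omega), h2.2.1 (by omega)]
  refine ⟨fun _ _ _ => ?_, fun h => by omega, fun _ _ => rfl⟩
  rw [caMap, add_sub_cancel_right, add_assoc, show (1 : ℤ) + 1 = 2 from rfl]

/-- `Sweep` claims nothing new at `B`: the last cell lacks a right neighbor to be updated with, and
it is deleted when the head comes back. -/
theorem sweep_last {G : ℤ → Q} {N x y} (hB : h + 1 = B) :
    Sweep δ G N B (h + 1) (h + 1) x y :=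
  ⟨fun _ _ _ => by omega, fun h => by omega, fun _ h => by omega⟩

theorem sweep_other {G : ℤ → Q} {N z x y} (hz : z ≠ h + 1) (hs : Sweep δ G N B h z x y) :
    Sweep δ G N B (h + 1) z x y :=
  ⟨fun h1 h2 => hs.1 h1 (by omega), fun h => hs.2.1 (by omega), fun h => by omega⟩

/-- A sweep to the right. -/
theorem sweepRight {G : ℤ → Q} {N : ℤ} (Z : LetterZone c .headRight A h B (Sweep δ G N B h))
    (hA : A < h) (hg : h - 1 = A → (c (A - 1)).sym ≠ .b) (hB : A + 1 < B) : ∃ s,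
    LetterZone ((caMap (zigzag δ))^[s] c) .headLeft A B B (fun z x _ => N < z → z < B →
      x = caMap δ G z) ∧ (∀ z, B < z → ((caMap (zigzag δ))^[s] c z).sym = .b) := by
  obtain ⟨n, hn⟩ := Int.eq_ofNat_of_zero_le (a := B - h) (by have := Z.head_le; omega)
  induction n generalizing c h with
  | zero =>
    obtain rfl : h = B := by omega
    refine ⟨1, (Z.turnRight hB).mono ?_, fun z hz => Z.blank_step' (Z.blank_right hz)⟩
    exact fun z x y _ _ hs h1 h2 => hs.1 h1 (by omega) h2
  | succ n ih =>
    have Z' := Z.moveRight_aux (δ := δ) (J := Sweep δ G N B (h + 1)) (by omega) le_rfl hA.le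
      (fun z hz => Or.inl (Z.blank_step' (Z.blank_left hz))) (Or.inl hA) hg
      (fun _ _ _ => sweep_other) (fun hB _ _ _ _ _ _ => sweep_cell hB)
      (fun hB _ _ _ => sweep_last hB)
    obtain ⟨s, hs⟩ := ih Z' (by omega) (by omega) (by push_cast at hn; omega)
    exact ⟨s + 1, hs⟩

/-- A sweep to the left. -/
theorem sweepLeft {I : ℤ → Q → Q → Prop} (Z : LetterZone c .headLeft A h B I) (hB : h < B)
    (hg : h + 1 = B → (c (B + 1)).sym ≠ .b) :
    ∃ s, LetterZone ((caMap (zigzag δ))^[s] c) .headRight A A B I := by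
  obtain ⟨n, hn⟩ := Int.eq_ofNat_of_zero_le (a := h - A) (by have := Z.le_head; omega)
  induction n generalizing c h with
  | zero =>
    obtain rfl : h = A := by omega
    exact ⟨1, Z.turnLeft ((show h + 1 < B ∨ h + 1 = B by omega).imp_right fun hB => ⟨hB, hg hB⟩)⟩
  | succ n ih =>
    obtain ⟨s, hs⟩ := ih (Z.moveLeft (δ := δ) (by omega) hg) (by omega) (by omega)
      (by push_cast at hn; omega)
    exact ⟨s + 1, hs⟩

/-- During a cycle, the head simulates one step of the automaton and the zone loses a cell at each
end. -/
theorem cycle {G : ℤ → Q} (Z : LetterZone c .headRight A A B fun z x _ => A < z → x = G z)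
    (hB : A + 3 ≤ B) : ∃ s, LetterZone ((caMap (zigzag δ))^[s] c) .headRight (A + 1) (A + 1) (B - 1)
      fun z x _ => A + 1 < z → x = caMap δ G z := by
  -- Cell `A + 1` is computed from the arbitrary letters of the first cell, so its new first letter
  -- is meaningless. Updates are therefore claimed only after `A + 1`, which serves as the head cell
  -- of the next cycle.
  have Z₁ := Z.moveRight_aux (δ := δ) (J := Sweep δ G (A + 1) B (A + 1)) (by omega) le_rfl le_rfl
    (fun z hz => Or.inl (Z.blank_step' (Z.blank_left hz)))
    (Or.inr fun x y x' y' _ h => absurd h (lt_irrefl _)) (by omega)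
    (fun z x y hz h => ⟨by omega, fun hz => h (by omega), fun h => absurd h hz⟩)
    (fun _ x y x' y' x'' y'' _ h _ => ⟨by omega, by omega, fun _ _ => h (by omega)⟩) (by omega)
  -- With a `b` on its left and the head on its right, cell `A` is deleted.
  have hdel : (caMap (zigzag δ) (caMap (zigzag δ) c) A).sym = .bPlus := by
    rw [sym_step, Z₁.sym_l le_rfl (by omega), Z₁.sym_head, Z.blank_step' (Z.blank_left (by omega))]
    rfl
  have Z₂ := Z₁.moveRight_aux (δ := δ) (J := Sweep δ G (A + 1) B (A + 1 + 1)) (by omega)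
    (A' := A + 1) (by omega) le_rfl (fun z hz => by
      rcases (show z = A ∨ z < A by omega) with rfl | hz
      · exact Or.inr ⟨hdel, rfl⟩
      · exact Or.inl (Z₁.blank_step' (Z₁.blank_left hz))) (Or.inl (by omega)) (by omega)
      (fun _ _ _ => sweep_other) (fun hB _ _ _ _ _ _ => sweep_cell hB) (by omega)
  -- The deleted cell is `bPlus` rather than `b` during exactly the step in which the head is next
  -- to the new left end. This prevents a second deletion; the same device protects the right end
  -- below.
  obtain ⟨s, Z₃, hb⟩ := Z₂.sweepRight (by omega) (fun _ => by
    rw [add_sub_cancel_right, hdel]; decide) (by omega)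
  have Z₄ := Z₃.moveLeft (δ := δ) (by omega) (by omega)
  obtain ⟨Z₅, hdel'⟩ := Z₄.moveLeft_delete (δ := δ) (by omega) (by omega)
    (Z₃.blank_step' (Z₃.blank_right (by omega)))
  obtain ⟨s', Z₆⟩ := Z₅.sweepLeft (δ := δ) (by omega) (fun _ => by
    rw [sub_add_cancel, hdel']; decide)
  refine ⟨s' + (1 + (1 + (s + (1 + 1)))), ?_⟩
  rw [Function.iterate_add_apply, Function.iterate_add_apply, Function.iterate_add_apply,
    Function.iterate_add_apply]
  exact Z₆.mono fun z x y _ h2 hx hz => hx hz (by omega)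

/-- The bounds `-t - 1` and `t` are those of the light cone of cell 0, with one more cell on the
left for the head, so each cycle passes from `t + 1` to `t`. -/
theorem cycles {G : ℤ → Q} (t : ℕ) (Z : LetterZone c .headRight (-t - 1) (-t - 1) t
    fun z x _ => -(t : ℤ) - 1 < z → x = G z) : ∃ s, LetterZone ((caMap (zigzag δ))^[s] c) .headRight
      (-1) (-1) 0 fun z x _ => -1 < z → x = (caMap δ)^[t] G z := by
  induction t generalizing c G with
  | zero => exact ⟨0, Z⟩
  | succ t ih =>
    obtain ⟨s, Z'⟩ := Z.cycle (δ := δ) (by push_cast; omega)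
    have e1 : -((t + 1 : ℕ) : ℤ) - 1 + 1 = -t - 1 := by push_cast; omega
    have e2 : ((t + 1 : ℕ) : ℤ) - 1 = t := by push_cast; omega
    rw [e1, e2] at Z'
    obtain ⟨s', Z''⟩ := ih Z'
    refine ⟨s' + s, ?_⟩
    rw [Function.iterate_add_apply]
    exact Z''

theorem eq_of_blank {s : ZState Q} (h : s.sym.blank) : s = .b ∨ s = .bPlus := by
  rcases s with _ | _ | _ | ⟨_, _, _ | _ | _ | _⟩ <;>
  first | exact Or.inl rfl | exact Or.inr rfl | (rcases h with h | h; cases h; cases h)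

/-- A cell whose surroundings are blank keeps its letters. -/
theorem isolated_step {x y : Q} {m : ZMark} (h0 : c 0 = cell x y m)
    (hz : ∀ z, z ≠ 0 → (c z).sym.blank) : caMap (zigzag δ) c 0 = cell x y .r ∧
      ∀ z, z ≠ 0 → (caMap (zigzag δ) c z).sym.blank := by
  have hne : ∀ z, (c z).sym ≠ .e := fun z => by
    by_cases h : z = 0
    · rw [h, h0, sym_cell]
      cases m <;> decide
    · rcases hz z h with h | h <;> rw [h] <;> decide
  constructor
  · change zigzag δ (c (0 - 1)) (c 0) (c (0 + 1)) = _
    have h1 := hz (0 - 1) (by omega)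
    have h2 := hz (0 + 1) (by omega)
    rw [h0]
    generalize c (0 - 1) = p at h1
    generalize c (0 + 1) = n at h2
    rcases eq_of_blank h1 with rfl | rfl <;> rcases eq_of_blank h2 with rfl | rfl <;>
    cases m <;> rfl
  · intro z h
    left
    change (zigzag δ _ _ _).sym = _
    rw [zigzag_blank δ (hne _) (hne _) (hz z h)]
    rfl

theorem isolated {x y : Q} {m : ZMark} (h0 : c 0 = cell x y m)
    (hz : ∀ z, z ≠ 0 → (c z).sym.blank) {s : ℕ} (hs : 1 ≤ s) :
    (caMap (zigzag δ))^[s] c 0 = cell x y .r := by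
  have key : ∀ s, (caMap (zigzag δ))^[s + 1] c 0 = cell x y .r ∧
      ∀ z, z ≠ 0 → ((caMap (zigzag δ))^[s + 1] c z).sym.blank := fun s => by
    induction s with
    | zero => exact isolated_step h0 hz
    | succ s ih =>
      rw [Function.iterate_succ_apply']
      exact isolated_step ih.1 ih.2
  obtain ⟨k, rfl⟩ := Nat.exists_eq_add_of_le' hs
  exact (key k).1

/-- When only the head and the result are left, the zone disappears. -/
theorem last {q : Q} (Z : LetterZone c .headRight (-1) (-1) 0 fun z x _ => -1 < z → x = q) :
    ∃ s, ∀ s', s ≤ s' → ∃ y, (caMap (zigzag δ))^[s'] c 0 = cell q y .r := by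
  have Z₁ := Z.moveRight_aux (δ := δ) (J := fun z x _ => -1 < z → x = q) (by omega) le_rfl le_rfl
    (fun z hz => Or.inl (Z.blank_step' (Z.blank_left hz)))
    (Or.inr fun x y x' y' _ h => absurd h (lt_irrefl _)) (by omega) (fun _ _ _ _ => id) (by omega)
    (fun _ _ _ => id)
  rw [neg_add_cancel] at Z₁
  obtain ⟨x, y, h0, hx⟩ := Z₁.cell_step (δ := δ) (z := 0) (m := .headLeft) (by omega) le_rfl (by
    rw [Z₁.sym_head, Z₁.sym_l (by omega) (by omega)]
    rcases Z₁.right (0 + 1) (by omega) with h | ⟨-, h, -⟩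
    · rw [h]; rfl
    · cases h) (by omega) (by omega)
  obtain rfl := hx (by omega)
  have hb : ∀ z, z ≠ 0 → (caMap (zigzag δ) (caMap (zigzag δ) c) z).sym.blank := fun z hz => by
    rcases (show z < -1 ∨ z = -1 ∨ 0 < z by omega) with hz | rfl | hz
    · exact Or.inl (Z₁.blank_step' (Z₁.blank_left hz))
    · right
      rw [sym_step, Z₁.sym_l le_rfl (by omega), Z.blank_step' (Z.blank_left (by omega)),
        neg_add_cancel, Z₁.sym_head]
      rfl
    · exact Or.inl (Z₁.blank_step' (Z₁.blank_right hz))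
  -- Two steps isolate cell 0, with the head turned into `headLeft` upon it; a third one changes
  -- that mark to `r`.
  refine ⟨3, fun s' hs' => ⟨y, ?_⟩⟩
  obtain ⟨k, rfl⟩ := Nat.exists_eq_add_of_le' hs'
  have := isolated (δ := δ) h0 hb (s := k + 1) (by omega)
  exact this

end LetterZone

/-! ### Initial configurations and padded words -/

/-- The initial configuration of the simulation: a head, followed by the letters of a finite pattern. -/
def simulationConfig (q : Q) (t : ℕ) (u : ℤ → Q) (z : ℤ) : ZState Q :=
  if z = -t - 1 then cell q q .headRight else
    if -(t : ℤ) ≤ z ∧ z ≤ t then cell (u z) (u z) .r else .b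

theorem simulation_eventually (δ : Q → Q → Q → Q) (q : Q) (t : ℕ) (u : ℤ → Q) : ∃ s, ∀ s', s ≤ s' →
    ∃ y, (caMap (zigzag δ))^[s'] (simulationConfig q t u) 0 = cell ((caMap δ)^[t] u 0) y .r := by
  have Z : LetterZone (simulationConfig q t u) .headRight (-t - 1) (-t - 1) t
      fun z x _ => -(t : ℤ) - 1 < z → x = u z :=
    { le_head := le_rfl
      head_le := by omega
      left := fun z hz => Or.inl (by
        rw [simulationConfig, if_neg (by omega), if_neg (by omega)]; rfl)
      right := fun z hz => Or.inl (by
        rw [simulationConfig, if_neg (by omega), if_neg (by omega)]; rfl)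
      cells := fun z h1 h2 => by
        rcases h1.eq_or_lt with h1 | h1
        · refine ⟨q, q, ?_, by omega⟩
          rw [← h1, zoneMark_self, simulationConfig, if_pos rfl]
        · refine ⟨u z, u z, ?_, fun _ => rfl⟩
          rw [zoneMark_of_gt h1, simulationConfig, if_neg (by omega), if_pos (by omega)] }
  obtain ⟨s, Z'⟩ := Z.cycles (δ := δ)
  have e : LetterZone ((caMap (zigzag δ))^[s] (simulationConfig q t u)) .headRight (-1) (-1) 0
      fun z x _ => -1 < z → x = (caMap δ)^[t] u 0 :=
    Z'.mono fun z x y h1 h2 hx hz => by rw [hx hz, show z = 0 by omega]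
  obtain ⟨s₁, hs₁⟩ := e.last (δ := δ)
  refine ⟨s₁ + s, fun s' hs' => ?_⟩
  obtain ⟨k, rfl⟩ := Nat.exists_eq_add_of_le hs'
  obtain ⟨y, hy⟩ := hs₁ (s₁ + k) (by omega)
  refine ⟨y, ?_⟩
  rw [show s₁ + s + k = s₁ + k + s by omega, Function.iterate_add_apply]
  exact hy

/-- A configuration of which the simulation configuration is the description, of size linear in `t`. -/
def simulationInput (q : Q) (t : ℕ) (u : ℤ → Q) : UBPredInput (ZState Q) where
  uL := [.b]
  v := cell q q .headRight :: List.ofFn fun i : Fin t => cell (u (i - t)) (u (i - t)) .r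
  w := List.ofFn fun i : Fin (t + 1) => cell (u i) (u i) .r
  uR := [.b]
  target := .b
  uL_ne := by simp
  uR_ne := by simp

theorem simulationInput_size (q : Q) (t : ℕ) (u : ℤ → Q) : (simulationInput q t u).size = 2 * t + 4 := by
  simp only [simulationInput, UBPredInput.size, List.length_cons, List.length_nil, List.length_ofFn]
  omega

theorem simulationInput_config (q : Q) (t : ℕ) (u : ℤ → Q) :
    (simulationInput q t u).config = simulationConfig q t u := by
  funext z
  rcases z with n | n
  · change eventuallyPeriodicWord (List.ofFn fun i : Fin (t + 1) => cell (u i) (u i) .r) [.b] (by simp) n = _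
    rw [eventuallyPeriodicWord, simulationConfig]
    rw [if_neg (by change (n : ℤ) ≠ _; omega)]
    split_ifs with h h' h'
    · rw [List.getElem_ofFn]; rfl
    · rw [List.length_ofFn] at h
      exact absurd ⟨by change -(t : ℤ) ≤ (n : ℤ); omega, by change (n : ℤ) ≤ _; omega⟩ h'
    · rw [List.length_ofFn] at h
      have := h'.2
      change (n : ℤ) ≤ _ at this
      omega
    · simp
  · change eventuallyPeriodicWord (List.reverse (cell q q .headRight ::
      List.ofFn fun i : Fin t => cell (u (i - t)) (u (i - t)) .r)) [.b] (by simp) n = _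
    rw [eventuallyPeriodicWord, simulationConfig]
    split_ifs with h h' h' h' h'
    all_goals simp only [List.length_reverse, List.length_cons, List.length_ofFn] at h
    · rw [List.getElem_reverse]
      have : (List.length (cell q q .headRight ::
        List.ofFn fun i : Fin t => cell (u (i - t)) (u (i - t)) ZMark.r)) - 1 - n = 0 := by
        simp only [List.length_cons, List.length_ofFn]
        omega
      simp only [this, List.getElem_cons_zero]
    · obtain ⟨k, hk⟩ : ∃ k, t - n = k + 1 := ⟨t - n - 1, by omega⟩
      rw [List.getElem_reverse]
      have : (List.length (cell q q .headRight ::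
        List.ofFn fun i : Fin t => cell (u (i - t)) (u (i - t)) ZMark.r)) - 1 - n = k + 1 := by
        simp only [List.length_cons, List.length_ofFn]
        omega
      simp only [this, List.getElem_cons_succ, List.getElem_ofFn]
      rw [show (k : ℤ) - t = Int.negSucc n by omega]
    · omega
    · omega
    · omega
    · simp

/-- The simulation has ended after a number of steps quadratic in `t`. -/
theorem simulation (δ : Q → Q → Q → Q) (q : Q) (t : ℕ) (u : ℤ → Q) {T : ℕ}
    (hT : 1000 * (2 * t + 4) ^ 2 ≤ T) :
    ∃ y, (caMap (zigzag δ))^[T] (simulationConfig q t u) 0 = cell ((caMap δ)^[t] u 0) y .r := by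
  obtain ⟨s, hs⟩ := simulation_eventually δ q t u
  obtain ⟨y, hy⟩ := hs (max s T) (by omega)
  refine ⟨y, ?_⟩
  -- The cycles give no explicit running time. None is needed: cell 0 is constant after the
  -- stabilization time, so its state at `T` is already its state at a time when the simulation is
  -- over.
  have h := zigzag_stabilizes δ (simulationInput q t u)
  rw [simulationInput_config, simulationInput_size] at h
  rw [h T hT, ← h (max s T) (by omega), hy]

/-- The iteration on patterns computes the state of cell `0` in every extension of the pattern. -/
theorem patternIter_eq {S : Type} (f : S → S → S → S) (t : ℕ) (u : Fin (2 * t + 1) → S) (c : ℤ → S)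
    (h : ∀ i : Fin (2 * t + 1), c ((i : ℕ) - t) = u i) : patternIter f t u = (caMap f)^[t] c 0 := by
  induction t generalizing c with
  | zero => simpa [patternIter] using (h 0).symm
  | succ t ih =>
    rw [Function.iterate_succ_apply]
    refine ih _ _ fun i => ?_
    rw [caMap, patternMap, ← h, ← h, ← h]
    congr 2 <;> push_cast <;> ring

/-- The word of the simulation of a word `v`, padded by `P` cells on the left. -/
def simulationWord (q : Q) (P : ℕ) (v : List Q) : List (ZState Q) :=
  List.replicate P .b ++ (cell q q .headRight :: (v.map (fun x => cell x x .r) ++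
    (List.replicate P .b ++ [.b])))

/-- The one additional blank on the right balances the head on the left, so the middle letter of the
padded word is the middle letter of `v`. -/
theorem simulationWord_length (q : Q) (P t : ℕ) (v : List Q) (hv : v.length = 2 * t + 1) :
    (simulationWord q P v).length = 2 * (P + 1 + t) + 1 := by
  simp only [simulationWord, List.length_append, List.length_replicate, List.length_cons,
    List.length_map, List.length_nil]
  omega

theorem simulationWord_getElem (q : Q) (P t : ℕ) (v : List Q) (hv : v.length = 2 * t + 1)
    (u : ℤ → Q) (hu : ∀ (i : ℕ) (h : i < v.length), u (i - t) = v[i]) (i : ℕ)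
    (hi : i < (simulationWord q P v).length) :
    simulationConfig q t u (i - (P + 1 + t : ℕ)) = (simulationWord q P v)[i] := by
  have hi' := hi
  rw [simulationWord_length q P t v hv] at hi'
  simp only [simulationWord]
  rcases lt_trichotomy i P with h | rfl | h
  · rw [List.getElem_append_left (by simpa using h), List.getElem_replicate, simulationConfig,
      if_neg (by push_cast; omega), if_neg (by push_cast; omega)]
  · rw [List.getElem_append_right (by simp)]
    simp only [List.length_replicate, Nat.sub_self, List.getElem_cons_zero]
    rw [simulationConfig, if_pos (by push_cast; omega)]
  · obtain ⟨k, rfl⟩ := Nat.exists_eq_add_of_le (show P + 1 ≤ i by omega)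
    have e : P + 1 + k - P = k + 1 := by omega
    rw [List.getElem_append_right (by simp; omega)]
    simp only [List.length_replicate, e, List.getElem_cons_succ]
    rw [simulationConfig, if_neg (by push_cast; omega)]
    by_cases hk : k < v.length
    · rw [if_pos (by push_cast; omega), List.getElem_append_left (by simpa using hk),
        List.getElem_map, ← hu k hk]
      congr 2 <;> push_cast <;> ring
    · rw [if_neg (by push_cast; omega), List.getElem_append_right (by simpa using hk)]
      symm
      have : ∀ x ∈ List.replicate P (.b : ZState Q) ++ [.b], x = .b := by
        simp only [List.mem_append, List.mem_replicate, List.mem_singleton]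
        rintro x (h | h)
        · exact h.2
        · exact h
      exact this _ (List.getElem_mem _)

/-- The prediction problem of an automaton is an instance of that of its zigzag automaton. -/
theorem exists_simulation_input (δ : Q → Q → Q → Q) (q : Q) (i : PredInput Q) (P : ℕ)
    (hP : 1000 * (2 * i.t + 4) ^ 2 ≤ P) : ∃ j : PredInput (ZState Q),
      j.encode = simulationWord q P i.encode ∧
      ∃ y, (PRED (zigzag δ)).solution j = cell ((PRED δ).solution i) y .r := by
  have hv : i.encode.length = 2 * i.t + 1 := List.length_ofFn
  have hl := simulationWord_length q P i.t _ hv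
  refine ⟨⟨P + 1 + i.t, by omega, fun k => (simulationWord q P i.encode)[k]⟩, ?_, ?_⟩
  · refine List.ext_getElem ?_ fun k h1 h2 => ?_
    · exact (List.length_ofFn).trans hl.symm
    · simp only [PredInput.encode, List.getElem_ofFn]
      rfl
  -- The values outside the pattern are arbitrary, since `t` steps only look at `[-t, t]`.
  · let u : ℤ → Q := fun z => if h : (z + i.t).toNat < 2 * i.t + 1 then i.u ⟨_, h⟩ else q
    have hu : ∀ k : Fin (2 * i.t + 1), u ((k : ℕ) - i.t) = i.u k := fun k => by
      have e : ((k : ℕ) - (i.t : ℤ) + i.t).toNat = k := by omega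
      simp only [u, e, k.isLt, dif_pos]
    have h1 : (PRED δ).solution i = (caMap δ)^[i.t] u 0 := patternIter_eq δ i.t i.u u hu
    have h2 : patternIter (zigzag δ) (P + 1 + i.t) (fun k => (simulationWord q P i.encode)[k]) =
        (caMap (zigzag δ))^[P + 1 + i.t] (simulationConfig q i.t u) 0 :=
      patternIter_eq _ _ _ _ fun m => simulationWord_getElem q P i.t _ hv u (fun k hk => by
        rw [hv] at hk
        rw [hu ⟨k, hk⟩]
        simp only [PredInput.encode, List.getElem_ofFn]) _ (by rw [hl]; exact m.isLt)
    obtain ⟨y, hy⟩ := simulation δ q i.t u (T := P + 1 + i.t) (by omega)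
    exact ⟨y, h2.trans (hy.trans (congrArg (fun x => cell x y .r) h1.symm))⟩

end Simulation

/-! ### Combinators for transducers -/

namespace Transducer

open Relation

variable {A B : Type}

/-- One step of a computation whose work heads stay within distance `s` of the origin. -/
def BoundedStep (M : Transducer A B) (w : List A) (s : ℕ) (c c' : M.Config) : Prop :=
  M.step w c = some c' ∧ ∀ k, |c'.head k| ≤ (s : ℤ)

/-- The effect of an instruction. -/
def Config.apply {M : Transducer A B} (w : List A) (c : M.Config)
    (act : TransducerAction M.State M.K M.Sym B) : M.Config where
  state := act.next
  inputPos := moveInput w c.inputPos act.inputMove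
  head := fun k => c.head k + (act.workMove k).toInt
  tape := fun k => Function.update (c.tape k) (c.head k) (act.write k)
  output := c.output ++ act.emit.toList

theorem step_of_trans {M : Transducer A B} {w : List A} {c : M.Config}
    {act : TransducerAction M.State M.K M.Sym B}
    (h : M.trans c.state (readInput w c.inputPos) (fun k => c.tape k (c.head k)) = some act) :
    M.step w c = some (c.apply w act) :=
  Option.map_eq_some_iff.mpr ⟨act, h, rfl⟩

theorem exists_of_step {M : Transducer A B} {w : List A} {c c' : M.Config}
    (h : M.step w c = some c') : ∃ act, M.trans c.state (readInput w c.inputPos)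
      (fun k => c.tape k (c.head k)) = some act ∧ c' = c.apply w act := by
  obtain ⟨act, ha, rfl⟩ := Option.map_eq_some_iff.mp h
  exact ⟨act, ha, rfl⟩

theorem step_eq_none {M : Transducer A B} {w : List A} {c : M.Config} :
    M.step w c = none ↔ M.trans c.state (readInput w c.inputPos)
      (fun k => c.tape k (c.head k)) = none := Option.map_eq_none_iff

theorem config_ext {M : Transducer A B} {c c' : M.Config} (h₁ : c.state = c'.state)
    (h₂ : c.inputPos = c'.inputPos) (h₃ : ∀ k, c.head k = c'.head k)
    (h₄ : ∀ k, c.tape k = c'.tape k) (h₅ : c.output = c'.output) : c = c' := by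
  cases c
  cases c'
  obtain rfl : _ = _ := funext h₃
  obtain rfl : _ = _ := funext h₄
  cases h₁
  cases h₂
  cases h₅
  rfl

/-- On input `w`, the machine halts with output `v` after a computation in space `s`. -/
def Computes (M : Transducer A B) (w : List A) (s : ℕ) (v : List B) : Prop :=
  ∃ c, ReflTransGen (M.BoundedStep w s) M.init c ∧ M.step w c = none ∧ c.output = v

/-- Paths of bounded steps replace counted runs: they concatenate, and they lift along maps of
configurations, which is how machines are combined below. -/
theorem computes_of_haltsWith {M : Transducer A B} {w : List A} {s : ℕ} {v : List B}
    (h : M.HaltsWith w v) (hs : M.UsesSpace w s) : M.Computes w s v := by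
  obtain ⟨t, ht, hv⟩ := h
  refine ⟨_, ?_, ht, hv⟩
  clear ht hv
  induction t with
  | zero => exact .refl
  | succ t ih =>
    rcases hc : M.step w (M.run w t) with _ | c'
    · rw [run, hc]
      exact ih
    · have hr : M.run w (t + 1) = c' := by rw [run, hc]; rfl
      rw [hr]
      exact ih.tail ⟨hc, fun k => by rw [← hr]; exact hs _ _⟩

theorem Computes.haltsWith {M : Transducer A B} {w : List A} {s : ℕ} {v : List B}
    (h : M.Computes w s v) : M.HaltsWith w v ∧ M.UsesSpace w s := by
  obtain ⟨c, hc, hn, rfl⟩ := h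
  have key : ∀ c, ReflTransGen (M.BoundedStep w s) M.init c → ∃ t, M.run w t = c ∧
      ∀ t' ≤ t, ∀ k, |(M.run w t').head k| ≤ (s : ℤ) := by
    intro c hc
    induction hc with
    | refl =>
      refine ⟨0, rfl, fun t' ht' k => ?_⟩
      rw [Nat.le_zero.mp ht']
      change |(0 : ℤ)| ≤ _
      simp
    | @tail c c' _ hcc ih =>
      obtain ⟨t, rfl, ht⟩ := ih
      have hr : M.run w (t + 1) = c' := by rw [run, hcc.1]; rfl
      refine ⟨t + 1, hr, fun t' ht' k => ?_⟩
      rcases ht'.lt_or_eq with ht' | rfl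
      · exact ht _ (by omega) k
      · rw [hr]; exact hcc.2 k
  obtain ⟨t, rfl, ht⟩ := key c hc
  refine ⟨⟨t, hn, rfl⟩, fun t' k => ?_⟩
  rcases le_total t' t with h | h
  · exact ht _ h k
  · have : ∀ j, M.run w (t + j) = M.run w t := fun j => by
      induction j with
      | zero => rfl
      | succ j ih => rw [← add_assoc, run, ih, hn]; rfl
    obtain ⟨j, rfl⟩ := Nat.exists_eq_add_of_le h
    rw [this]
    exact ht _ le_rfl k

theorem BoundedStep.mono {M : Transducer A B} {w : List A} {s s' : ℕ} (hs : s ≤ s') {c c' : M.Config}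
    (h : M.BoundedStep w s c c') : M.BoundedStep w s' c c' :=
  ⟨h.1, fun k => (h.2 k).trans (by exact_mod_cast hs)⟩

theorem Computes.mono {M : Transducer A B} {w : List A} {s s' : ℕ} {v : List B}
    (h : M.Computes w s v) (hs : s ≤ s') : M.Computes w s' v := by
  obtain ⟨c, hc, h⟩ := h
  exact ⟨c, ReflTransGen.mono (fun _ _ => BoundedStep.mono hs) _ _ hc, h⟩

/-- A machine whose output is the letter `b`. -/
abbrev emitLetter (A : Type) (b : B) : Transducer A B where
  State := Bool
  K := Empty
  Sym := Unit
  blank := ()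
  start := false
  trans s _ _ := if s then none else some
    { next := true
      inputMove := .stay
      write := fun _ => ()
      workMove := fun _ => .stay
      emit := some b }

theorem emitLetter_computes (w : List A) (b : B) (s : ℕ) : (emitLetter A b).Computes w s [b] :=
  ⟨_, .single ⟨rfl, fun k => k.elim⟩, rfl, rfl⟩

/-- Apply a map to all letters of the output. -/
abbrev mapOutput {B' : Type} (M : Transducer A B) (g : B → B') : Transducer A B' where
  State := M.State
  K := M.K
  Sym := M.Sym
  stateFinite := M.stateFinite
  tapesFinite := M.tapesFinite
  symFinite := M.symFinite
  blank := M.blank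
  start := M.start
  trans s a r := (M.trans s a r).map fun act =>
    { next := act.next
      inputMove := act.inputMove
      write := act.write
      workMove := act.workMove
      emit := act.emit.map g }

theorem mapOutput_computes {B' : Type} {M : Transducer A B} (g : B → B') {w : List A} {s : ℕ}
    {v : List B} (h : M.Computes w s v) : (M.mapOutput g).Computes w s (v.map g) := by
  obtain ⟨c, hc, hn, rfl⟩ := h
  let φ : M.Config → (M.mapOutput g).Config := fun c =>
    { state := c.state
      inputPos := c.inputPos
      head := c.head
      tape := c.tape
      output := c.output.map g }
  have hsome : ∀ {c c'}, M.step w c = some c' → (M.mapOutput g).step w (φ c) = some (φ c') := by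
    intro c c' h
    obtain ⟨act, ha, rfl⟩ := exists_of_step h
    refine (step_of_trans (M := M.mapOutput g) (Option.map_eq_some_iff.mpr ⟨act, ha, rfl⟩)).trans ?_
    refine congrArg some (config_ext rfl rfl (fun _ => rfl) (fun _ => rfl) ?_)
    change List.map g c.output ++ (act.emit.map g).toList = List.map g (c.output ++ act.emit.toList)
    rw [List.map_append]
    cases act.emit <;> rfl
  refine ⟨φ c, hc.lift φ fun c c' h => ⟨hsome h.1, h.2⟩, ?_, rfl⟩
  exact (step_eq_none (M := M.mapOutput g)).mpr
    (Option.map_eq_none_iff.mpr (step_eq_none.mp hn))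

/-- Run `M₁`, bring the input head back to the left end, and run `M₂`. -/
abbrev seq (M₁ M₂ : Transducer A B) : Transducer A B where
  State := M₁.State ⊕ Option M₂.State
  K := M₁.K ⊕ M₂.K
  Sym := M₁.Sym × M₂.Sym
  stateFinite := have := M₁.stateFinite; have := M₂.stateFinite; inferInstance
  tapesFinite := have := M₁.tapesFinite; have := M₂.tapesFinite; inferInstance
  symFinite := have := M₁.symFinite; have := M₂.symFinite; inferInstance
  blank := (M₁.blank, M₂.blank)
  start := .inl M₁.start
  trans
    | .inl q, a, r => some <| match M₁.trans q a fun k => (r (.inl k)).1 with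
      | some act =>
        { next := .inl act.next
          inputMove := act.inputMove
          write := Sum.elim (fun k => (act.write k, (r (.inl k)).2)) fun k => r (.inr k)
          workMove := Sum.elim act.workMove fun _ => .stay
          emit := act.emit }
      | none =>
        { next := .inr none
          inputMove := .stay
          write := r
          workMove := fun _ => .stay
          emit := none }
    | .inr none, a, r => some
        { next := match a with
            | .leftEnd => .inr (some M₂.start)
            | _ => .inr none
          inputMove := match a with
            | .leftEnd => .stay
            | _ => .left
          write := r
          workMove := fun _ => .stay
          emit := none }
    | .inr (some q), a, r => (M₂.trans q a fun k => (r (.inr k)).2).map fun act =>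
        { next := .inr (some act.next)
          inputMove := act.inputMove
          write := Sum.elim (fun k => r (.inl k)) fun k => ((r (.inr k)).1, act.write k)
          workMove := Sum.elim (fun _ => .stay) act.workMove
          emit := act.emit }

section seq

variable (M₁ M₂ : Transducer A B)

/-- Configurations of `M₁.seq M₂` in which `M₁` is running. -/
def seqLeft (c : M₁.Config) : (M₁.seq M₂).Config where
  state := .inl c.state
  inputPos := c.inputPos
  head := Sum.elim c.head fun _ => 0
  tape := Sum.elim (fun k z => (c.tape k z, M₂.blank)) fun _ _ => (M₁.blank, M₂.blank)
  output := c.output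

/-- Configurations of `M₁.seq M₂` in which the input head goes back to the left. -/
def seqRewind (c : M₁.Config) (p : ℕ) : (M₁.seq M₂).Config :=
  { seqLeft M₁ M₂ c with
    state := .inr none
    inputPos := p }

/-- Configurations of `M₁.seq M₂` in which `M₂` is running. -/
def seqRight (c : M₁.Config) (c' : M₂.Config) : (M₁.seq M₂).Config where
  state := .inr (some c'.state)
  inputPos := c'.inputPos
  head := Sum.elim c.head c'.head
  tape := Sum.elim (fun k z => (c.tape k z, M₂.blank)) fun k z => (M₁.blank, c'.tape k z)
  output := c.output ++ c'.output

variable {M₁ M₂} {w : List A} {s : ℕ}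

theorem seq_step_left {c c' : M₁.Config} (h : M₁.step w c = some c') :
    (M₁.seq M₂).step w (seqLeft M₁ M₂ c) = some (seqLeft M₁ M₂ c') := by
  obtain ⟨act, ha, rfl⟩ := exists_of_step h
  refine (step_of_trans (M := M₁.seq M₂) (act :=
    { next := .inl act.next
      inputMove := act.inputMove
      write := Sum.elim (fun k => (act.write k, M₂.blank)) fun _ => (M₁.blank, M₂.blank)
      workMove := Sum.elim act.workMove fun _ => .stay
      emit := act.emit }) ?_).trans (congrArg some (config_ext rfl rfl (fun k => ?_) (fun k => ?_)
        rfl))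
  · change some (match M₁.trans c.state (readInput w c.inputPos) fun k => c.tape k (c.head k) with
      | some act => _ | none => _) = _
    rw [ha]
    rfl
  · rcases k with k | k
    · rfl
    · exact add_zero _
  · rcases k with k | k
    · funext z
      change Function.update (fun z => (c.tape k z, M₂.blank)) (c.head k)
        (act.write k, M₂.blank) z = (Function.update (c.tape k) (c.head k) (act.write k) z, _)
      by_cases hz : z = c.head k
      · subst hz
        rw [Function.update_self, Function.update_self]
      · rw [Function.update_of_ne hz, Function.update_of_ne hz]
    · exact Function.update_eq_self _ _

theorem seq_step_turn {c : M₁.Config} (h : M₁.step w c = none) :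
    (M₁.seq M₂).step w (seqLeft M₁ M₂ c) = some (seqRewind M₁ M₂ c c.inputPos) := by
  have h := step_eq_none.mp h
  refine (step_of_trans (M := M₁.seq M₂) (act :=
    { next := .inr none
      inputMove := .stay
      write := fun k => (seqLeft M₁ M₂ c).tape k ((seqLeft M₁ M₂ c).head k)
      workMove := fun _ => .stay
      emit := none }) ?_).trans (congrArg some (config_ext rfl rfl (fun k => add_zero _)
        (fun k => Function.update_eq_self _ _) (List.append_nil _)))
  change some (match M₁.trans c.state (readInput w c.inputPos) fun k => c.tape k (c.head k) with
    | some act => _ | none => _) = _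
  rw [h]

theorem seq_step_rewind {c : M₁.Config} (p : ℕ) :
    (M₁.seq M₂).step w (seqRewind M₁ M₂ c (p + 1)) = some (seqRewind M₁ M₂ c p) := by
  refine (step_of_trans (M := M₁.seq M₂) (act :=
    { next := .inr none
      inputMove := .left
      write := fun k => (seqLeft M₁ M₂ c).tape k ((seqLeft M₁ M₂ c).head k)
      workMove := fun _ => .stay
      emit := none }) ?_).trans (congrArg some (config_ext rfl rfl (fun k => add_zero _)
        (fun k => Function.update_eq_self _ _) (List.append_nil _)))
  have hr : readInput w (p + 1) ≠ .leftEnd := by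
    rw [readInput]
    split <;> simp
  change (M₁.seq M₂).trans (.inr none) (readInput w (p + 1)) _ = _
  generalize readInput w (p + 1) = a at hr
  cases a
  · exact absurd rfl hr
  · rfl
  · rfl

theorem seq_step_start {c : M₁.Config} :
    (M₁.seq M₂).step w (seqRewind M₁ M₂ c 0) = some (seqRight M₁ M₂ c M₂.init) :=
  (step_of_trans (M := M₁.seq M₂) (act :=
    { next := .inr (some M₂.start)
      inputMove := .stay
      write := fun k => (seqLeft M₁ M₂ c).tape k ((seqLeft M₁ M₂ c).head k)
      workMove := fun _ => .stay
      emit := none }) rfl).trans (congrArg some (config_ext rfl rfl (fun k => by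
        refine (add_zero _).trans ?_
        rcases k with k | k <;> rfl)
        (fun k => (Function.update_eq_self _ _).trans (by rcases k with k | k <;> rfl)) rfl))

theorem seq_step_right {c : M₁.Config} {d d' : M₂.Config} (h : M₂.step w d = some d') :
    (M₁.seq M₂).step w (seqRight M₁ M₂ c d) = some (seqRight M₁ M₂ c d') := by
  obtain ⟨act, ha, rfl⟩ := exists_of_step h
  refine (step_of_trans (M := M₁.seq M₂) (act :=
    { next := .inr (some act.next)
      inputMove := act.inputMove
      write := Sum.elim (fun k => (c.tape k (c.head k), M₂.blank)) fun k => (M₁.blank, act.write k)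
      workMove := Sum.elim (fun _ => .stay) act.workMove
      emit := act.emit }) ?_).trans (congrArg some (config_ext rfl rfl (fun k => ?_) (fun k => ?_)
        (List.append_assoc _ _ _)))
  · exact Option.map_eq_some_iff.mpr ⟨act, ha, rfl⟩
  · rcases k with k | k
    · exact add_zero _
    · rfl
  · rcases k with k | k
    · exact Function.update_eq_self _ _
    · funext z
      change Function.update (fun z => (M₁.blank, d.tape k z)) (d.head k)
        (M₁.blank, act.write k) z = (_, Function.update (d.tape k) (d.head k) (act.write k) z)
      by_cases hz : z = d.head k
      · subst hz
        rw [Function.update_self, Function.update_self]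
      · rw [Function.update_of_ne hz, Function.update_of_ne hz]

/-- The two machines work on disjoint tapes, so the second one starts with blank tapes whatever the
first left behind, and the read-only input is intact once the input head is rewound. The space bound
does not grow. -/
theorem seq_computes {v₁ v₂ : List B} (h₁ : M₁.Computes w s v₁) (h₂ : M₂.Computes w s v₂) :
    (M₁.seq M₂).Computes w s (v₁ ++ v₂) := by
  obtain ⟨c, hc, hcn, rfl⟩ := h₁
  obtain ⟨d, hd, hdn, rfl⟩ := h₂
  have hcs : ∀ k, |c.head k| ≤ (s : ℤ) := by
    cases hc with
    | refl => exact fun k => by change |(0 : ℤ)| ≤ _; simp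
    | tail _ h => exact h.2
  have hcs' : ∀ k, |(seqLeft M₁ M₂ c).head k| ≤ (s : ℤ) := by
    rintro (k | k)
    · exact hcs k
    · change |(0 : ℤ)| ≤ _; simp
  have e₁ : ReflTransGen ((M₁.seq M₂).BoundedStep w s) (M₁.seq M₂).init (seqLeft M₁ M₂ c) := by
    have e : (M₁.seq M₂).init = seqLeft M₁ M₂ M₁.init :=
      config_ext rfl rfl (by rintro (k | k) <;> rfl) (by rintro (k | k) <;> rfl) rfl
    rw [e]
    refine hc.lift _ fun c c' h => ⟨seq_step_left h.1, ?_⟩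
    rintro (k | k)
    · exact h.2 k
    · change |(0 : ℤ)| ≤ _; simp
  have e₂ : ∀ p, ReflTransGen ((M₁.seq M₂).BoundedStep w s) (seqRewind M₁ M₂ c p)
      (seqRight M₁ M₂ c M₂.init) := fun p => by
    induction p with
    | zero =>
      refine .single ⟨seq_step_start, ?_⟩
      rintro (k | k)
      · exact hcs k
      · change |(0 : ℤ)| ≤ _; simp
    | succ p ih => exact .head ⟨seq_step_rewind p, hcs'⟩ ih
  have e₃ : ReflTransGen ((M₁.seq M₂).BoundedStep w s) (seqRight M₁ M₂ c M₂.init)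
      (seqRight M₁ M₂ c d) := by
    refine hd.lift _ fun d d' h => ⟨seq_step_right h.1, ?_⟩
    rintro (k | k)
    · exact hcs k
    · exact h.2 k
  refine ⟨seqRight M₁ M₂ c d, e₁.trans (.head ⟨seq_step_turn hcn, hcs'⟩ ((e₂ _).trans e₃)), ?_, rfl⟩
  exact (step_eq_none (M := M₁.seq M₂)).mpr (Option.map_eq_none_iff.mpr (step_eq_none.mp hdn))

end seq

end Transducer

/-! ### The length of the output of a transducer -/

namespace Transducer

variable {A B : Type} {M : Transducer A B} {w : List A}

/-- Two configurations that differ at most in their output. -/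
def Config.Same (c c' : M.Config) : Prop :=
  c.state = c'.state ∧ c.inputPos = c'.inputPos ∧ c.head = c'.head ∧ c.tape = c'.tape

theorem Config.Same.trans_eq {c c' : M.Config} (h : c.Same c') :
    M.trans c.state (readInput w c.inputPos) (fun k => c.tape k (c.head k)) =
      M.trans c'.state (readInput w c'.inputPos) (fun k => c'.tape k (c'.head k)) := by
  obtain ⟨h1, h2, h3, h4⟩ := h
  rw [h1, h2, h3, h4]

theorem Config.Same.step {c c' : M.Config} (h : c.Same c') :
    ((M.step w c).getD c).Same ((M.step w c').getD c') := by
  rcases ha : M.trans c.state (readInput w c.inputPos) (fun k => c.tape k (c.head k)) with _ | act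
  · rw [step_eq_none.mpr ha, step_eq_none.mpr (h.trans_eq ▸ ha)]
    exact h
  · rw [step_of_trans ha, step_of_trans (h.trans_eq ▸ ha)]
    obtain ⟨h1, h2, h3, h4⟩ := h
    refine ⟨rfl, congrArg (moveInput w · _) h2, ?_, ?_⟩
    · change (fun k => c.head k + _) = fun k => c'.head k + _
      rw [h3]
    · change (fun k => Function.update (c.tape k) (c.head k) _) =
        fun k => Function.update (c'.tape k) (c'.head k) _
      rw [h3, h4]

theorem run_same {i j : ℕ} (h : (M.run w i).Same (M.run w j)) (k : ℕ) :
    (M.run w (i + k)).Same (M.run w (j + k)) := by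
  induction k with
  | zero => exact h
  | succ k ih => exact ih.step

theorem run_inputPos_le (t : ℕ) : (M.run w t).inputPos ≤ w.length + 1 := by
  induction t with
  | zero => exact Nat.zero_le _
  | succ t ih =>
    rcases hc : M.step w (M.run w t) with _ | c'
    · rw [run, hc]; exact ih
    · obtain ⟨act, -, rfl⟩ := exists_of_step hc
      rw [run, hc]
      change moveInput w _ _ ≤ _
      cases act.inputMove
      · exact (Nat.sub_le _ _).trans ih
      · exact ih
      · exact min_le_right _ _

theorem run_tape_eq_blank {s : ℕ} (hs : M.UsesSpace w s) (t : ℕ) (k : M.K) (z : ℤ) (hz : s < |z|) :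
    (M.run w t).tape k z = M.blank := by
  induction t with
  | zero => rfl
  | succ t ih =>
    rcases hc : M.step w (M.run w t) with _ | c'
    · rw [run, hc]; exact ih
    · obtain ⟨act, -, rfl⟩ := exists_of_step hc
      rw [run, hc]
      change Function.update ((M.run w t).tape k) ((M.run w t).head k) _ z = _
      rw [Function.update_of_ne, ih]
      rintro rfl
      exact absurd (hs t k) (not_le.mpr hz)

theorem run_output_length_le (t : ℕ) : (M.run w t).output.length ≤ t := by
  induction t with
  | zero => exact le_rfl
  | succ t ih =>
    rcases hc : M.step w (M.run w t) with _ | c'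
    · rw [run, hc]; exact ih.trans (Nat.le_succ t)
    · obtain ⟨act, -, rfl⟩ := exists_of_step hc
      rw [run, hc]
      change ((M.run w t).output ++ _).length ≤ _
      rw [List.length_append]
      have : act.emit.toList.length ≤ 1 := by cases act.emit <;> simp
      omega

theorem run_of_halted {t : ℕ} (h : M.step w (M.run w t) = none) (j : ℕ) :
    M.run w (t + j) = M.run w t := by
  induction j with
  | zero => rfl
  | succ j ih => rw [← add_assoc, run, ih, h]; rfl

/-- A computation in space `s` visits each configuration at most once, up to the output. -/
theorem output_length_le {v : List B} {s : ℕ} (h : M.HaltsWith w v) (hs : M.UsesSpace w s) :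
    v.length ≤ Nat.card M.State * ((w.length + 2) * ((2 * s + 1) ^ Nat.card M.K *
      (Nat.card M.Sym ^ (2 * s + 1)) ^ Nat.card M.K)) := by
  classical
  have := M.stateFinite
  have := M.tapesFinite
  have := M.symFinite
  have hex : ∃ t, M.step w (M.run w t) = none := h.imp fun _ => And.left
  set t := Nat.find hex with ht
  have hhalt : M.step w (M.run w t) = none := Nat.find_spec hex
  have hv : v = (M.run w t).output := by
    obtain ⟨t', ht', rfl⟩ := h
    obtain ⟨j, rfl⟩ := Nat.exists_eq_add_of_le (Nat.find_min' hex ht')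
    rw [run_of_halted hhalt]
  -- Beyond distance `s` the tapes are blank, so these finite data determine a configuration up to
  -- its output.
  let φ : Fin (t + 1) → M.State × Fin (w.length + 2) × (M.K → Fin (2 * s + 1)) ×
      (M.K → Fin (2 * s + 1) → M.Sym) := fun i =>
    ((M.run w i).state, ⟨(M.run w i).inputPos, Nat.lt_succ_of_le (run_inputPos_le _)⟩,
      fun k => ⟨((M.run w i).head k + s).toNat, by
        have := abs_le.mp (hs i k)
        omega⟩,
      fun k z => (M.run w i).tape k ((z : ℕ) - s))
  have hφ : ∀ i j, φ i = φ j → (M.run w i).Same (M.run w j) := by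
    intro i j hij
    simp only [φ, Prod.mk.injEq, Fin.mk.injEq] at hij
    obtain ⟨h1, h2, h3, h4⟩ := hij
    refine ⟨h1, h2, funext fun k => ?_, funext fun k => funext fun z => ?_⟩
    · have h3 := congrFun h3 k
      simp only [Fin.mk.injEq] at h3
      have := abs_le.mp (hs i k)
      have := abs_le.mp (hs j k)
      omega
    · by_cases hz : |z| ≤ s
      · have hz := abs_le.mp hz
        have := congrFun (congrFun h4 k) ⟨(z + s).toNat, by omega⟩
        simp only at this
        rwa [show (((z + s).toNat : ℕ) : ℤ) - s = z by omega] at this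
      · rw [run_tape_eq_blank hs _ _ _ (not_le.mp hz), run_tape_eq_blank hs _ _ _ (not_le.mp hz)]
  -- If time `i` looked like the later time `j`, then the `t - j` steps from `j` to the first
  -- halting time could be copied from `i`, and the machine would halt before `t`.
  have hlt : ∀ i j : Fin (t + 1), i < j → φ i ≠ φ j := by
    intro i j hij he
    have hj : (j : ℕ) + (t - j) = t := by omega
    have hsame := run_same (hφ i j he) (t - j)
    rw [hj] at hsame
    have hn := step_eq_none.mp hhalt
    rw [← hsame.trans_eq] at hn
    have := Nat.find_min' hex (step_eq_none.mpr hn)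
    have : (i : ℕ) < j := hij
    omega
  have hinj : Function.Injective φ := by
    intro i j he
    rcases lt_trichotomy i j with h | h | h
    · exact absurd he (hlt i j h)
    · exact h
    · exact absurd he.symm (hlt j i h)
  have hcard := Nat.card_le_card_of_injective φ hinj
  simp only [Nat.card_prod, Nat.card_fun, Nat.card_fin] at hcard
  rw [hv]
  exact (run_output_length_le t).trans ((Nat.le_succ t).trans hcard)

/-- The output of a machine working in logarithmic space has polynomial length. -/
theorem exists_output_length_le (M : Transducer A B) (C : ℕ) : ∃ a, ∀ (w : List A) (v : List B),
    M.HaltsWith w v → M.UsesSpace w (C * (Nat.log 2 w.length + 1)) →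
    v.length ≤ a ^ (Nat.log 2 w.length + 1) := by
  -- Each factor of the number of configurations is at most a constant to the power `ℓ = log |w| +
  -- 1`: for the input position the constant is 4, and one tape with its head position contributes
  -- `(2 * (card Sym + 1)) ^ (2 * C + 1)`.
  refine ⟨(Nat.card M.State + 1) * (4 * ((2 * (Nat.card M.Sym + 1)) ^ (2 * C + 1)) ^ Nat.card M.K),
    fun w v hv hs => ?_⟩
  refine (output_length_le hv hs).trans ?_
  set ℓ := Nat.log 2 w.length + 1 with hℓ
  have h1 : Nat.card M.State ≤ (Nat.card M.State + 1) ^ ℓ :=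
    (Nat.le_succ _).trans (Nat.le_self_pow (by omega) _)
  have h2 : w.length + 2 ≤ 4 ^ ℓ := by
    have h : w.length < 2 ^ ℓ := Nat.lt_pow_succ_log_self (by omega) _
    have h' : 2 ≤ 2 ^ ℓ := Nat.le_self_pow (by omega) _
    have : (4 : ℕ) ^ ℓ = 2 ^ ℓ * 2 ^ ℓ := by rw [← mul_pow]; norm_num
    nlinarith
  have h3 : (2 * (C * ℓ) + 1) * Nat.card M.Sym ^ (2 * (C * ℓ) + 1) ≤
      ((2 * (Nat.card M.Sym + 1)) ^ (2 * C + 1)) ^ ℓ := by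
    have hle : 2 * (C * ℓ) + 1 ≤ (2 * C + 1) * ℓ := by
      have : 1 ≤ ℓ := by omega
      nlinarith
    calc (2 * (C * ℓ) + 1) * Nat.card M.Sym ^ (2 * (C * ℓ) + 1)
        ≤ 2 ^ (2 * (C * ℓ) + 1) * (Nat.card M.Sym + 1) ^ (2 * (C * ℓ) + 1) :=
          Nat.mul_le_mul Nat.lt_two_pow_self.le (Nat.pow_le_pow_left (Nat.le_succ _) _)
      _ = (2 * (Nat.card M.Sym + 1)) ^ (2 * (C * ℓ) + 1) := (mul_pow _ _ _).symm
      _ ≤ (2 * (Nat.card M.Sym + 1)) ^ ((2 * C + 1) * ℓ) := Nat.pow_le_pow_right (by omega) hle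
      _ = _ := pow_mul _ _ _
  rw [← mul_pow (2 * (C * ℓ) + 1), mul_pow (Nat.card M.State + 1), mul_pow 4, ← pow_mul _ (Nat.card M.K) ℓ,
    mul_comm (Nat.card M.K) ℓ, pow_mul]
  exact Nat.mul_le_mul h1 (Nat.mul_le_mul h2 (Nat.pow_le_pow_left h3 _))

end Transducer

/-! ### A machine whose output is long -/

namespace Transducer

open Relation

/-- The states of a machine that counts: at the beginning, going back to the first digit, and
incrementing.  The Boolean tells whether it counts the letters of the input in base two or the letters of
its output in a larger base. -/
inductive PadState where
  | mark
  | first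
  | back (emitting : Bool)
  | inc (emitting : Bool)
  deriving DecidableEq

instance : Fintype PadState where
  elems := {.mark, .first, .back true, .back false, .inc true, .inc false}
  complete s := by rcases s with _ | _ | _ | _ <;> first | decide | (rename_i b; cases b <;> decide)

/-- The base of the counter. -/
def padBase (a : ℕ) : Bool → ℕ
  | true => a + 2
  | false => 2

theorem padBase_le (a : ℕ) (ph : Bool) : padBase a ph ≤ a + 2 := by
  cases ph <;> simp [padBase]

/-- Count the letters of the input in base two, on a work tape; then, starting with the resulting digits,
count in base `a + 2` until overflow, with one letter `x` of output for each increment. -/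
abbrev padder (A : Type) {B : Type} (a : ℕ) (x : B) : Transducer A B where
  State := PadState
  K := Unit
  Sym := Option (Option (Fin (a + 2)))
  blank := none
  start := .mark
  trans
    | .mark, _, _ => some ⟨.first, .stay, fun _ => some none, fun _ => .right, none⟩
    | .first, _, _ => some ⟨.back false, .stay, fun _ => some (some 0), fun _ => .left, none⟩
    | .back ph, i, r => match r () with
      | some (some _) => some ⟨.back ph, .stay, r, fun _ => .left, none⟩
      | _ => match ph, i with
        | true, _ => some ⟨.inc true, .stay, r, fun _ => .right, some x⟩
        | false, .rightEnd => some ⟨.back true, .stay, r, fun _ => .stay, none⟩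
        | false, _ => some ⟨.inc false, .right, r, fun _ => .right, none⟩
    | .inc ph, _, r => match r () with
      | some (some d) =>
        if h : d.val + 1 < padBase a ph then
          some ⟨.back ph, .stay, fun _ => some (some ⟨d.val + 1, h.trans_le (padBase_le a ph)⟩),
            fun _ => .left, none⟩
        else some ⟨.inc ph, .stay, fun _ => some (some 0), fun _ => .right, none⟩
      | _ => match ph with
        | true => none
        | false => some ⟨.back false, .stay, fun _ => some (some 1), fun _ => .left, none⟩

section padder

variable {A B : Type} {a : ℕ} {x : B} {w : List A} {s : ℕ}

/-- A tape with a marker at `0`, followed by digits. -/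
def digitTape (L : List (Fin (a + 2))) (z : ℤ) : Option (Option (Fin (a + 2))) :=
  if z = 0 then some none else if 0 < z then L[(z - 1).toNat]?.map some else none

theorem digitTape_zero (L : List (Fin (a + 2))) : digitTape L 0 = some none := if_pos rfl

theorem digitTape_succ (L : List (Fin (a + 2))) (k : ℕ) :
    digitTape L (k + 1) = L[k]?.map some := by
  rw [digitTape, if_neg (by omega), if_pos (by omega)]
  congr 2
  omega

theorem update_digitTape_set (L : List (Fin (a + 2))) {k : ℕ} (hk : k < L.length) (d : Fin (a + 2)) :
    Function.update (digitTape L) (k + 1) (some (some d)) = digitTape (L.set k d) := by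
  funext z
  rcases eq_or_ne z (k + 1) with rfl | hz
  · rw [Function.update_self, digitTape_succ, List.getElem?_set_self hk]; rfl
  · rw [Function.update_of_ne hz, digitTape, digitTape]
    split_ifs with h1 h2
    · rfl
    · rw [List.getElem?_set_ne (by omega)]
    · rfl

theorem update_digitTape_append (L : List (Fin (a + 2))) (d : Fin (a + 2)) :
    Function.update (digitTape L) (L.length + 1) (some (some d)) = digitTape (L ++ [d]) := by
  funext z
  rcases eq_or_ne z (L.length + 1) with rfl | hz
  · rw [Function.update_self, digitTape_succ, List.getElem?_concat_length]; rfl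
  · rw [Function.update_of_ne hz, digitTape, digitTape]
    split_ifs with h1 h2
    · rfl
    · rcases lt_or_ge (z - 1).toNat L.length with h | h
      · rw [List.getElem?_append_left h]
      · rw [List.getElem?_eq_none h, List.getElem?_eq_none (by
          rw [List.length_append, List.length_singleton]; omega)]
    · rfl

variable (A a x) in
/-- The configurations of the machine. -/
def padConfig (q : PadState) (p : ℕ) (h : ℤ) (L : List (Fin (a + 2))) (out : List B) :
    (padder A a x).Config where
  state := q
  inputPos := p
  head := fun _ => h
  tape := fun _ => digitTape L
  output := out

theorem padder_step {q : PadState} {p : ℕ} {h : ℤ} {L : List (Fin (a + 2))} {out : List B}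
    {act : TransducerAction PadState Unit (Option (Option (Fin (a + 2)))) B}
    (hact : (padder A a x).trans q (readInput w p) (fun _ => digitTape L h) = some act)
    {L' : List (Fin (a + 2))} (hL : Function.update (digitTape L) h (act.write ()) = digitTape L')
    {h' : ℤ} (hh : h + (act.workMove ()).toInt = h') (hs : |h'| ≤ s) :
    (padder A a x).BoundedStep w s (padConfig A a x q p h L out)
      (padConfig A a x act.next (moveInput w p act.inputMove) h' L' (out ++ act.emit.toList)) := by
  refine ⟨(step_of_trans (c := padConfig A a x q p h L out) hact).trans (congrArg some
    (config_ext rfl rfl (fun _ => hh) (fun _ => hL) rfl)), fun _ => hs⟩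

/-- The head goes back to the marker. -/
theorem padder_back (ph : Bool) (p : ℕ) (L : List (Fin (a + 2))) (out : List B) (k : ℕ)
    (hk : k ≤ L.length) (hs : k ≤ s) : ReflTransGen ((padder A a x).BoundedStep w s)
      (padConfig A a x (.back ph) p k L out) (padConfig A a x (.back ph) p 0 L out) := by
  induction k with
  | zero => exact .refl
  | succ k ih =>
    have hr : digitTape L ((k + 1 : ℕ) : ℤ) = some (some L[k]) := by
      push_cast
      rw [digitTape_succ, List.getElem?_eq_getElem (by omega)]; rfl
    refine .head ?_ (ih (by omega) (by omega))
    have := padder_step (A := A) (x := x) (w := w) (s := s) (q := .back ph) (p := p) (out := out)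
      (h := (k + 1 : ℕ)) (L := L) (L' := L) (h' := k) (act := ⟨.back ph, .stay,
      fun _ => digitTape L ((k + 1 : ℕ) : ℤ), fun _ => .left, none⟩) ?_ ?_ ?_ ?_
    · simpa [moveInput] using this
    · change (match digitTape L ((k + 1 : ℕ) : ℤ) with | some (some _) => _ | _ => _) = _
      rw [hr]
    · exact Function.update_eq_self _ _
    · change ((k + 1 : ℕ) : ℤ) + -1 = k
      push_cast; ring
    · rw [abs_le]; omega

/-- Increment a number written in base `b`, without change of the number of digits. -/
def incr (b : ℕ) (hb : b ≤ a + 2) : List (Fin (a + 2)) → Option (List (Fin (a + 2)))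
  | [] => none
  | d :: L => if h : d.val + 1 < b then some (⟨d.val + 1, h.trans_le hb⟩ :: L)
      else (incr b hb L).map (0 :: ·)

theorem padder_carry {ph : Bool} {p : ℕ} {out : List B} (pre L : List (Fin (a + 2)))
    (d : Fin (a + 2)) (hd : ¬ d.val + 1 < padBase a ph) (hs : pre.length + 2 ≤ s) :
    (padder A a x).BoundedStep w s
      (padConfig A a x (.inc ph) p (pre.length + 1) (pre ++ d :: L) out)
      (padConfig A a x (.inc ph) p ((pre ++ [0]).length + 1) (pre ++ [0] ++ L) out) := by
  have hr : digitTape (pre ++ d :: L) (pre.length + 1) = some (some d) := by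
    rw [digitTape_succ]; simp
  have := padder_step (A := A) (x := x) (w := w) (s := s) (q := .inc ph) (p := p) (out := out)
    (h := (pre.length + 1)) (L := pre ++ d :: L) (L' := pre ++ [0] ++ L)
    (h' := (pre ++ [0]).length + 1) (act := ⟨.inc ph, .stay, fun _ => some (some 0),
      fun _ => .right, none⟩) ?_ ?_ ?_ ?_
  · simpa [moveInput] using this
  · change (match digitTape (pre ++ d :: L) (pre.length + 1) with
      | some (some d) => (if h : d.val + 1 < padBase a ph then _ else _) | _ => _) = _
    rw [hr]
    change (dite _ _ _) = _
    rw [dif_neg hd]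
  · refine (update_digitTape_set _ (by simp) _).trans ?_
    simp
  · change ((pre.length : ℤ) + 1) + 1 = _
    rw [List.length_append, List.length_singleton]
    push_cast; ring
  · rw [abs_le, List.length_append, List.length_singleton]
    push_cast; omega

theorem padder_inc_some {ph : Bool} {p : ℕ} {out : List B} (pre L L' : List (Fin (a + 2)))
    (hL : incr (padBase a ph) (padBase_le a ph) L = some L') (hs : pre.length + L.length + 1 ≤ s) :
    ReflTransGen ((padder A a x).BoundedStep w s)
      (padConfig A a x (.inc ph) p (pre.length + 1) (pre ++ L) out)
      (padConfig A a x (.back ph) p 0 (pre ++ L') out) := by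
  induction L generalizing pre L' with
  | nil => cases hL
  | cons d L ih =>
    rw [List.length_cons] at hs
    rw [incr] at hL
    split_ifs at hL with hd
    · cases hL
      have hr : digitTape (pre ++ d :: L) (pre.length + 1) = some (some d) := by
        rw [digitTape_succ]; simp
      refine .head ?_ (padder_back ph p _ out pre.length (by simp) (by omega))
      have := padder_step (A := A) (x := x) (w := w) (s := s) (q := .inc ph) (p := p) (out := out)
        (h := (pre.length + 1)) (L := pre ++ d :: L)
        (L' := pre ++ ⟨d.val + 1, hd.trans_le (padBase_le a ph)⟩ :: L)
        (h' := pre.length) (act := ⟨.back ph, .stay,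
          fun _ => some (some ⟨d.val + 1, hd.trans_le (padBase_le a ph)⟩),
          fun _ => .left, none⟩) ?_ ?_ ?_ ?_
      · simpa [moveInput] using this
      · change (match digitTape (pre ++ d :: L) (pre.length + 1) with
          | some (some d) => (if h : d.val + 1 < padBase a ph then _ else _) | _ => _) = _
        rw [hr]
        change (dite _ _ _) = _
        rw [dif_pos hd]
      · refine (update_digitTape_set _ (by simp) _).trans ?_
        simp
      · exact add_neg_cancel_right _ _
      · rw [abs_le]; omega
    · obtain ⟨L'', hL'', rfl⟩ := Option.map_eq_some_iff.mp hL
      refine .head (padder_carry pre L d hd (by omega)) ?_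
      have := ih (pre ++ [0]) L'' hL'' (by rw [List.length_append, List.length_singleton]; omega)
      rw [List.append_assoc pre [0] L''] at this
      exact this

theorem padder_inc_none {ph : Bool} {p : ℕ} {out : List B} (pre L : List (Fin (a + 2)))
    (hL : incr (padBase a ph) (padBase_le a ph) L = none) (hs : pre.length + L.length + 1 ≤ s) :
    ReflTransGen ((padder A a x).BoundedStep w s)
      (padConfig A a x (.inc ph) p (pre.length + 1) (pre ++ L) out)
      (padConfig A a x (.inc ph) p ((pre.length + L.length : ℕ) + 1)
        (pre ++ List.replicate L.length 0) out) := by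
  induction L generalizing pre with
  | nil => exact .refl
  | cons d L ih =>
    rw [List.length_cons] at hs
    rw [incr] at hL
    split_ifs at hL with hd
    refine .head (padder_carry pre L d hd (by omega)) ?_
    have := ih (pre ++ [0]) (Option.map_eq_none_iff.mp hL)
      (by rw [List.length_append, List.length_singleton]; omega)
    rw [List.append_assoc pre [0] (List.replicate _ _)] at this
    have e : (pre ++ [0]).length + L.length = pre.length + (d :: L).length := by
      rw [List.length_append, List.length_singleton, List.length_cons]; omega
    rw [e] at this
    exact this

/-- The number with the given digits, from the least significant one, in base `b`. -/
def digitValue (b : ℕ) : List (Fin (a + 2)) → ℕ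
  | [] => 0
  | d :: L => d + b * digitValue b L

theorem digitValue_lt {b : ℕ} : ∀ L : List (Fin (a + 2)), (∀ d ∈ L, d.val < b) →
    digitValue b L < b ^ L.length
  | [], _ => by simp [digitValue]
  | d :: L, h => by
    have h1 := digitValue_lt L fun d hd => h d (List.mem_cons_of_mem _ hd)
    have h2 := h d List.mem_cons_self
    rw [digitValue, List.length_cons, pow_succ]
    nlinarith

theorem incr_some {b : ℕ} {hb : b ≤ a + 2} : ∀ {L L' : List (Fin (a + 2))}, incr b hb L = some L' →
    (∀ d ∈ L, d.val < b) → digitValue b L' = digitValue b L + 1 ∧ L'.length = L.length ∧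
      ∀ d ∈ L', d.val < b
  | [], _, h, _ => by cases h
  | d :: L, L', h, hL => by
    rw [incr] at h
    split_ifs at h with hd
    · cases h
      refine ⟨?_, rfl, ?_⟩
      · rw [digitValue, digitValue]
        change d.val + 1 + _ = _
        ring
      · intro d' hd'
        rcases List.mem_cons.mp hd' with rfl | hd'
        · exact hd
        · exact hL d' (List.mem_cons_of_mem _ hd')
    · obtain ⟨L'', hL'', rfl⟩ := Option.map_eq_some_iff.mp h
      obtain ⟨h1, h2, h3⟩ := incr_some hL'' fun d hd => hL d (List.mem_cons_of_mem _ hd)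
      have hd' := hL d List.mem_cons_self
      refine ⟨?_, by rw [List.length_cons, List.length_cons, h2], ?_⟩
      · rw [digitValue, digitValue, h1]
        change 0 + _ = _
        rw [mul_add]
        omega
      · intro d' hd'
        rcases List.mem_cons.mp hd' with rfl | hd'
        · change 0 < b
          omega
        · exact h3 d' hd'

theorem incr_none {b : ℕ} {hb : b ≤ a + 2} : ∀ {L : List (Fin (a + 2))}, incr b hb L = none →
    (∀ d ∈ L, d.val < b) → digitValue b L + 1 = b ^ L.length
  | [], _, _ => by simp [digitValue]
  | d :: L, h, hL => by
    rw [incr] at h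
    split_ifs at h with hd
    have h1 := incr_none (Option.map_eq_none_iff.mp h) fun d hd => hL d (List.mem_cons_of_mem _ hd)
    have hd' := hL d List.mem_cons_self
    rw [digitValue, List.length_cons, pow_succ, ← h1]
    have : d.val + 1 = b := by omega
    rw [← this]
    ring

theorem digitValue_replicate (b n : ℕ) :
    digitValue b (List.replicate n (0 : Fin (a + 2)) ++ [1]) = b ^ n := by
  induction n with
  | zero => simp [digitValue]
  | succ n ih =>
    rw [List.replicate_succ, List.cons_append, digitValue, ih, pow_succ']
    exact zero_add _

/-- Digits 0 and 1, read in the larger base `a + 2`, form a number far below the overflow: at least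
`a ^ length` increments remain. -/
theorem digitValue_add_pow_le (ha : 1 ≤ a) : ∀ L : List (Fin (a + 2)), (∀ d ∈ L, d.val < 2) →
    digitValue (a + 2) L + a ^ L.length ≤ (a + 2) ^ L.length
  | [], _ => by simp [digitValue]
  | d :: L, h => by
    have h1 := digitValue_add_pow_le ha L fun d hd => h d (List.mem_cons_of_mem _ hd)
    have h2 := h d List.mem_cons_self
    have h3 : 0 < a ^ L.length := Nat.pow_pos ha
    rw [digitValue, List.length_cons, pow_succ', pow_succ']
    nlinarith [Nat.mul_le_mul_left (a + 2) h1]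

theorem padder_trans_emit (i : InputSymbol A) {r : Unit → Option (Option (Fin (a + 2)))}
    (hr : r () = some none) : (padder A a x).trans (.back true) i r =
      some ⟨.inc true, .stay, r, fun _ => .right, some x⟩ := by
  change (match r () with | some (some _) => _ | _ => _) = _
  rw [hr]

theorem padder_trans_count {i : InputSymbol A} (hi : i ≠ .rightEnd)
    {r : Unit → Option (Option (Fin (a + 2)))} (hr : r () = some none) :
    (padder A a x).trans (.back false) i r =
      some ⟨.inc false, .right, r, fun _ => .right, none⟩ := by
  change (match r () with | some (some _) => _ | _ => _) = _
  rw [hr]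
  cases i
  · rfl
  · rfl
  · exact absurd rfl hi

theorem padder_trans_rightEnd {r : Unit → Option (Option (Fin (a + 2)))} (hr : r () = some none) :
    (padder A a x).trans (.back false) .rightEnd r =
      some ⟨.back true, .stay, r, fun _ => .stay, none⟩ := by
  change (match r () with | some (some _) => _ | _ => _) = _
  rw [hr]

theorem padder_emit_letter (p : ℕ) (L : List (Fin (a + 2))) (out : List B) (hs : 1 ≤ s) :
    (padder A a x).BoundedStep w s (padConfig A a x (.back true) p 0 L out)
      (padConfig A a x (.inc true) p (([] : List (Fin (a + 2))).length + 1) L (out ++ [x])) := by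
  have := padder_step (A := A) (x := x) (w := w) (s := s) (q := .back true) (p := p) (out := out)
    (h := 0) (L := L) (L' := L) (h' := 1) (act := ⟨.inc true, .stay,
    fun _ => digitTape L 0, fun _ => .right, some x⟩) ?_ ?_ ?_ ?_
  · simpa [moveInput] using this
  · exact padder_trans_emit _ (digitTape_zero L)
  · exact Function.update_eq_self _ _
  · rfl
  · rw [abs_le]; omega

/-- Emit letters until overflow. -/
theorem padder_emit (p : ℕ) (k : ℕ) (L : List (Fin (a + 2))) (out : List B)
    (hk : digitValue (a + 2) L + (k + 1) = (a + 2) ^ L.length) (hs : L.length + 1 ≤ s) :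
    ReflTransGen ((padder A a x).BoundedStep w s) (padConfig A a x (.back true) p 0 L out)
      (padConfig A a x (.inc true) p (L.length + 1) (List.replicate L.length 0)
        (out ++ List.replicate (k + 1) x)) := by
  induction k generalizing L out with
  | zero =>
    refine .head (padder_emit_letter p L out (by omega)) ?_
    rcases hL : incr (padBase a true) (padBase_le a true) L with _ | L'
    · simpa using padder_inc_none (A := A) (x := x) (w := w) (s := s) (p := p) (out := out ++ [x])
        [] L hL (by simpa using hs)
    · obtain ⟨h1, h2, -⟩ := incr_some (b := a + 2) hL fun d _ => d.isLt
      have hlt := digitValue_lt L' fun d _ => d.isLt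
      rw [h2] at hlt
      omega
  | succ k ih =>
    refine .head (padder_emit_letter p L out (by omega)) ?_
    rcases hL : incr (padBase a true) (padBase_le a true) L with _ | L'
    · have hv := incr_none (b := a + 2) hL fun d _ => d.isLt
      omega
    · obtain ⟨h1, h2, -⟩ := incr_some (b := a + 2) hL fun d _ => d.isLt
      refine (padder_inc_some [] L L' hL (by simpa using hs)).trans ?_
      have := ih L' (out ++ [x]) (by rw [h1, h2]; omega) (by omega)
      rw [h2, List.append_assoc] at this
      exact this

/-- The beginning of the computation. -/
theorem padder_start (hs : 1 ≤ s) : ReflTransGen ((padder A a x).BoundedStep w s)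
    (padder A a x).init (padConfig A a x (.back false) 0 0 [0] []) := by
  have h1 : (padder A a x).BoundedStep w s (padder A a x).init (padConfig A a x .first 0 1 [] []) := by
    refine ⟨(step_of_trans (c := (padder A a x).init) rfl).trans (congrArg some
      (config_ext rfl rfl (fun _ => rfl) (fun _ => ?_) rfl)), fun _ => ?_⟩
    · funext z
      change Function.update (fun _ : ℤ => (none : Option (Option (Fin (a + 2))))) 0 (some none) z =
        digitTape [] z
      rcases eq_or_ne z 0 with rfl | hz
      · rfl
      · rw [Function.update_of_ne hz, digitTape, if_neg hz]
        split_ifs <;> rfl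
    · change |(1 : ℤ)| ≤ s
      rw [abs_one]; omega
  refine .head h1 (.single ?_)
  exact padder_step (A := A) (x := x) (w := w) (s := s) (q := .first) (p := 0) (out := [])
    (h := 1) (L := []) (L' := [0]) (h' := 0) (act := ⟨.back false, .stay,
    fun _ => some (some 0), fun _ => .left, none⟩) rfl (update_digitTape_append [] 0) rfl (by simp)

/-- The digits that count the first `p` symbols of the input. -/
structure Counted (p : ℕ) (L : List (Fin (a + 2))) : Prop where
  lt_two : ∀ d ∈ L, d.val < 2
  value : digitValue 2 L = p
  ne_nil : L ≠ []
  length_le : 2 ^ (L.length - 1) ≤ max 1 p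

/-- The clause `length_le` says that no digit is wasted, which keeps the counter within logarithmic
space. It has `max 1 p` because zero is written with one digit. -/
theorem Counted.length_le_log {p n : ℕ} {L : List (Fin (a + 2))} (h : Counted p L) (hp : p ≤ n + 1) :
    L.length ≤ Nat.log 2 n + 2 := by
  have h1 : n < 2 ^ (Nat.log 2 n + 1) := Nat.lt_pow_succ_log_self (by omega) n
  have h2 := h.length_le
  have h3 : 2 ^ (L.length - 1) ≤ 2 ^ (Nat.log 2 n + 1) := by omega
  have := (Nat.pow_le_pow_iff_right (by omega)).mp h3
  omega

/-- Counting a symbol of the input. -/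
theorem padder_count_symbol {p : ℕ} (hp : p ≤ w.length) {L : List (Fin (a + 2))} (hL : Counted p L)
    (hs : Nat.log 2 w.length + 3 ≤ s) : ∃ L' : List (Fin (a + 2)), Counted (p + 1) L' ∧
      ReflTransGen ((padder A a x).BoundedStep w s) (padConfig A a x (.back false) p 0 L [])
        (padConfig A a x (.back false) (p + 1) 0 L' []) := by
  have hlen := hL.length_le_log (n := w.length) (by omega)
  have first : (padder A a x).BoundedStep w s (padConfig A a x (.back false) p 0 L [])
      (padConfig A a x (.inc false) (p + 1) (([] : List (Fin (a + 2))).length + 1) L []) := by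
    have hr : readInput w p ≠ .rightEnd := by
      rcases p with _ | p
      · simp [readInput]
      · rw [readInput, List.getElem?_eq_getElem (by omega)]
        simp
    have := padder_step (A := A) (x := x) (w := w) (s := s) (q := .back false) (p := p) (out := [])
      (h := 0) (L := L) (L' := L) (h' := 1) (act := ⟨.inc false, .right,
      fun _ => digitTape L 0, fun _ => .right, none⟩) ?_ ?_ ?_ ?_
    · rw [show moveInput w p .right = p + 1 from min_eq_left (by omega)] at this
      exact this
    · exact padder_trans_count hr (digitTape_zero L)
    · exact Function.update_eq_self _ _
    · rfl
    · rw [abs_le]; omega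
  have hne := List.length_pos_iff.mpr hL.ne_nil
  rcases hi : incr (padBase a false) (padBase_le a false) L with _ | L'
  · have hv := incr_none (b := 2) hi hL.lt_two
    rw [hL.value] at hv
    refine ⟨List.replicate L.length 0 ++ [1], ⟨?_, ?_, by simp, ?_⟩, .head first
      ((padder_inc_none [] L hi (by simp; omega)).trans (.head ?_
        (padder_back false (p + 1) _ [] L.length (by simp) (by omega))))⟩
    · intro d hd
      rcases List.mem_append.mp hd with hd | hd
      · rw [List.eq_of_mem_replicate hd]; exact Nat.zero_lt_two
      · rw [List.mem_singleton.mp hd]; exact Nat.one_lt_two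
    · rw [digitValue_replicate, hv]
    · rw [List.length_append, List.length_replicate, List.length_singleton, Nat.add_sub_cancel, ← hv]
      omega
    · have := padder_step (A := A) (x := x) (w := w) (s := s) (q := .inc false) (p := p + 1) (out := [])
        (h := (List.replicate L.length (0 : Fin (a + 2))).length + 1)
        (L := List.replicate L.length 0) (L' := List.replicate L.length 0 ++ [1]) (h' := L.length)
        (act := ⟨.back false, .stay, fun _ => some (some 1), fun _ => .left, none⟩) ?_
        (update_digitTape_append _ _) ?_ ?_
      · simpa [moveInput] using this
      · change (match digitTape (List.replicate L.length (0 : Fin (a + 2))) (_ + 1) with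
          | some (some _) => _ | _ => _) = _
        rw [digitTape_succ, List.getElem?_eq_none le_rfl]
        rfl
      · rw [List.length_replicate]
        exact add_neg_cancel_right _ _
      · rw [abs_le]; omega
  · obtain ⟨h1, h2, h3⟩ := incr_some (b := 2) hi hL.lt_two
    refine ⟨L', ⟨h3, by rw [h1, hL.value], ?_, ?_⟩, .head first
      (padder_inc_some [] L L' hi (by simp; omega))⟩
    · rw [← List.length_pos_iff, h2]; exact hne
    · rw [h2]
      exact hL.length_le.trans (by omega)

theorem padder_count (hs : Nat.log 2 w.length + 3 ≤ s) (p : ℕ) (hp : p ≤ w.length + 1) :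
    ∃ L : List (Fin (a + 2)), Counted p L ∧ ReflTransGen ((padder A a x).BoundedStep w s)
      (padder A a x).init (padConfig A a x (.back false) p 0 L []) := by
  induction p with
  | zero =>
    exact ⟨[0], ⟨by simp, rfl, by simp, by simp⟩, padder_start (by omega)⟩
  | succ p ih =>
    obtain ⟨L, hL, h⟩ := ih (by omega)
    obtain ⟨L', hL', h'⟩ := padder_count_symbol (A := A) (x := x) (by omega) hL hs
    exact ⟨L', hL', h.trans h'⟩

/-- Counting the left end marker and the letters gives `|w| + 1` in base two, hence more than `log
|w|` and at most `log |w| + 2` digits. Restarting from these digits in base `a + 2` emits one letter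
per increment until overflow. The exact number emitted is irrelevant; it depends only on `w`. -/
theorem padder_computes (ha : 1 ≤ a) (w : List A) : ∃ P, a ^ (Nat.log 2 w.length + 1) ≤ P ∧
    (padder A a x).Computes w (3 * (Nat.log 2 w.length + 1)) (List.replicate P x) := by
  set s := 3 * (Nat.log 2 w.length + 1) with hs
  obtain ⟨L, hL, hpath⟩ := padder_count (A := A) (a := a) (x := x) (w := w) (s := s) (by omega)
    (w.length + 1) le_rfl
  have hlen := hL.length_le_log le_rfl
  have hlog : Nat.log 2 w.length < L.length := by
    have := digitValue_lt L hL.lt_two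
    rw [hL.value] at this
    exact Nat.log_lt_of_lt_pow' (by have := List.length_pos_iff.mpr hL.ne_nil; omega) (by omega)
  have hpow : a ^ (Nat.log 2 w.length + 1) ≤ a ^ L.length := Nat.pow_le_pow_right ha hlog
  have hval := digitValue_add_pow_le ha L hL.lt_two
  have hpos : 0 < a ^ L.length := Nat.pow_pos ha
  obtain ⟨k, hk⟩ : ∃ k, digitValue (a + 2) L + (k + 1) = (a + 2) ^ L.length :=
    ⟨(a + 2) ^ L.length - digitValue (a + 2) L - 1, by omega⟩
  refine ⟨k + 1, by omega, _, hpath.trans (.head ?_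
    (padder_emit (w.length + 1) k L [] hk (by omega))), ?_, by simp [padConfig]⟩
  · have hr : readInput w (w.length + 1) = .rightEnd := by
      rw [readInput, List.getElem?_eq_none le_rfl]
    have := padder_step (A := A) (x := x) (w := w) (s := s) (q := .back false) (p := w.length + 1)
      (out := []) (h := 0) (L := L) (L' := L) (h' := 0) (act := ⟨.back true, .stay,
      fun _ => digitTape L 0, fun _ => .stay, none⟩) ?_ ?_ ?_ ?_
    · simpa [moveInput] using this
    · rw [hr]
      exact padder_trans_rightEnd (digitTape_zero L)
    · exact Function.update_eq_self _ _
    · rfl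
    · simp
  · refine step_eq_none.mpr ?_
    change (match digitTape (List.replicate L.length (0 : Fin (a + 2))) (L.length + 1) with
      | some (some _) => _ | _ => _) = _
    rw [digitTape_succ, List.getElem?_eq_none (by simp)]
    rfl

end padder

end Transducer

/-! ### The main theorem -/

section MainTheorem

variable {Q : Type}

instance [Finite Q] : Finite (ZState Q) := by
  have : Finite (Option (Option (Option (Q × Q × Fin 4)))) := inferInstance
  refine Finite.of_surjective (fun s : Option (Option (Option (Q × Q × Fin 4))) => match s with
    | none => ZState.b
    | some none => ZState.bPlus
    | some (some none) => ZState.e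
    | some (some (some (x, y, 0))) => .cell x y .headLeft
    | some (some (some (x, y, 1))) => .cell x y .headRight
    | some (some (some (x, y, 2))) => .cell x y .l
    | some (some (some (x, y, 3))) => .cell x y .r) ?_
  rintro (_ | _ | _ | ⟨x, y, _ | _ | _ | _⟩)
  · exact ⟨none, rfl⟩
  · exact ⟨some none, rfl⟩
  · exact ⟨some (some none), rfl⟩
  · exact ⟨some (some (some (x, y, 0))), rfl⟩
  · exact ⟨some (some (some (x, y, 1))), rfl⟩
  · exact ⟨some (some (some (x, y, 2))), rfl⟩
  · exact ⟨some (some (some (x, y, 3))), rfl⟩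

instance : Nonempty (ZState Q) := ⟨.b⟩

/-- The words of simulations, sufficiently padded, are computed in logarithmic space. -/
theorem exists_simulationWord_transducer {A : Type} (q : Q) (M : Transducer A Q) (C : ℕ) :
    ∃ (M' : Transducer A (ZState Q)) (C' : ℕ), ∀ (w : List A) (i : PredInput Q),
      M.HaltsWith w i.encode → M.UsesSpace w (C * (Nat.log 2 w.length + 1)) →
      ∃ P, 1000 * (2 * i.t + 4) ^ 2 ≤ P ∧ M'.HaltsWith w (simulationWord q P i.encode) ∧
        M'.UsesSpace w (C' * (Nat.log 2 w.length + 1)) := by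
  obtain ⟨a, ha⟩ := M.exists_output_length_le C
  -- If `2 * t + 1 ≤ a ^ ℓ`, then `1000 * (2 * t + 4) ^ 2 ≤ 16000 * (2 * t + 1) ^ 2`, which is at
  -- most the `ℓ`-th power of this base.
  let pad : Transducer A (ZState Q) := .padder A (16000 * (a + 1) ^ 2) .b
  -- The machine `pad` runs twice on the same input, and being deterministic it prints the same
  -- number of blanks on both sides; the final letter is the balancing blank.
  refine ⟨pad.seq ((Transducer.emitLetter A (.cell q q .headRight)).seq
    ((M.mapOutput fun x => .cell x x .r).seq (pad.seq (Transducer.emitLetter A .b)))), C + 3,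
    fun w i hM hs => ?_⟩
  set ℓ := Nat.log 2 w.length + 1 with hℓ
  have hpos : 1 ≤ 16000 * (a + 1) ^ 2 := Nat.mul_pos (by omega) (Nat.pow_pos (by omega))
  obtain ⟨P, hP, hpad⟩ := Transducer.padder_computes (x := (.b : ZState Q)) hpos w
  refine ⟨P, le_trans ?_ hP, ?_⟩
  · have hlen : i.encode.length ≤ a ^ ℓ := ha w _ hM hs
    rw [show i.encode.length = 2 * i.t + 1 from List.length_ofFn] at hlen
    have h1 : a ^ ℓ ≤ (a + 1) ^ ℓ := Nat.pow_le_pow_left (by omega) _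
    have h2 : 16000 ≤ 16000 ^ ℓ := Nat.le_self_pow (by omega) _
    calc 1000 * (2 * i.t + 4) ^ 2 ≤ 1000 * (4 * (2 * i.t + 1)) ^ 2 :=
          Nat.mul_le_mul_left _ (Nat.pow_le_pow_left (by omega) _)
      _ = 16000 * (2 * i.t + 1) ^ 2 := by ring
      _ ≤ 16000 ^ ℓ * ((a + 1) ^ ℓ) ^ 2 := Nat.mul_le_mul h2 (Nat.pow_le_pow_left (by omega) _)
      _ = (16000 * (a + 1) ^ 2) ^ ℓ := by rw [mul_pow, ← pow_mul, ← pow_mul, mul_comm 2 ℓ]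
  · have hpad' := hpad.mono (show 3 * ℓ ≤ (C + 3) * ℓ from Nat.mul_le_mul_right _ (by omega))
    have hM' := (Transducer.computes_of_haltsWith hM hs).mono
      (show C * ℓ ≤ (C + 3) * ℓ from Nat.mul_le_mul_right _ (by omega))
    exact (Transducer.seq_computes hpad' (Transducer.seq_computes
      (Transducer.emitLetter_computes w _ _) (Transducer.seq_computes
        (Transducer.mapOutput_computes _ hM') (Transducer.seq_computes hpad'
          (Transducer.emitLetter_computes w _ _))))).haltsWith

/-- The problems that reduce to the prediction of an automaton reduce to that of its zigzag automaton. -/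
theorem Problem.LogReduces.pred_zigzag {X : Problem} [Nonempty X.Input] {δ : Q → Q → Q → Q}
    (h : X.LogReduces (PRED δ)) : X.LogReduces (PRED (zigzag δ)) := by
  obtain ⟨ρ, ⟨M, C, hM⟩, σ, hσ⟩ := h
  let i₀ : PredInput Q := ρ (Classical.arbitrary X.Input)
  -- The head cell needs some letter of `Q`; one is available from the image of any input.
  let q : Q := i₀.u ⟨0, by omega⟩
  obtain ⟨M', C', hM'⟩ := exists_simulationWord_transducer q M C
  have key : ∀ i, ∃ j : PredInput (ZState Q),
      (M'.HaltsWith (X.encode i) j.encode ∧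
        M'.UsesSpace (X.encode i) (C' * (Nat.log 2 (X.encode i).length + 1))) ∧
      ∃ y, (PRED (zigzag δ)).solution j = .cell ((PRED δ).solution (ρ i)) y .r := by
    intro i
    obtain ⟨P, hP, hh, hs⟩ := hM' (X.encode i) (ρ i) (hM i).1 (hM i).2
    obtain ⟨j, hj, hy⟩ := exists_simulation_input δ q (ρ i) P hP
    exact ⟨j, ⟨hj ▸ hh, hs⟩, hy⟩
  choose ρ' hρ' y hy using key
  -- The result is the first letter of the final cell. The other states never occur as answers here,
  -- and their value is a default.
  let σ' : ZState Q → X.Answer := fun s => match s with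
    | .cell x _ _ => σ x
    | _ => σ q
  exact ⟨ρ', ⟨M', C', hρ'⟩, σ', fun i => (hσ i).trans (congrArg σ' (hy i)).symm⟩

end MainTheorem

theorem mainTheorem1 {Q : Type} [Finite Q] (δ : Q → Q → Q → Q) :
    (∃ C : ℕ, ∀ (i : UBPredInput (ZState Q)) (t : ℕ), C * i.size ^ 2 ≤ t →
      (caMap (zigzag δ))^[t] i.config 0 = (caMap (zigzag δ))^[C * i.size ^ 2] i.config 0) ∧
    (UBPRED (zigzag δ)).PolyTime ∧
    ((PRED δ).PComplete → (PRED (zigzag δ)).PComplete) :=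
  ⟨⟨1000, zigzag_stabilizes δ⟩, ubpred_polyTime (zigzag δ) 1000 (zigzag_stabilizes δ), fun h =>
    ⟨pred_polyTime (zigzag δ), fun L hL =>
      have : Nonempty (Problem.ofLanguage L).Input := inferInstanceAs (Nonempty (List Bool))
      (h.2 L hL).pred_zigzag⟩⟩
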